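/- **Setting.** Let $\mathcal S,\mathcal A$ be finite nonempty sets and consider a discounted Markov decision process with transition kernel $\mathcal P(s'\mid s,a)$, cost $c(s,a)$ and discount factor $\gamma\in[0,1)$. Let $\Delta$ be the probability simplex over $\mathcal A$, and let $\|\cdot\|$ be a norm on $\mathbb R^{\mathcal A}$ with $\max_{p\in\Delta}\|p\|\le 1$ and dual norm $\|\cdot\|_*$. For each $s$ let $p\mapsto h^{p}(s)$ be a convex regularizer on $\Delta$ with $h^{p}(s)-h^{p'}(s)\le M_h\|p-p'\|$ for all $p,p'\in\Delta$ ($M_h\ge0$). For a policy $\pi$ (so $\pi(\cdot|s)\in\Delta$ for every $s$) let $$V^\pi(s)=\mathbb E\Big[\sum_{t\ge0}\gamma^t\big(c(s_t,a_t)+h^{\pi(\cdot|s_t)}(s_t)\big)\,\Big|\,s_0=s\Big],$$ where $a_t\sim\pi(\cdot|s_t)$ and $s_{t+1}\sim\mathcal P(\cdot|s_t,a_t)$; let $Q^\pi(s,a)$ be the same expectation given $s_0=s,a_0=a$, and let $$\psi^\pi(s,p)=\langle Q^\pi(s,\cdot),p\rangle-V^\pi(s)+h^p(s)-h^{\pi(\cdot|s)}(s).$$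 Let $\pi^*$ be an optimal policy, i.e. $V^{\pi^*}(s)\le V^\pi(s)$ for all policies $\pi$ and all $s$. Let $\omega$ be continuous and $1$-strongly convex on $\Delta$ with respect to $\|\cdot\|$, and let $D(q,p)=\omega(p)-\omega(q)-\langle\nabla\omega(q),p-q\rangle$ be Bregman's distance (gradients are taken relative to $\Delta$). **Algorithm.** Fix $k\ge1$, $\alpha>0$ and $\eta_t=\alpha/\sqrt k$. Stochastic policy mirror descent starts from a deterministic policy $\pi_0$ and sets, for every $s$ and $0\le t<k$, $$\pi_{t+1}(\cdot|s)\in\operatorname{argmin}_{p\in\Delta}\big\{\eta_t[\langle\tilde Q_t(s,\cdot),p\rangle+h^p(s)]+D(\pi_t(\cdot|s),p)\big\},$$ where $\tilde Q_t$ is a random estimate of $Q^{\pi_t}$. It is understood that $\omega$ is differentiable relative to $\Delta$ at the points $\pi_t(\cdot|s)$, $t<k$, so that the subproblems are defined. Let $(\mathcal F_t)$ be a filtration ($\mathcal F_t$ is the information available before $\tilde Q_t$ is drawn), such that $\pi_t$ is $\mathcal F_t$-measurable and $\tilde Q_t$ is $\mathcal F_{t+1}$-measurable. Let $\bar D_0>0$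 satisfy $D(\pi_0(\cdot|s),p)\le\bar D_0$ for all $s$ and all $p\in\Delta$. Define $$V^{*k}(s)=\tfrac1k\sum_{t<k}V^{\pi_t}(s),\qquad G^k(s)=\tfrac1k\max_{p\in\Delta}\Big\{-\sum_{t<k}\psi^{\pi_t}(s,p)\Big\},$$ and let $\bar V^k,\tilde G^k$ be the same quantities with $Q^{\pi_t}(s,\cdot)$ replaced by $\tilde Q_t(s,\cdot)$ and $V^{\pi_t}(s)$ replaced by $\langle\tilde Q_t(s,\cdot),\pi_t(\cdot|s)\rangle$. **(a) In expectation.** Suppose that for some $\varsigma,\sigma,\bar Q\ge0$, almost surely for all $t<k$ and all $s$, $$\|\mathbb E[\tilde Q_t(s,\cdot)\mid\mathcal F_t]-Q^{\pi_t}(s,\cdot)\|_*\le\varsigma,$$ $$\mathbb E[\|\tilde Q_t(s,\cdot)-Q^{\pi_t}(s,\cdot)\|_*^2\mid\mathcal F_t]\le\sigma^2,\qquad \mathbb E[\|\tilde Q_t(s,\cdot)\|_*^2\mid\mathcal F_t]\le\bar Q^2.$$ Then $V^{*k}(s),G^k(s),\bar V^k(s),\tilde G^k(s)$ are integrable and,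 for all $s\in\mathcal S$, $$\mathbb E[V^{*k}(s)-V^{\pi^*}(s)]\le(1-\gamma)^{-1}\max_q\mathbb E[G^k(q)]\le\frac{\alpha^{-1}\bar D_0+\alpha(\bar Q^2+M_h^2)+2\varsigma\sqrt k}{(1-\gamma)^2\sqrt k},$$ $$\mathbb E|V^{*k}(s)-\bar V^k(s)|\le\frac{\sigma}{\sqrt k}+\varsigma,$$ $$\mathbb E|G^k(s)-\tilde G^k(s)|\le\frac{\alpha^{-1}\bar D_0+\alpha\sigma^2+4\sqrt{\sigma^2+k\varsigma^2}}{\sqrt k}.$$ **(b) With high probability.** Suppose instead that for some $\varsigma\ge0$ and $\sigma,\bar Q>0$ the first (bias) bound of (a) holds and, almost surely for all $t<k$ and all $s$, $$\mathbb E[\exp\{\|\tilde Q_t(s,\cdot)-Q^{\pi_t}(s,\cdot)\|_*^2/\sigma^2\}\mid\mathcal F_t]\le2,\qquad \mathbb E[\exp\{\|\tilde Q_t(s,\cdot)\|_*^2/\bar Q^2\}\mid\mathcal F_t]\le2,$$ and that $\varsigma\le\sigma/k$. Then for every $\delta\in(0,1]$: $$\Pr\{V^{*k}(s)-V^{\pi^*}(s)\le(1-\gamma)^{-1}\max_qG^k(q)\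 \ \forall s\in\mathcal S\}=1,$$ $$\Pr\Big\{(1-\gamma)^{-1}\max_qG^k(q)>\tfrac{\alpha^{-1}\bar D_0+2\alpha(\bar Q^2+M_h^2)+12\alpha(\bar Q^2/\sqrt k+\sigma^2)\log(4|\mathcal S|/\delta)+\alpha^{-1}}{(1-\gamma)^2\sqrt k}\Big\}\le\delta,$$ $$\Pr\Big\{\exists s\in\mathcal S:\ |V^{*k}(s)-\bar V^k(s)|>\sigma\sqrt{\tfrac{3\log(2|\mathcal S|/\delta)}{k}}\Big\}\le\delta,$$ $$\Pr\Big\{\exists s\in\mathcal S:\ |G^k(s)-\tilde G^k(s)|>\tfrac{2(\alpha^{-1}\bar D_0+\alpha\sigma^2)+4\sigma\sqrt{3\log(8|\mathcal S|/\delta)}+24\alpha\sigma^2\log(16|\mathcal S|/\delta)}{\sqrt k}\Big\}\le\delta.$$ -/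

import Mathlib

open MeasureTheory

namespace SPMD

noncomputable section

/-- A finite discounted Markov decision process with cost `c`, discount factor `γ`, transition
kernel `P s a s'` (the probability of moving to `s'` from `s` under action `a`), and a policy
regularizer `h s p`, a function of the state `s` and of the distribution `p` over actions. -/
structure MDP (S A : Type*) [Fintype S] where
  P : S → A → S → ℝ
  P_nonneg : ∀ s a s', 0 ≤ P s a s'
  P_sum : ∀ s a, ∑ s', P s a s' = 1
  c : S → A → ℝ
  h : S → (A → ℝ) → ℝ
  γ : ℝ
  γ_nonneg : 0 ≤ γ
  γ_lt_one : γ < 1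

variable {S A : Type*} [Fintype S] [Fintype A]

/-- `π s a` is the probability of selecting action `a` at state `s`. -/
def IsPolicy (π : S → A → ℝ) : Prop := ∀ s, π s ∈ stdSimplex ℝ A

/-- The inner product over the action space. -/
def dot (x y : A → ℝ) : ℝ := ∑ a, x a * y a

/-- The law of `(s_t, a_t)` when `(s_0, a_0)` has law `init`, `s_{t+1} ∼ P(· | s_t, a_t)` and
`a_{t+1} ∼ π(· | s_{t+1})`. -/
def stateActionLaw (M : MDP S A) (π : S → A → ℝ) (init : S → A → ℝ) : ℕ → S → A → ℝ
  | 0 => init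
  | t + 1 => fun s' a' =>
      (∑ s, ∑ a, stateActionLaw M π init t s a * M.P s a s') * π s' a'

/-- The expected discounted regularized cost `∑ₜ γ^t E[c(s_t, a_t) + h^{π(·|s_t)}(s_t)]` when
`(s_0, a_0)` has law `init`. -/
def discountedCost (M : MDP S A) (π : S → A → ℝ) (init : S → A → ℝ) : ℝ :=
  ∑' t : ℕ, M.γ ^ t *
    ∑ s, ∑ a, stateActionLaw M π init t s a * (M.c s a + M.h s (π s))

open scoped Classical in
/-- The action-value function `Q^π(s, a)`: start from `s_0 = s`, `a_0 = a`. -/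
def qValue (M : MDP S A) (π : S → A → ℝ) (s : S) (a : A) : ℝ :=
  discountedCost M π (fun s' a' => if s' = s ∧ a' = a then 1 else 0)

open scoped Classical in
/-- The state-value function `V^π(s)`: start from `s_0 = s`, `a_0 ∼ π(· | s)`. -/
def value (M : MDP S A) (π : S → A → ℝ) (s : S) : ℝ :=
  discountedCost M π (fun s' a' => if s' = s then π s' a' else 0)

/-- `πstar` is an optimal policy: it minimizes the value at every state simultaneously. -/
def IsOptimal (M : MDP S A) (πstar : S → A → ℝ) : Prop :=
  IsPolicy πstar ∧ ∀ π, IsPolicy π → ∀ s, value M πstar s ≤ value M π s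

/-- The advantage `⟨Q(s,·), p⟩ - V(s) + h^p(s) - h^{π(·|s)}(s)` at a state `s`, built from given
(exact or estimated) values `q = Q(s,·)` and `v = V(s)`. -/
def advantage (M : MDP S A) (π : S → A → ℝ) (q : A → ℝ) (v : ℝ) (s : S) (p : A → ℝ) : ℝ :=
  dot q p - v + M.h s p - M.h s (π s)

/-- The averaged value `k⁻¹ ∑_{t<k} V^{π_t}(s)`. -/
def avgValue (M : MDP S A) (k : ℕ) (π : ℕ → S → A → ℝ) (s : S) : ℝ :=
  (k : ℝ)⁻¹ * ∑ t ∈ Finset.range k, value M (π t) s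

/-- The noisy averaged value `k⁻¹ ∑_{t<k} ⟨Q̃_t(s,·), π_t(·|s)⟩`. -/
def noisyAvgValue (k : ℕ) (π Qt : ℕ → S → A → ℝ) (s : S) : ℝ :=
  (k : ℝ)⁻¹ * ∑ t ∈ Finset.range k, dot (Qt t s) (π t s)

/-- The averaged advantage gap `k⁻¹ max_{p ∈ Δ} {-∑_{t<k} ψ^{π_t}(s, p)}`. -/
def avgGap (M : MDP S A) (k : ℕ) (π : ℕ → S → A → ℝ) (s : S) : ℝ :=
  (k : ℝ)⁻¹ * sSup ((fun p => -∑ t ∈ Finset.range k,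
    advantage M (π t) (qValue M (π t) s) (value M (π t) s) s p) '' stdSimplex ℝ A)

/-- The noisy averaged advantage gap, where `Q^{π_t}(s,·)` is replaced by `Q̃_t(s,·)` and
`V^{π_t}(s)` by `⟨Q̃_t(s,·), π_t(·|s)⟩`. -/
def noisyAvgGap (M : MDP S A) (k : ℕ) (π Qt : ℕ → S → A → ℝ) (s : S) : ℝ :=
  (k : ℝ)⁻¹ * sSup ((fun p => -∑ t ∈ Finset.range k,
    advantage M (π t) (Qt t s) (dot (Qt t s) (π t s)) s p) '' stdSimplex ℝ A)

/-- The seminorm `N` is a norm on `ℝ^A` and it is at most one on the probability simplex. -/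
structure IsSimplexNorm (N : Seminorm ℝ (A → ℝ)) : Prop where
  eq_zero : ∀ x, N x = 0 → x = 0
  le_one : ∀ p ∈ stdSimplex ℝ A, N p ≤ 1

/-- The dual norm `max {⟨z, x⟩ : N x ≤ 1}`. -/
def dualNorm (N : Seminorm ℝ (A → ℝ)) (z : A → ℝ) : ℝ :=
  sSup ((fun x => dot z x) '' {x | N x ≤ 1})

/-- `w` is a distance generating function on the simplex: continuous and `1`-strongly convex with
respect to the norm `N`. -/
structure IsDGF (N : Seminorm ℝ (A → ℝ)) (w : (A → ℝ) → ℝ) : Prop where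
  continuousOn : ContinuousOn w (stdSimplex ℝ A)
  strongConvex : ∀ x ∈ stdSimplex ℝ A, ∀ y ∈ stdSimplex ℝ A, ∀ a b : ℝ, 0 ≤ a → 0 ≤ b →
    a + b = 1 → w (a • x + b • y) ≤ a * w x + b * w y - a * b / 2 * N (x - y) ^ 2

/-- Bregman's distance `D(q, p) = w(p) - w(q) - ⟨∇w(q), p - q⟩` on the simplex. The gradient is
taken relative to the simplex; for `p`, `q` in the simplex the number `⟨∇w(q), p - q⟩` is then
uniquely determined as soon as `w` is differentiable at `q` relative to the simplex. -/
def bregman (w : (A → ℝ) → ℝ) (q p : A → ℝ) : ℝ :=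
  w p - w q - fderivWithin ℝ w (stdSimplex ℝ A) q (p - q)

/-- The first `k` steps of stochastic policy mirror descent with constant step size `η`, started
at `π0` and fed with the estimates `Qt t` of the action-value functions. The distance generating
function has to be differentiable, relative to the simplex, at the iterates where Bregman's
distance is used as prox-function. -/
structure IsRun (M : MDP S A) (w : (A → ℝ) → ℝ) (η : ℝ) (k : ℕ) (π0 : S → A → ℝ)
    (π Qt : ℕ → S → A → ℝ) : Prop where
  init : π 0 = π0
  policy : ∀ t ≤ k, IsPolicy (π t)
  differentiable : ∀ t < k, ∀ s, DifferentiableWithinAt ℝ w (stdSimplex ℝ A) (π t s)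
  update : ∀ t < k, ∀ s,
    IsMinOn (fun p => η * (dot (Qt t s) p + M.h s p) + bregman w (π t s) p)
      (stdSimplex ℝ A) (π (t + 1) s)

variable {Ω : Type*} [mΩ : MeasurableSpace Ω]

/-- `X` is integrable and `E[X | m] ≤ b` almost surely. -/
def CondExpLE (μ : Measure Ω) (m : MeasurableSpace Ω) (X : Ω → ℝ) (b : ℝ) : Prop :=
  Integrable X μ ∧ ∀ᵐ x ∂μ, (μ[X | m]) x ≤ b

/-- The bias bound `‖E[Q̃_t | ℱ_t] - Q^{π_t}‖_* ≤ ς`, at every state and for all `t < k`. Here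
`ℱ t` is the information available before the `t`-th estimate `Q̃_t` is drawn. -/
def BiasBound (M : MDP S A) (N : Seminorm ℝ (A → ℝ)) (μ : Measure Ω) (ℱ : Filtration ℕ mΩ)
    (k : ℕ) (π Qt : ℕ → Ω → S → A → ℝ) (ς : ℝ) : Prop :=
  ∀ t < k, ∀ s, ∀ᵐ x ∂μ,
    dualNorm N (fun a => (μ[fun y => Qt t y s a | ℱ t]) x - qValue M (π t x) s a) ≤ ς

/-- Second-moment noise assumption. -/
structure NoiseL2 (M : MDP S A) (N : Seminorm ℝ (A → ℝ)) (μ : Measure Ω) (ℱ : Filtration ℕ mΩ)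
    (k : ℕ) (π Qt : ℕ → Ω → S → A → ℝ) (ς σ Qbar : ℝ) : Prop where
  ς_nonneg : 0 ≤ ς
  σ_nonneg : 0 ≤ σ
  Qbar_nonneg : 0 ≤ Qbar
  bias : BiasBound M N μ ℱ k π Qt ς
  variance : ∀ t < k, ∀ s,
    CondExpLE μ (ℱ t) (fun x => dualNorm N (Qt t x s - qValue M (π t x) s) ^ 2) (σ ^ 2)
  second_moment : ∀ t < k, ∀ s,
    CondExpLE μ (ℱ t) (fun x => dualNorm N (Qt t x s) ^ 2) (Qbar ^ 2)

/-- Light-tail noise assumption. -/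
structure NoiseExp (M : MDP S A) (N : Seminorm ℝ (A → ℝ)) (μ : Measure Ω) (ℱ : Filtration ℕ mΩ)
    (k : ℕ) (π Qt : ℕ → Ω → S → A → ℝ) (ς σ Qbar : ℝ) : Prop where
  ς_nonneg : 0 ≤ ς
  σ_pos : 0 < σ
  Qbar_pos : 0 < Qbar
  bias : BiasBound M N μ ℱ k π Qt ς
  variance : ∀ t < k, ∀ s,
    CondExpLE μ (ℱ t)
      (fun x => Real.exp (dualNorm N (Qt t x s - qValue M (π t x) s) ^ 2 / σ ^ 2)) 2
  second_moment : ∀ t < k, ∀ s,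
    CondExpLE μ (ℱ t) (fun x => Real.exp (dualNorm N (Qt t x s) ^ 2 / Qbar ^ 2)) 2

end

end SPMD

/-! The performance difference identity turns the averaged optimality gap `f = V^{*k} - V^{π*}` into
a solution of `f = g + γ P^{π*} f`, where `g(s) = -k⁻¹ ∑ ψ^{π_t}(s, π*(·|s))` (`value_sub_value`,
`avgValue_sub_eq`). The maximum principle `le_of_le_add_transition` gives `f ≤ (1-γ)⁻¹ max g`, and
`g ≤ G^k` by definition. Conversely `G^k ≤ f`, because optimality forces `-ψ^π(s,p) ≤ V^π(s) -
V^{π*}(s)` for every `p` (`IsOptimal.neg_advantage_le`). So a bound on `g` controls everything: the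
data-dependent maximizer inside `G^k` is traded for the fixed comparator `π*`, at the price of a
second factor `(1-γ)⁻¹`.

The regret bound of mirror descent for the estimated costs (`IsRun.regret_le`) bounds `k g` by `D0/η
+ η ∑ (‖Q̃_t‖_*² + M_h²)` plus the noise sum `∑ ⟨Q̃_t - Q^{π_t}, π* - π_t⟩`.

For `G^k - G̃^k` no fixed comparator is available: `∑ ⟨±noise, p - π_t⟩` must be bounded uniformly
in `p`. The point `p` is replaced by a follow-the-regularized-leader sequence driven by the past
noise, with regularizer `D(π_0, ·)`. Its regret (`IsDGF.leader_regret_le`) pays for the replacement,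
and the sequence is predictable. Unlike a second mirror descent, it needs no differentiability of
`w` at its own iterates.

What remains are sums `∑ ⟨noise_t, y_t⟩` with `y_t` measurable for `ℱ t` and `N (y_t) ≤ 1` or `2`.
In expectation they are handled by the bias bound and by orthogonality of martingale differences
(`exists_martingale_bound`). In probability, `measureReal_sqrt_lt_abs_sum_le` combines
Cauchy-Schwarz for large deviations with a Chernoff bound for moderate ones, and union bounds over
states conclude. -/

namespace SPMD

open Filter Topology

/-! ### The pairing on the action space -/

section Dot

variable {A : Type*} [Fintype A]

lemma dot_add_left (x y z : A → ℝ) : dot (x + y) z = dot x z + dot y z :=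
  add_dotProduct x y z

lemma dot_add_right (x y z : A → ℝ) : dot x (y + z) = dot x y + dot x z :=
  dotProduct_add x y z

lemma dot_sub_left (x y z : A → ℝ) : dot (x - y) z = dot x z - dot y z :=
  sub_dotProduct x y z

lemma dot_sub_right (x y z : A → ℝ) : dot x (y - z) = dot x y - dot x z :=
  dotProduct_sub x y z

lemma dot_neg_left (x y : A → ℝ) : dot (-x) y = -dot x y :=
  neg_dotProduct x y

lemma dot_smul_left (c : ℝ) (x y : A → ℝ) : dot (c • x) y = c * dot x y :=
  smul_dotProduct c x y

lemma dot_smul_right (c : ℝ) (x y : A → ℝ) : dot x (c • y) = c * dot x y :=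
  dotProduct_smul c x y

lemma dot_sum_left {ι : Type*} (s : Finset ι) (f : ι → A → ℝ) (y : A → ℝ) :
    dot (∑ i ∈ s, f i) y = ∑ i ∈ s, dot (f i) y :=
  sum_dotProduct s f y

lemma dot_zero_left (y : A → ℝ) : dot 0 y = 0 := zero_dotProduct y

lemma continuous_dot : Continuous fun z : (A → ℝ) × (A → ℝ) => dot z.1 z.2 := by
  unfold dot; fun_prop

lemma abs_dot_le_norm (z : A → ℝ) {p : A → ℝ} (hp : p ∈ stdSimplex ℝ A) : |dot z p| ≤ ‖z‖ := by
  calc |dot z p| ≤ ∑ a, |z a * p a| := Finset.abs_sum_le_sum_abs _ _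
    _ ≤ ∑ a, ‖z‖ * p a := by
        refine Finset.sum_le_sum fun a _ => ?_
        rw [abs_mul, abs_of_nonneg (hp.1 a)]
        exact mul_le_mul_of_nonneg_right (norm_le_pi_norm z a) (hp.1 a)
    _ = ‖z‖ := by rw [← Finset.mul_sum, hp.2, mul_one]

end Dot

/-! ### The norm and its dual -/

section Norm

variable {A : Type*} [Fintype A] {N : Seminorm ℝ (A → ℝ)}

lemma IsSimplexNorm.le_card_mul_norm (hN : IsSimplexNorm N) (x : A → ℝ) :
    N x ≤ Fintype.card A * ‖x‖ := by
  classical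
  have hx : x = ∑ a, x a • (Pi.single a 1 : A → ℝ) := by
    ext b; simp [Finset.sum_apply, Pi.single_apply]
  calc N x = N (∑ a, x a • (Pi.single a 1 : A → ℝ)) := by rw [← hx]
    _ ≤ ∑ a, N (x a • (Pi.single a 1 : A → ℝ)) :=
        Finset.le_sum_of_subadditive N (map_zero N).le (map_add_le_add N) _ _
    _ ≤ ∑ _a : A, ‖x‖ := by
        refine Finset.sum_le_sum fun a _ => ?_
        rw [map_smul_eq_mul]
        calc ‖x a‖ * N (Pi.single a 1) ≤ ‖x‖ * 1 := by
              gcongr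
              · exact norm_le_pi_norm x a
              · exact hN.le_one _ (single_mem_stdSimplex ℝ a)
          _ = ‖x‖ := mul_one _
    _ = Fintype.card A * ‖x‖ := by simp

lemma IsSimplexNorm.continuous (hN : IsSimplexNorm N) : Continuous N := by
  refine (LipschitzWith.of_dist_le_mul (K := (Fintype.card A : NNReal)) fun x y => ?_).continuous
  rw [Real.dist_eq, dist_eq_norm]
  calc |N x - N y| ≤ N (x - y) := abs_sub_map_le_sub N x y
    _ ≤ _ := by simpa using hN.le_card_mul_norm (x - y)

/-- On the compact unit sphere of the sup norm, `N` attains a positive minimum. The sphere is empty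
when `A` is, hence the case split. -/
lemma IsSimplexNorm.exists_norm_le (hN : IsSimplexNorm N) :
    ∃ C : ℝ, 0 < C ∧ ∀ x, ‖x‖ ≤ C * N x := by
  have hcomp : IsCompact (Metric.sphere (0 : A → ℝ) 1) := isCompact_sphere _ _
  rcases (Metric.sphere (0 : A → ℝ) 1).eq_empty_or_nonempty with he | hne
  · refine ⟨1, one_pos, fun x => ?_⟩
    by_cases hx : x = 0
    · simp [hx]
    · have : ‖x‖⁻¹ • x ∈ Metric.sphere (0 : A → ℝ) 1 := by
        simp [norm_smul, inv_mul_cancel₀ (norm_ne_zero_iff.2 hx)]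
      simp [he] at this
  · obtain ⟨y, hy, hmin⟩ := hcomp.exists_isMinOn hne hN.continuous.continuousOn
    have hy0 : 0 < N y := by
      refine lt_of_le_of_ne (apply_nonneg N y) fun h => ?_
      have := hN.eq_zero y h.symm
      simp [this] at hy
    refine ⟨(N y)⁻¹, inv_pos.2 hy0, fun x => ?_⟩
    by_cases hx : x = 0
    · simp [hx]
    have hx' : 0 < ‖x‖ := norm_pos_iff.2 hx
    have hmem : ‖x‖⁻¹ • x ∈ Metric.sphere (0 : A → ℝ) 1 := by
      simp [norm_smul, inv_mul_cancel₀ hx'.ne']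
    have h := hmin hmem
    simp only [Set.mem_ofPred_eq, map_smul_eq_mul, norm_inv, norm_norm] at h
    rw [inv_mul_eq_div, le_div_iff₀ hx'] at h
    rw [inv_mul_eq_div, le_div_iff₀ hy0]
    linarith

lemma IsSimplexNorm.bddAbove_dual (hN : IsSimplexNorm N) (z : A → ℝ) :
    BddAbove ((fun x => dot z x) '' {x | N x ≤ 1}) := by
  obtain ⟨C, hC, h⟩ := hN.exists_norm_le
  refine ⟨∑ a, |z a| * C, ?_⟩
  rintro _ ⟨x, hx, rfl⟩
  refine Finset.sum_le_sum fun a _ => (le_abs_self _).trans ?_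
  rw [abs_mul]
  refine mul_le_mul_of_nonneg_left ?_ (abs_nonneg _)
  calc |x a| ≤ ‖x‖ := norm_le_pi_norm x a
    _ ≤ C * N x := h x
    _ ≤ C := mul_le_of_le_one_right hC.le hx

lemma IsSimplexNorm.dot_le_of_le_one (hN : IsSimplexNorm N) (z : A → ℝ) {x : A → ℝ}
    (hx : N x ≤ 1) : dot z x ≤ dualNorm N z :=
  le_csSup (hN.bddAbove_dual z) ⟨x, hx, rfl⟩

lemma dualNorm_le {z : A → ℝ} {c : ℝ} (h : ∀ x, N x ≤ 1 → dot z x ≤ c) : dualNorm N z ≤ c := by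
  refine csSup_le ⟨_, 0, by simp, rfl⟩ ?_
  rintro _ ⟨x, hx, rfl⟩
  exact h x hx

lemma IsSimplexNorm.dualNorm_nonneg (hN : IsSimplexNorm N) (z : A → ℝ) : 0 ≤ dualNorm N z := by
  have := hN.dot_le_of_le_one z (x := 0) (by simp)
  simpa [dot] using this

lemma IsSimplexNorm.dot_le (hN : IsSimplexNorm N) (z x : A → ℝ) :
    dot z x ≤ dualNorm N z * N x := by
  rcases (apply_nonneg N x).eq_or_lt with h | h
  · rw [hN.eq_zero x h.symm]; simp [dot]
  · have := hN.dot_le_of_le_one z (x := (N x)⁻¹ • x) (by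
      rw [map_smul_eq_mul, norm_inv, Real.norm_of_nonneg h.le, inv_mul_cancel₀ h.ne'])
    rw [dot_smul_right, inv_mul_eq_div, div_le_iff₀ h] at this
    exact this

lemma IsSimplexNorm.abs_dot_le (hN : IsSimplexNorm N) (z x : A → ℝ) :
    |dot z x| ≤ dualNorm N z * N x := by
  refine abs_le.2 ⟨?_, hN.dot_le z x⟩
  have := hN.dot_le z (-x)
  rw [map_neg_eq_map, show dot z (-x) = -dot z x from dotProduct_neg z x] at this
  linarith

lemma IsSimplexNorm.abs_apply_le (hN : IsSimplexNorm N) (z : A → ℝ) (a : A) :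
    |z a| ≤ dualNorm N z := by
  classical
  have h1 := hN.abs_dot_le z (Pi.single a 1)
  have h2 : dot z (Pi.single a 1) = z a := by simp [dot, Pi.single_apply]
  rw [h2] at h1
  exact h1.trans (mul_le_of_le_one_right (hN.dualNorm_nonneg z)
    (hN.le_one _ (single_mem_stdSimplex ℝ a)))

lemma dualNorm_neg (z : A → ℝ) : dualNorm N (-z) = dualNorm N z := by
  unfold dualNorm
  congr 1
  ext r
  constructor <;>
  · rintro ⟨x, hx, rfl⟩
    exact ⟨-x, by simpa using hx, by simp [dot]⟩

lemma IsSimplexNorm.dualNorm_add_le (hN : IsSimplexNorm N) (y z : A → ℝ) :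
    dualNorm N (y + z) ≤ dualNorm N y + dualNorm N z :=
  dualNorm_le fun x hx => by
    rw [dot_add_left]
    exact add_le_add (hN.dot_le_of_le_one y hx) (hN.dot_le_of_le_one z hx)

lemma IsSimplexNorm.exists_dualNorm_le (hN : IsSimplexNorm N) :
    ∃ C : ℝ, 0 ≤ C ∧ ∀ z, dualNorm N z ≤ C * ‖z‖ := by
  obtain ⟨C, hC, h⟩ := hN.exists_norm_le
  refine ⟨Fintype.card A * C, by positivity, fun z => dualNorm_le fun x hx => ?_⟩
  calc dot z x ≤ ∑ _a : A, ‖z‖ * C := by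
        refine Finset.sum_le_sum fun a _ => (le_abs_self _).trans ?_
        rw [abs_mul]
        refine mul_le_mul (norm_le_pi_norm z a) ?_ (abs_nonneg _) (norm_nonneg _)
        exact (norm_le_pi_norm x a).trans ((h x).trans (mul_le_of_le_one_right hC.le hx))
    _ = Fintype.card A * C * ‖z‖ := by simp; ring

lemma IsSimplexNorm.continuous_dualNorm (hN : IsSimplexNorm N) : Continuous (dualNorm N) := by
  obtain ⟨C, hC, h⟩ := hN.exists_dualNorm_le
  refine (LipschitzWith.of_dist_le_mul (K := C.toNNReal) fun x y => ?_).continuous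
  rw [Real.dist_eq, dist_eq_norm, Real.coe_toNNReal C hC]
  refine le_trans ?_ (h (x - y))
  have h1 := hN.dualNorm_add_le (x - y) y
  have h2 := hN.dualNorm_add_le (-(x - y)) x
  rw [dualNorm_neg] at h2
  rw [sub_add_cancel] at h1
  rw [show -(x - y) + x = y by abel] at h2
  exact abs_le.2 ⟨by linarith, by linarith⟩

lemma IsSimplexNorm.sub_le_two (hN : IsSimplexNorm N) {p q : A → ℝ} (hp : p ∈ stdSimplex ℝ A)
    (hq : q ∈ stdSimplex ℝ A) : N (p - q) ≤ 2 := by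
  linarith [map_sub_le_add N p q, hN.le_one p hp, hN.le_one q hq]

lemma IsSimplexNorm.continuousOn_of_lipschitz (hN : IsSimplexNorm N) {f : (A → ℝ) → ℝ} {c : ℝ}
    (hc : 0 ≤ c)
    (hf : ∀ p ∈ stdSimplex ℝ A, ∀ q ∈ stdSimplex ℝ A, f p - f q ≤ c * N (p - q)) :
    ContinuousOn f (stdSimplex ℝ A) := by
  refine (LipschitzOnWith.of_dist_le_mul (K := (c * Fintype.card A).toNNReal)
    fun p hp q hq => ?_).continuousOn
  rw [Real.dist_eq, dist_eq_norm, Real.coe_toNNReal _ (by positivity), mul_assoc]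
  refine le_trans ?_ (mul_le_mul_of_nonneg_left (hN.le_card_mul_norm (p - q)) hc)
  have h1 := hf q hq p hp
  rw [map_sub_rev] at h1
  exact abs_le.2 ⟨by linarith, hf p hp q hq⟩

end Norm

/-! ### Maxima over the simplex -/

section Simplex

variable {A : Type*} [Fintype A]

lemma bddAbove_simplex_image {f : (A → ℝ) → ℝ} (hf : ContinuousOn f (stdSimplex ℝ A)) :
    BddAbove (f '' stdSimplex ℝ A) :=
  ((isCompact_stdSimplex ℝ A).image_of_continuousOn hf).bddAbove

lemma nonempty_stdSimplex [Nonempty A] : (stdSimplex ℝ A).Nonempty := by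
  classical
  exact ⟨_, single_mem_stdSimplex ℝ (Classical.arbitrary A)⟩

lemma sSup_simplex_image_le [Nonempty A] {f : (A → ℝ) → ℝ} {c : ℝ}
    (h : ∀ p ∈ stdSimplex ℝ A, f p ≤ c) : sSup (f '' stdSimplex ℝ A) ≤ c := by
  refine csSup_le (nonempty_stdSimplex.image _) ?_
  rintro _ ⟨p, hp, rfl⟩
  exact h p hp

lemma sSup_simplex_image_le_add [Nonempty A] {f g : (A → ℝ) → ℝ} {c : ℝ}
    (hg : ContinuousOn g (stdSimplex ℝ A)) (h : ∀ p ∈ stdSimplex ℝ A, f p ≤ g p + c) :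
    sSup (f '' stdSimplex ℝ A) ≤ sSup (g '' stdSimplex ℝ A) + c :=
  sSup_simplex_image_le fun p hp => (h p hp).trans
    (add_le_add_left (le_csSup (bddAbove_simplex_image hg) ⟨p, hp, rfl⟩) c)

/-- This convex conjugate is `1`-Lipschitz for the sup norm because points of the simplex have total
mass one. It makes the gap functions, maxima over an uncountable set, measurable. -/
lemma continuous_sSup_dot_sub [Nonempty A] {f : (A → ℝ) → ℝ}
    (hf : ContinuousOn f (stdSimplex ℝ A)) :
    Continuous fun z : A → ℝ => sSup ((fun p => dot z p - f p) '' stdSimplex ℝ A) := by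
  have hc (z : A → ℝ) : ContinuousOn (fun p => dot z p - f p) (stdSimplex ℝ A) :=
    (continuous_dot.comp (by fun_prop : Continuous fun p => (z, p))).continuousOn.sub hf
  have key (y z : A → ℝ) : sSup ((fun p => dot y p - f p) '' stdSimplex ℝ A) ≤
      sSup ((fun p => dot z p - f p) '' stdSimplex ℝ A) + ‖y - z‖ := by
    refine sSup_simplex_image_le_add (hc z) fun p hp => ?_
    have := (le_abs_self _).trans (abs_dot_le_norm (y - z) hp)
    rw [dot_sub_left] at this
    linarith
  refine (LipschitzWith.of_dist_le_mul (K := 1) fun y z => ?_).continuous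
  rw [Real.dist_eq, dist_eq_norm, NNReal.coe_one, one_mul]
  have h1 := key y z
  have h2 := key z y
  rw [norm_sub_rev] at h2
  exact abs_le.2 ⟨by linarith, by linarith⟩

end Simplex

/-! ### Value functions, performance difference and optimality -/

section Mdp

variable {S A : Type*} [Fintype S] [Fintype A]

lemma sum_sum_comm_pair (f : S → A → S → A → ℝ) :
    ∑ s, ∑ a, ∑ u, ∑ b, f s a u b = ∑ u, ∑ b, ∑ s, ∑ a, f s a u b := by
  have h := Finset.sum_comm (s := (Finset.univ : Finset (S × A)))
    (t := (Finset.univ : Finset (S × A))) (f := fun x y => f x.1 x.2 y.1 y.2)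
  simpa only [Fintype.sum_prod_type] using h

-- The chain is linear in its initial law. Hence every discounted cost is a combination of action
-- values, which start from Dirac masses.
open scoped Classical in
lemma stateActionLaw_eq_sum (M : MDP S A) (π init : S → A → ℝ) (t : ℕ) (s' : S) (a' : A) :
    stateActionLaw M π init t s' a' = ∑ s, ∑ a, init s a *
      stateActionLaw M π (fun u b => if u = s ∧ b = a then 1 else 0) t s' a' := by
  induction t generalizing s' a' with
  | zero =>
    simp only [stateActionLaw, mul_ite, mul_one, mul_zero, ite_and]
    simp
  | succ t ih =>
    simp only [stateActionLaw]
    simp_rw [ih, Finset.sum_mul, Finset.mul_sum]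
    refine (sum_sum_comm_pair _).trans ?_
    refine Finset.sum_congr rfl fun _ _ => Finset.sum_congr rfl fun _ _ =>
      Finset.sum_congr rfl fun _ _ => Finset.sum_congr rfl fun _ _ => ?_
    ring

/-- One step of the state-action chain. -/
def stepLaw (M : MDP S A) (π init : S → A → ℝ) : S → A → ℝ :=
  fun s' a' => (∑ s, ∑ a, init s a * M.P s a s') * π s' a'

lemma stateActionLaw_succ (M : MDP S A) (π init : S → A → ℝ) (t : ℕ) :
    stateActionLaw M π init (t + 1) = stateActionLaw M π (stepLaw M π init) t := by
  induction t with
  | zero => rfl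
  | succ t ih =>
    rw [stateActionLaw, ih]
    rfl

/-- A state-action law is a probability distribution. -/
def IsLaw (μ : S → A → ℝ) : Prop := (∀ s a, 0 ≤ μ s a) ∧ ∑ s, ∑ a, μ s a = 1

lemma IsLaw.stepLaw {M : MDP S A} {π init : S → A → ℝ} (hπ : IsPolicy π) (h : IsLaw init) :
    IsLaw (stepLaw M π init) := by
  refine ⟨fun s a => mul_nonneg (Finset.sum_nonneg fun s' _ => Finset.sum_nonneg fun a' _ =>
    mul_nonneg (h.1 _ _) (M.P_nonneg _ _ _)) ((hπ s).1 a), ?_⟩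
  unfold SPMD.stepLaw
  simp_rw [← Finset.mul_sum, (hπ _).2, mul_one]
  rw [Finset.sum_comm, ← h.2]
  refine Finset.sum_congr rfl fun s _ => ?_
  rw [Finset.sum_comm]
  simp_rw [← Finset.mul_sum, M.P_sum, mul_one]

lemma IsLaw.stateActionLaw {M : MDP S A} {π init : S → A → ℝ} (hπ : IsPolicy π) (h : IsLaw init)
    (t : ℕ) : IsLaw (stateActionLaw M π init t) := by
  induction t with
  | zero => exact h
  | succ t ih => exact IsLaw.stepLaw hπ ih

lemma IsLaw.abs_sum_le {μ : S → A → ℝ} (h : IsLaw μ) {f : S → A → ℝ} {C : ℝ}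
    (hf : ∀ s a, |f s a| ≤ C) : |∑ s, ∑ a, μ s a * f s a| ≤ C := by
  calc |∑ s, ∑ a, μ s a * f s a| ≤ ∑ s, ∑ a, μ s a * C := by
        refine (Finset.abs_sum_le_sum_abs _ _).trans (Finset.sum_le_sum fun s _ =>
          (Finset.abs_sum_le_sum_abs _ _).trans (Finset.sum_le_sum fun a _ => ?_))
        rw [abs_mul, abs_of_nonneg (h.1 s a)]
        exact mul_le_mul_of_nonneg_left (hf s a) (h.1 s a)
    _ = C := by simp_rw [← Finset.sum_mul, h.2, one_mul]

open scoped Classical in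
lemma isLaw_dirac (s : S) (a : A) : IsLaw fun u b => if u = s ∧ b = a then (1 : ℝ) else 0 := by
  refine ⟨fun u b => by dsimp only; split_ifs <;> norm_num, ?_⟩
  simp only [ite_and]
  simp

lemma abs_discountedCost_term_le {M : MDP S A} {π init : S → A → ℝ} (hπ : IsPolicy π)
    (h : IsLaw init) {C : ℝ} (hC : ∀ s a, |M.c s a + M.h s (π s)| ≤ C) (t : ℕ) :
    |M.γ ^ t * ∑ s, ∑ a, stateActionLaw M π init t s a * (M.c s a + M.h s (π s))| ≤
      C * M.γ ^ t := by
  rw [abs_mul, abs_of_nonneg (pow_nonneg M.γ_nonneg t), mul_comm]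
  exact mul_le_mul_of_nonneg_right ((h.stateActionLaw hπ t).abs_sum_le hC)
    (pow_nonneg M.γ_nonneg t)

lemma summable_discountedCost (M : MDP S A) {π init : S → A → ℝ} (hπ : IsPolicy π)
    (h : IsLaw init) : Summable fun t : ℕ =>
      M.γ ^ t * ∑ s, ∑ a, stateActionLaw M π init t s a * (M.c s a + M.h s (π s)) := by
  refine Summable.of_norm_bounded
    ((summable_geometric_of_lt_one M.γ_nonneg M.γ_lt_one).mul_left
      (∑ s, ∑ a, |M.c s a + M.h s (π s)|)) fun t => ?_
  refine abs_discountedCost_term_le hπ h (fun s a => ?_) t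
  exact (Finset.single_le_sum (f := fun a => |M.c s a + M.h s (π s)|)
      (fun _ _ => abs_nonneg _) (Finset.mem_univ a)).trans
    (Finset.single_le_sum (f := fun s => ∑ a, |M.c s a + M.h s (π s)|)
      (fun _ _ => Finset.sum_nonneg fun _ _ => abs_nonneg _) (Finset.mem_univ s))

lemma abs_qValue_le {M : MDP S A} {π : S → A → ℝ} (hπ : IsPolicy π) {C : ℝ}
    (hC : ∀ s a, |M.c s a + M.h s (π s)| ≤ C) (s : S) (a : A) :
    |qValue M π s a| ≤ C * (1 - M.γ)⁻¹ := by
  have h := (hasSum_geometric_of_lt_one M.γ_nonneg M.γ_lt_one).mul_left C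
  rw [qValue, discountedCost, ← Real.norm_eq_abs]
  refine tsum_of_norm_bounded h fun t => ?_
  rw [Real.norm_eq_abs]
  exact abs_discountedCost_term_le hπ (isLaw_dirac s a) hC t

lemma discountedCost_eq_sum (M : MDP S A) {π : S → A → ℝ} (hπ : IsPolicy π) (init : S → A → ℝ) :
    discountedCost M π init = ∑ s, ∑ a, init s a * qValue M π s a := by
  classical
  have hs (s : S) (a : A) := (summable_discountedCost M hπ (isLaw_dirac s a)).hasSum.mul_left
    (init s a)
  have h := hasSum_sum (s := Finset.univ) fun s _ =>
    hasSum_sum (s := Finset.univ) fun a _ => hs s a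
  refine Eq.trans ?_ h.tsum_eq
  unfold discountedCost
  congr 1
  ext t
  simp_rw [stateActionLaw_eq_sum M π init t, Finset.sum_mul, Finset.mul_sum]
  refine (sum_sum_comm_pair _).trans ?_
  refine Finset.sum_congr rfl fun _ _ => Finset.sum_congr rfl fun _ _ =>
    Finset.sum_congr rfl fun _ _ => Finset.sum_congr rfl fun _ _ => ?_
  ring

lemma value_eq_dot (M : MDP S A) {π : S → A → ℝ} (hπ : IsPolicy π) (s : S) :
    value M π s = dot (qValue M π s) (π s) := by
  classical
  rw [value, discountedCost_eq_sum M hπ]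
  simp only [ite_mul, zero_mul]
  rw [Finset.sum_comm]
  simp [dot, mul_comm]

lemma discountedCost_eq_add (M : MDP S A) {π init : S → A → ℝ} (hπ : IsPolicy π)
    (h : IsLaw init) : discountedCost M π init =
      ∑ s, ∑ a, init s a * (M.c s a + M.h s (π s)) +
        M.γ * discountedCost M π (stepLaw M π init) := by
  unfold discountedCost
  rw [(summable_discountedCost M hπ h).tsum_eq_zero_add, ← tsum_mul_left]
  simp only [stateActionLaw_succ, pow_succ', mul_assoc, pow_zero, one_mul]
  rfl

lemma qValue_eq (M : MDP S A) {π : S → A → ℝ} (hπ : IsPolicy π) (s : S) (a : A) :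
    qValue M π s a = M.c s a + M.h s (π s) + M.γ * ∑ s', M.P s a s' * value M π s' := by
  classical
  rw [qValue, discountedCost_eq_add M hπ (isLaw_dirac s a), discountedCost_eq_sum M hπ]
  congr 1
  · simp only [ite_and, ite_mul, zero_mul, one_mul]
    simp
  · congr 1
    refine Finset.sum_congr rfl fun s' _ => ?_
    rw [value_eq_dot M hπ, dot, Finset.mul_sum]
    refine Finset.sum_congr rfl fun a' _ => ?_
    simp only [stepLaw, ite_and, ite_mul, zero_mul, one_mul]
    simp
    ring

/-- The state transition matrix under a policy. -/
def transition (M : MDP S A) (π : S → A → ℝ) (s s' : S) : ℝ := ∑ a, π s a * M.P s a s'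

lemma transition_nonneg (M : MDP S A) {π : S → A → ℝ} (hπ : IsPolicy π) (s s' : S) :
    0 ≤ transition M π s s' :=
  Finset.sum_nonneg fun a _ => mul_nonneg ((hπ s).1 a) (M.P_nonneg _ _ _)

lemma sum_transition (M : MDP S A) {π : S → A → ℝ} (hπ : IsPolicy π) (s : S) :
    ∑ s', transition M π s s' = 1 := by
  unfold transition
  rw [Finset.sum_comm]
  simp_rw [← Finset.mul_sum, M.P_sum, mul_one]
  exact (hπ s).2

/-- One step with `ρ`, then `π` forever. The first regularization cost is still that of `π`, since
it is built into `Q^π`; this is where the `h` terms of the advantage come from. The case `ρ = π` is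
the Bellman equation. -/
lemma dot_qValue (M : MDP S A) {π : S → A → ℝ} (hπ : IsPolicy π) {ρ : S → A → ℝ}
    (hρ : IsPolicy ρ) (s : S) : dot (qValue M π s) (ρ s) =
      dot (M.c s) (ρ s) + M.h s (π s) + M.γ * ∑ s', transition M ρ s s' * value M π s' := by
  have h1 : ∑ a, M.h s (π s) * ρ s a = M.h s (π s) := by rw [← Finset.mul_sum, (hρ s).2, mul_one]
  have h2 : ∑ s', transition M ρ s s' * value M π s' =
      ∑ a, (∑ s', M.P s a s' * value M π s') * ρ s a := by
    simp_rw [transition, Finset.sum_mul]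
    rw [Finset.sum_comm]
    refine Finset.sum_congr rfl fun _ _ => Finset.sum_congr rfl fun _ _ => ?_
    ring
  rw [h2, Finset.mul_sum]
  conv_lhs => unfold dot
  rw [← h1]
  unfold dot
  rw [← Finset.sum_add_distrib, ← Finset.sum_add_distrib]
  refine Finset.sum_congr rfl fun a _ => ?_
  rw [qValue_eq M hπ]
  ring

/-- The performance difference identity in recursive form. -/
lemma value_sub_value (M : MDP S A) {π ρ : S → A → ℝ} (hπ : IsPolicy π) (hρ : IsPolicy ρ) (s : S) :
    value M ρ s - value M π s =
      advantage M π (qValue M π s) (value M π s) s (ρ s) +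
        M.γ * ∑ s', transition M ρ s s' * (value M ρ s' - value M π s') := by
  rw [advantage, dot_qValue M hπ hρ, value_eq_dot M hρ, dot_qValue M hρ hρ]
  simp_rw [mul_sub, Finset.sum_sub_distrib]
  ring

lemma advantage_eq (M : MDP S A) {π : S → A → ℝ} (hπ : IsPolicy π) (s : S) (p : A → ℝ) :
    advantage M π (qValue M π s) (value M π s) s p =
      dot (qValue M π s) (p - π s) + M.h s p - M.h s (π s) := by
  rw [advantage, value_eq_dot M hπ, dot_sub_right]

/-- The maximum principle for the discounted transition operator. -/
lemma le_of_le_add_transition [Nonempty S] (M : MDP S A) {ρ : S → A → ℝ} (hρ : IsPolicy ρ)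
    {f : S → ℝ} {b : ℝ} (h : ∀ s, f s ≤ b + M.γ * ∑ s', transition M ρ s s' * f s') (s : S) :
    f s ≤ (1 - M.γ)⁻¹ * b := by
  -- At a maximizer of `f` the transition average cannot exceed `f m`, so the inequality there
  -- closes on `f m` alone.
  obtain ⟨m, hm⟩ := Finite.exists_max f
  have h1 : ∑ s', transition M ρ m s' * f s' ≤ f m := by
    calc ∑ s', transition M ρ m s' * f s' ≤ ∑ s', transition M ρ m s' * f m :=
          Finset.sum_le_sum fun s' _ =>
            mul_le_mul_of_nonneg_left (hm s') (transition_nonneg M hρ m s')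
      _ = f m := by rw [← Finset.sum_mul, sum_transition M hρ, one_mul]
  have h2 := (h m).trans (add_le_add_right (mul_le_mul_of_nonneg_left h1 M.γ_nonneg) b)
  have h3 : 0 < 1 - M.γ := sub_pos.2 M.γ_lt_one
  rw [inv_mul_eq_div, le_div_iff₀ h3]
  nlinarith [hm s]

/-- Policy improvement: if switching to `p` at the single state `s` had negative advantage, the
modified policy would be nowhere worse by the maximum principle, and the recursion at `s` would make
it strictly better there. -/
lemma IsOptimal.advantage_nonneg [Nonempty S] {M : MDP S A} {πs : S → A → ℝ}
    (h : IsOptimal M πs) (s : S) {p : A → ℝ} (hp : p ∈ stdSimplex ℝ A) :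
    0 ≤ advantage M πs (qValue M πs s) (value M πs s) s p := by
  classical
  by_contra! hneg
  set ρ : S → A → ℝ := Function.update πs s p with hρdef
  have hρ : IsPolicy ρ := fun q => by
    by_cases hq : q = s
    · subst hq; simpa [hρdef] using hp
    · simpa [hρdef, hq] using h.1 q
  have hself (q : S) : advantage M πs (qValue M πs q) (value M πs q) q (πs q) = 0 := by
    rw [advantage_eq M h.1]; simp [dot]
  have hρs : ρ s = p := by simp [hρdef]
  have hle (q : S) : advantage M πs (qValue M πs q) (value M πs q) q (ρ q) ≤ 0 := by
    by_cases hq : q = s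
    · rw [hq, hρs]; exact hneg.le
    · rw [show ρ q = πs q by simp [hρdef, hq], hself]
  have hD : ∀ q, value M ρ q - value M πs q ≤ 0 := fun q => by
    have := le_of_le_add_transition M hρ (f := fun q => value M ρ q - value M πs q) (b := 0)
      (fun q => by
        rw [value_sub_value M h.1 hρ q]
        exact add_le_add_left (hle q) _) q
    simpa using this
  have h1 := value_sub_value M h.1 hρ s
  rw [hρs] at h1
  have h2 : ∑ s', transition M ρ s s' * (value M ρ s' - value M πs s') ≤ 0 :=
    Finset.sum_nonpos fun s' _ =>
      mul_nonpos_of_nonneg_of_nonpos (transition_nonneg M hρ s s') (hD s')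
  have h3 := h.2 ρ hρ s
  nlinarith [M.γ_nonneg]

/-- After removing the regularizer of the first step, action values are monotone in the continuation
value, so those of `π*` lie below those of `π`. Combined with the nonnegative advantage at `π*`,
this bounds the advantage at `π` uniformly in `p`. -/
lemma IsOptimal.neg_advantage_le [Nonempty S] {M : MDP S A} {πs π : S → A → ℝ}
    (h : IsOptimal M πs) (hπ : IsPolicy π) (s : S) {p : A → ℝ} (hp : p ∈ stdSimplex ℝ A) :
    -advantage M π (qValue M π s) (value M π s) s p ≤ value M π s - value M πs s := by
  have h1 := h.advantage_nonneg s hp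
  have h2 : dot (qValue M πs s) p - M.h s (πs s) ≤ dot (qValue M π s) p - M.h s (π s) := by
    -- Only the value at `s` matters; the constant policy is a convenient extension of `p`.
    have hρ : IsPolicy fun _ : S => p := fun _ => hp
    have e1 := dot_qValue M h.1 hρ s
    have e2 := dot_qValue M hπ hρ s
    rw [e1, e2]
    have : ∑ s', transition M (fun _ => p) s s' * value M πs s' ≤
        ∑ s', transition M (fun _ => p) s s' * value M π s' :=
      Finset.sum_le_sum fun s' _ =>
        mul_le_mul_of_nonneg_left (h.2 π hπ s') (transition_nonneg M hρ s s')
    nlinarith [mul_le_mul_of_nonneg_left this M.γ_nonneg]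
  unfold advantage at *
  linarith

end Mdp

/-! ### Strong convexity, Bregman's distance and the prox step -/

section Bregman

variable {A : Type*} [Fintype A] {N : Seminorm ℝ (A → ℝ)} {w : (A → ℝ) → ℝ}

lemma add_smul_sub_mem_simplex {p q : A → ℝ} (hq : q ∈ stdSimplex ℝ A) (hp : p ∈ stdSimplex ℝ A)
    {r : ℝ} (h0 : 0 ≤ r) (h1 : r ≤ 1) : q + r • (p - q) ∈ stdSimplex ℝ A :=
  (convex_stdSimplex ℝ A).add_smul_sub_mem hq hp ⟨h0, h1⟩

lemma add_smul_sub_eq {E : Type*} [AddCommGroup E] [Module ℝ E] (p q : E) (r : ℝ) : q + r • (p - q) = (1 - r) • q + r • p := by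
  module

lemma eventually_Ioo : ∀ᶠ r : ℝ in 𝓝[>] 0, r ∈ Set.Ioo (0 : ℝ) 1 :=
  Ioo_mem_nhdsGT one_pos

/-- The simplex has empty interior, so the derivative within it is meaningful only along feasible
directions. Inequalities for it are derived from this one-sided limit; elsewhere only its linearity
is used. -/
lemma tendsto_directional_slope {p q : A → ℝ} (hq : q ∈ stdSimplex ℝ A) (hp : p ∈ stdSimplex ℝ A)
    (hd : DifferentiableWithinAt ℝ w (stdSimplex ℝ A) q) :
    Tendsto (fun r : ℝ => r⁻¹ * (w (q + r • (p - q)) - w q)) (𝓝[>] 0)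
      (𝓝 (fderivWithin ℝ w (stdSimplex ℝ A) q (p - q))) := by
  refine hd.hasFDerivWithinAt.lim (c := fun r : ℝ => r⁻¹) (d := fun r : ℝ => r • (p - q))
    ?_ ?_ ?_
  · have h : Continuous fun r : ℝ => r • (p - q) := by fun_prop
    refine tendsto_nhdsWithin_of_tendsto_nhds ?_
    simpa using h.tendsto 0
  · filter_upwards [eventually_Ioo] with r hr
    exact add_smul_sub_mem_simplex hq hp hr.1.le hr.2.le
  · refine tendsto_const_nhds.congr' ?_
    filter_upwards [eventually_Ioo] with r hr
    rw [smul_smul, inv_mul_cancel₀ hr.1.ne', one_smul]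

lemma tendsto_one_sub_mul (c : ℝ) : Tendsto (fun r : ℝ => (1 - r) / 2 * c) (𝓝[>] 0) (𝓝 (c / 2)) := by
  have : Continuous fun r : ℝ => (1 - r) / 2 * c := by fun_prop
  refine tendsto_nhdsWithin_of_tendsto_nhds ?_
  convert this.tendsto 0 using 2
  ring

/-- Strong convexity on the segment from `q` to `p`, divided by the step `r`, in the limit `r → 0+`.
-/
lemma IsDGF.half_sq_le_bregman (hw : IsDGF N w) {p q : A → ℝ} (hq : q ∈ stdSimplex ℝ A)
    (hp : p ∈ stdSimplex ℝ A) (hd : DifferentiableWithinAt ℝ w (stdSimplex ℝ A) q) :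
    N (q - p) ^ 2 / 2 ≤ bregman w q p := by
  have h : fderivWithin ℝ w (stdSimplex ℝ A) q (p - q) + N (q - p) ^ 2 / 2 ≤ w p - w q := by
    refine le_of_tendsto ((tendsto_directional_slope hq hp hd).add
      (tendsto_one_sub_mul (N (q - p) ^ 2))) ?_
    filter_upwards [eventually_Ioo] with r hr
    have h1 := hw.strongConvex q hq p hp (1 - r) r (by linarith [hr.2]) hr.1.le (by ring)
    rw [← add_smul_sub_eq] at h1
    have h2 : r⁻¹ * (w (q + r • (p - q)) - w q) ≤ w p - w q - (1 - r) / 2 * N (q - p) ^ 2 := by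
      rw [inv_mul_eq_div, div_le_iff₀ hr.1]
      linarith
    linarith
  unfold bregman
  linarith

/-- The same limit, with minimality in place of the derivative. No differentiability is needed,
which is what allows the leader argument below. -/
lemma IsDGF.add_half_sq_le_of_isMinOn (hw : IsDGF N w) {p u : A → ℝ} (hu : u ∈ stdSimplex ℝ A)
    (hp : p ∈ stdSimplex ℝ A) (hmin : IsMinOn w (stdSimplex ℝ A) u) :
    w u + N (u - p) ^ 2 / 2 ≤ w p := by
  have h : N (u - p) ^ 2 / 2 ≤ w p - w u := by
    refine le_of_tendsto (tendsto_one_sub_mul (N (u - p) ^ 2)) ?_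
    filter_upwards [eventually_Ioo] with r hr
    have h1 := hw.strongConvex u hu p hp (1 - r) r (by linarith [hr.2]) hr.1.le (by ring)
    rw [← add_smul_sub_eq] at h1
    have h2 : w u ≤ w (u + r • (p - u)) := hmin (add_smul_sub_mem_simplex hu hp hr.1.le hr.2.le)
    refine le_of_mul_le_mul_left ?_ hr.1
    linarith
  linarith

/-- The three-point inequality for a prox step. -/
lemma three_point {F : (A → ℝ) → ℝ} (hF : ConvexOn ℝ (stdSimplex ℝ A) F) {q u p : A → ℝ}
    (hu : u ∈ stdSimplex ℝ A) (hp : p ∈ stdSimplex ℝ A)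
    (hd : DifferentiableWithinAt ℝ w (stdSimplex ℝ A) u)
    (hmin : IsMinOn (fun p => F p + bregman w q p) (stdSimplex ℝ A) u) :
    F u + bregman w q u + bregman w u p ≤ F p + bregman w q p := by
  set L := fderivWithin ℝ w (stdSimplex ℝ A) q with hL
  have h : L (p - u) - (F p - F u) ≤ fderivWithin ℝ w (stdSimplex ℝ A) u (p - u) := by
    -- First-order optimality without subgradients of `F`: minimality along the segment to `p` and
    -- convexity of `F` bound the difference quotients of `w` at `u` from below.
    refine ge_of_tendsto (tendsto_directional_slope hu hp hd) ?_
    filter_upwards [eventually_Ioo] with r hr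
    have h1 : F u + bregman w q u ≤ F (u + r • (p - u)) + bregman w q (u + r • (p - u)) :=
      hmin (add_smul_sub_mem_simplex hu hp hr.1.le hr.2.le)
    have h2 := hF.2 hu hp (by linarith [hr.2] : 0 ≤ 1 - r) hr.1.le (by ring)
    rw [← add_smul_sub_eq] at h2
    simp only [smul_eq_mul] at h2
    unfold bregman at h1
    rw [← hL, show u + r • (p - u) - q = (u - q) + r • (p - u) by abel, map_add, map_smul,
      smul_eq_mul] at h1
    rw [inv_mul_eq_div, le_div_iff₀ hr.1]
    linarith
  have e : L (p - q) = L (p - u) + L (u - q) := by rw [← map_add]; congr 1; abel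
  unfold bregman
  rw [← hL, e]
  linarith

/-- The cost of moving from `q` to `u` is absorbed by the prox term. Here `d` stands for `D(q, u)`,
`d'` for `D(q, p)`, and `E` for `D(u, p)`, or for `0` at the last step. -/
lemma IsSimplexNorm.mirror_step (hN : IsSimplexNorm N) {f : (A → ℝ) → ℝ} {c η E d d' : ℝ}
    (hη : 0 ≤ η) {Q q u p : A → ℝ} (hf : f q - f u ≤ c * N (q - u))
    (hd : N (q - u) ^ 2 / 2 ≤ d)
    (h : η * (dot Q u + f u) + d + E ≤ η * (dot Q p + f p) + d') :
    η * (dot Q (q - p) + f q - f p) ≤ d' - E + η ^ 2 * (dualNorm N Q ^ 2 + c ^ 2) := by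
  have h1 := hN.dot_le Q (q - u)
  rw [dot_sub_right] at h1 ⊢
  have h2 : η * (dot Q q - dot Q u + (f q - f u)) ≤ η * ((dualNorm N Q + c) * N (q - u)) :=
    mul_le_mul_of_nonneg_left (by linarith) hη
  -- Young's inequality followed by `(a + c)² ≤ 2 (a² + c²)`.
  have h3 : η * ((dualNorm N Q + c) * N (q - u)) ≤
      N (q - u) ^ 2 / 2 + η ^ 2 * (dualNorm N Q ^ 2 + c ^ 2) := by
    nlinarith [sq_nonneg (N (q - u) - η * (dualNorm N Q + c)),
      mul_nonneg (sq_nonneg η) (sq_nonneg (dualNorm N Q - c))]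
  linarith

end Bregman

/-! ### Regret of mirror descent -/

section Regret

variable {S A : Type*} [Fintype S] [Fintype A] {N : Seminorm ℝ (A → ℝ)} {w : (A → ℝ) → ℝ}

/-- The regret bound of policy mirror descent with respect to the estimated values. -/
lemma IsRun.regret_le {M : MDP S A} (hN : IsSimplexNorm N) (hw : IsDGF N w) {s : S}
    (h_convex : ConvexOn ℝ (stdSimplex ℝ A) (M.h s)) {c : ℝ}
    (h_lip : ∀ p ∈ stdSimplex ℝ A, ∀ q ∈ stdSimplex ℝ A, M.h s p - M.h s q ≤ c * N (p - q))
    {η : ℝ} (hη : 0 < η) {k : ℕ} (hk : 1 ≤ k) {π0 : S → A → ℝ} {π Qt : ℕ → S → A → ℝ}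
    (hrun : IsRun M w η k π0 π Qt) {D0 : ℝ} {p : A → ℝ} (hp : p ∈ stdSimplex ℝ A)
    (hD0 : bregman w (π0 s) p ≤ D0) :
    ∑ t ∈ Finset.range k, (dot (Qt t s) (π t s - p) + M.h s (π t s) - M.h s p) ≤
      D0 / η + η * ∑ t ∈ Finset.range k, (dualNorm N (Qt t s) ^ 2 + c ^ 2) := by
  -- The telescoping potential is cut to `0` at time `k`, since `w` need not be differentiable at
  -- `π_k`. The last step then uses mere minimality instead of the three-point inequality.
  set E : ℕ → ℝ := fun t => if t < k then bregman w (π t s) p else 0 with hE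
  have step : ∀ t ∈ Finset.range k,
      η * (dot (Qt t s) (π t s - p) + M.h s (π t s) - M.h s p) ≤
        (E t - E (t + 1)) + η ^ 2 * (dualNorm N (Qt t s) ^ 2 + c ^ 2) := by
    intro t ht
    have ht := Finset.mem_range.1 ht
    have hq := hrun.policy t ht.le s
    have hu := hrun.policy (t + 1) ht s
    have hEt : E t = bregman w (π t s) p := by simp [hE, ht]
    rw [hEt]
    refine hN.mirror_step hη.le (h_lip _ hq _ hu)
      (hw.half_sq_le_bregman hq hu (hrun.differentiable t ht s)) ?_
    by_cases h1 : t + 1 < k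
    · have hEt' : E (t + 1) = bregman w (π (t + 1) s) p := by simp [hE, h1]
      rw [hEt']
      have hlin : ConvexOn ℝ (stdSimplex ℝ A) fun p => dot (Qt t s) p :=
        ⟨convex_stdSimplex ℝ A, fun x _ y _ a b _ _ _ => by
          simp only [dot_add_right, dot_smul_right, smul_eq_mul, le_refl]⟩
      exact three_point (F := fun p => η * (dot (Qt t s) p + M.h s p))
        ((hlin.add h_convex).smul hη.le) hu hp (hrun.differentiable (t + 1) h1 s)
        (hrun.update t ht s)
    · have hEt' : E (t + 1) = 0 := by simp [hE, h1]
      rw [hEt', add_zero]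
      exact hrun.update t ht s hp
  have hsum := Finset.sum_le_sum step
  rw [Finset.sum_add_distrib, Finset.sum_range_sub', ← Finset.mul_sum, ← Finset.mul_sum] at hsum
  have hE0 : E 0 ≤ D0 := by
    simp only [hE, show 0 < k by omega, if_true]
    rw [hrun.init]; exact hD0
  have hEk : E k = 0 := by simp [hE]
  rw [hEk, sub_zero] at hsum
  refine le_of_mul_le_mul_left ?_ hη
  rw [mul_add, mul_div_cancel₀ _ hη.ne', ← mul_assoc, ← sq]
  linarith

end Regret

/-! ### The regularized leader and its regret -/

section FollowTheLeader

variable {A : Type*} [Fintype A] {N : Seminorm ℝ (A → ℝ)} {R : (A → ℝ) → ℝ}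

lemma exists_isMinOn_sub_dot [Nonempty A] (hR : ContinuousOn R (stdSimplex ℝ A)) (z : A → ℝ) :
    ∃ u ∈ stdSimplex ℝ A, IsMinOn (fun p => R p - dot z p) (stdSimplex ℝ A) u :=
  (isCompact_stdSimplex ℝ A).exists_isMinOn nonempty_stdSimplex
    (hR.sub (continuous_dot.comp (by fun_prop : Continuous fun p => (z, p))).continuousOn)

open scoped Classical in
/-- The regularized leader: a maximizer of `⟨z, p⟩ - R p` over the simplex. -/
noncomputable def leader (R : (A → ℝ) → ℝ) (z : A → ℝ) : A → ℝ :=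
  if h : ∃ u ∈ stdSimplex ℝ A, IsMinOn (fun p => R p - dot z p) (stdSimplex ℝ A) u
  then h.choose else 0

lemma leader_mem [Nonempty A] (hR : ContinuousOn R (stdSimplex ℝ A)) (z : A → ℝ) :
    leader R z ∈ stdSimplex ℝ A := by
  rw [leader, dif_pos (exists_isMinOn_sub_dot hR z)]
  exact (exists_isMinOn_sub_dot hR z).choose_spec.1

lemma leader_isMinOn [Nonempty A] (hR : ContinuousOn R (stdSimplex ℝ A)) (z : A → ℝ) :
    IsMinOn (fun p => R p - dot z p) (stdSimplex ℝ A) (leader R z) := by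
  rw [leader, dif_pos (exists_isMinOn_sub_dot hR z)]
  exact (exists_isMinOn_sub_dot hR z).choose_spec.2

lemma IsDGF.sub_clm (hR : IsDGF N R) (L : (A → ℝ) →ₗ[ℝ] ℝ) (c : ℝ) :
    IsDGF N fun p => R p - c - L p := by
  refine ⟨(hR.continuousOn.sub continuousOn_const).sub
    (L.continuous_of_finiteDimensional).continuousOn, fun x hx y hy a b ha hb hab => ?_⟩
  have := hR.strongConvex x hx y hy a b ha hb hab
  rw [map_add, map_smul, map_smul, smul_eq_mul, smul_eq_mul]
  have hc : c = a * c + b * c := by rw [← add_mul, hab, one_mul]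
  linarith

/-- Bregman's distance differs from `R` by an affine function of its second argument, and strong
convexity ignores affine terms. -/
lemma IsDGF.bregman (hR : IsDGF N R) (q : A → ℝ) : IsDGF N (bregman R q) := by
  have h := hR.sub_clm (fderivWithin ℝ R (stdSimplex ℝ A) q).toLinearMap
    (R q - fderivWithin ℝ R (stdSimplex ℝ A) q q)
  convert h using 2 with p
  simp [SPMD.bregman]
  ring

lemma IsDGF.sub_dot (hR : IsDGF N R) (z : A → ℝ) : IsDGF N fun p => R p - dot z p := by
  have h := hR.sub_clm (dotProductBilin ℝ ℝ z) 0
  simp only [sub_zero] at h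
  exact h

lemma IsDGF.leader_quadratic_growth [Nonempty A] (hR : IsDGF N R) (z : A → ℝ) {p : A → ℝ}
    (hp : p ∈ stdSimplex ℝ A) :
    R (leader R z) - dot z (leader R z) + N (leader R z - p) ^ 2 / 2 ≤ R p - dot z p :=
  (hR.sub_dot z).add_half_sq_le_of_isMinOn (leader_mem hR.continuousOn z) hp
    (leader_isMinOn hR.continuousOn z)

/-- Add the quadratic growth inequalities of the two leaders, each tested at the other. So the
leader, although obtained by choice, depends continuously on `z`; its measurability follows. -/
lemma IsDGF.norm_leader_sub_le [Nonempty A] (hN : IsSimplexNorm N) (hR : IsDGF N R)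
    (y z : A → ℝ) : N (leader R y - leader R z) ≤ dualNorm N (y - z) := by
  have h1 := hR.leader_quadratic_growth y (leader_mem hR.continuousOn z)
  have h2 := hR.leader_quadratic_growth z (leader_mem hR.continuousOn y)
  have h3 := hN.dot_le (y - z) (leader R y - leader R z)
  rw [dot_sub_left, dot_sub_right, dot_sub_right] at h3
  rw [map_sub_rev] at h2
  set n := N (leader R y - leader R z)
  rcases (apply_nonneg N (leader R y - leader R z)).eq_or_lt with h | h
  · exact h.symm.le.trans (hN.dualNorm_nonneg _)
  · refine le_of_mul_le_mul_right ?_ h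
    change n * n ≤ _ * n
    nlinarith

lemma IsDGF.continuous_leader [Nonempty A] (hN : IsSimplexNorm N) (hR : IsDGF N R) :
    Continuous (leader R) := by
  obtain ⟨C, hC, h⟩ := hN.exists_norm_le
  obtain ⟨C', hC', h'⟩ := hN.exists_dualNorm_le
  refine (LipschitzWith.of_dist_le_mul (K := (C * C').toNNReal) fun y z => ?_).continuous
  rw [dist_eq_norm, dist_eq_norm, Real.coe_toNNReal _ (by positivity), mul_assoc]
  exact (h _).trans (mul_le_mul_of_nonneg_left
    ((hR.norm_leader_sub_le hN y z).trans (h' _)) hC.le)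

/-- The growth of the conjugate of `R` in one step: quadratic growth at the old leader and Young's
inequality pay for evaluating `ξ` at the old leader, which does not know `ξ`. -/
lemma IsDGF.leader_step [Nonempty A] (hN : IsSimplexNorm N) (hR : IsDGF N R) (η : ℝ) (hη : 0 ≤ η)
    (z ξ : A → ℝ) :
    dot (z + η • ξ) (leader R (z + η • ξ)) - R (leader R (z + η • ξ)) ≤
      dot z (leader R z) - R (leader R z) + η * dot ξ (leader R z) +
        η ^ 2 / 2 * dualNorm N ξ ^ 2 := by
  set u := leader R z
  set v := leader R (z + η • ξ)
  have h1 := hR.leader_quadratic_growth z (leader_mem hR.continuousOn (z + η • ξ))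
  have h2 := mul_le_mul_of_nonneg_left (hN.dot_le ξ (v - u)) hη
  rw [map_sub_rev] at h1
  rw [dot_sub_right] at h2
  rw [dot_add_left, dot_smul_left]
  nlinarith [sq_nonneg (N (v - u) - η * dualNorm N ξ)]

/-- The regret bound of the follow-the-regularized-leader scheme. -/
lemma IsDGF.leader_regret_le [Nonempty A] (hN : IsSimplexNorm N) (hR : IsDGF N R)
    (hR0 : ∀ p ∈ stdSimplex ℝ A, 0 ≤ R p) {D0 : ℝ} {η : ℝ} (hη : 0 < η) (ξ : ℕ → A → ℝ) (k : ℕ)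
    {p : A → ℝ} (hp : p ∈ stdSimplex ℝ A) (hD0 : R p ≤ D0) :
    ∑ t ∈ Finset.range k, dot (ξ t) (p - leader R (η • ∑ i ∈ Finset.range t, ξ i)) ≤
      D0 / η + η / 2 * ∑ t ∈ Finset.range k, dualNorm N (ξ t) ^ 2 := by
  set z : ℕ → A → ℝ := fun t => η • ∑ i ∈ Finset.range t, ξ i with hz
  -- The conjugate of `R` at `z n` serves as potential. It starts at most at `0` because `R` is
  -- nonnegative.
  have key (n : ℕ) : dot (z n) (leader R (z n)) - R (leader R (z n)) ≤
      η * ∑ t ∈ Finset.range n, dot (ξ t) (leader R (z t)) +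
        η ^ 2 / 2 * ∑ t ∈ Finset.range n, dualNorm N (ξ t) ^ 2 := by
    induction n with
    | zero =>
      simp only [hz, Finset.range_zero, Finset.sum_empty, smul_zero, dot_zero_left, mul_zero,
        add_zero, zero_sub]
      linarith [hR0 _ (leader_mem hR.continuousOn 0)]
    | succ n ih =>
      have hzs : z (n + 1) = z n + η • ξ n := by
        simp only [hz, Finset.sum_range_succ, smul_add]
      rw [Finset.sum_range_succ, Finset.sum_range_succ, hzs]
      linarith [hR.leader_step hN η hη.le (z n) (ξ n)]
  have h1 := leader_isMinOn hR.continuousOn (z k) hp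
  simp only [Set.mem_ofPred_eq] at h1
  have h2 : dot (z k) p = η * ∑ t ∈ Finset.range k, dot (ξ t) p := by
    rw [hz, dot_smul_left, dot_sum_left]
  simp_rw [dot_sub_right, Finset.sum_sub_distrib]
  refine le_of_mul_le_mul_left ?_ hη
  rw [mul_add, mul_div_cancel₀ _ hη.ne']
  linarith [key k]

end FollowTheLeader

/-! ### Scalar exponential inequalities -/

section ExpInequality

/-- `(eˣ - x) e^{-4x²/7}` is nonincreasing on `[1, ∞)`. -/
lemma antitoneOn_exp_sub_self_mul :
    AntitoneOn (fun x : ℝ => (Real.exp x - x) * Real.exp (-(4 / 7 * x ^ 2))) (Set.Ici 1) := by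
  have hd (x : ℝ) : HasDerivAt (fun x : ℝ => (Real.exp x - x) * Real.exp (-(4 / 7 * x ^ 2)))
      ((Real.exp x - 1) * Real.exp (-(4 / 7 * x ^ 2)) +
        (Real.exp x - x) * (Real.exp (-(4 / 7 * x ^ 2)) * -(4 / 7 * (2 * x)))) x := by
    have h1 : HasDerivAt (fun x : ℝ => -(4 / 7 * x ^ 2)) (-(4 / 7 * (2 * x))) x := by
      simpa using ((hasDerivAt_pow 2 x).const_mul (4 / 7 : ℝ)).fun_neg
    exact ((Real.hasDerivAt_exp x).sub (hasDerivAt_id x)).mul h1.exp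
  refine antitoneOn_of_deriv_nonpos (convex_Ici 1)
    (fun x _ => (hd x).continuousAt.continuousWithinAt)
    (fun x _ => (hd x).differentiableAt.differentiableWithinAt) fun x hx => ?_
  rw [interior_Ici, Set.mem_Ioi] at hx
  rw [(hd x).deriv]
  have h2 := Real.quadratic_le_exp_of_nonneg (by linarith : 0 ≤ x)
  -- The sign of the derivative. Since `8/7 * x - 1 ≥ 0` here, the quadratic lower bound for `exp`
  -- may be inserted, which leaves the polynomial in `h5`.
  have h3 : Real.exp x - 1 - 8 / 7 * x * (Real.exp x - x) ≤ 0 := by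
    have h4 : (8 / 7 * x - 1) * (1 + x + x ^ 2 / 2) ≤ (8 / 7 * x - 1) * Real.exp x :=
      mul_le_mul_of_nonneg_left h2 (by linarith)
    have h5 : 0 ≤ x * (1 / 7 - x / 2 + 4 / 7 * x ^ 2) :=
      mul_nonneg (by linarith) (by nlinarith [sq_nonneg (x - 7 / 16)])
    nlinarith
  have h6 := mul_nonpos_of_nonneg_of_nonpos (Real.exp_pos (-(4 / 7 * x ^ 2))).le h3
  linarith

/-- Taylor bounds settle `[0, 1]`; beyond `1` the quotient `(eˣ - x) / e^{4x²/7}` decreases, so the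
bound at `1` propagates. -/
lemma exp_le_add_exp_sq_of_nonneg {x : ℝ} (hx : 0 ≤ x) :
    Real.exp x ≤ x + Real.exp (4 / 7 * x ^ 2) := by
  have small {x : ℝ} (hx : 0 ≤ x) (h1 : x ≤ 1) : Real.exp x ≤ x + Real.exp (4 / 7 * x ^ 2) := by
    have h2 := Real.exp_bound' hx h1 (n := 4) (by norm_num)
    have h3 := Real.quadratic_le_exp_of_nonneg (by positivity : 0 ≤ 4 / 7 * x ^ 2)
    simp only [Finset.sum_range_succ, Finset.sum_range_zero, Nat.factorial] at h2
    norm_num at h2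
    -- The gap between the two Taylor bounds: `1/14 = 4/7 - 1/2`, and the quadratic factor has
    -- negative discriminant.
    have h4 : 0 ≤ x ^ 2 * (1 / 14 - x / 6 + (8 / 49 - 5 / 96) * x ^ 2) :=
      mul_nonneg (sq_nonneg x) (by nlinarith [sq_nonneg (x - 3 / 4)])
    nlinarith
  rcases le_total x 1 with h | h
  · exact small hx h
  · have h1 := antitoneOn_exp_sub_self_mul Set.self_mem_Ici h h
    have h2 := small zero_le_one le_rfl
    simp only [Real.exp_neg] at h1
    have h3 : (Real.exp x - x) * (Real.exp (4 / 7 * x ^ 2))⁻¹ ≤ 1 := by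
      refine h1.trans ?_
      rw [← div_eq_mul_inv, div_le_one (Real.exp_pos _)]
      linarith
    rw [← div_eq_mul_inv, div_le_one (Real.exp_pos _)] at h3
    linarith

/-- For negative `x`, the inequality `-x ≤ sinh (-x)` reduces the claim to the one at `-x`. -/
lemma exp_le_add_exp_sq (x : ℝ) : Real.exp x ≤ x + Real.exp (4 / 7 * x ^ 2) := by
  rcases le_total 0 x with h | h
  · exact exp_le_add_exp_sq_of_nonneg h
  · have h1 := exp_le_add_exp_sq_of_nonneg (neg_nonneg.2 h)
    have h2 := Real.self_le_sinh_iff.2 (neg_nonneg.2 h)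
    rw [Real.sinh_eq, neg_neg] at h2
    rw [neg_sq] at h1
    linarith

/-- The concave function `t ↦ t^θ` lies below its tangent at `t = 2`, the bound on the exponential
moment. This makes the conditional Jensen inequality a consequence of linearity and monotonicity. -/
lemma exp_mul_le_of_le_one (y : ℝ) {θ : ℝ} (h0 : 0 ≤ θ) (h1 : θ ≤ 1) :
    Real.exp (θ * y) ≤ 2 ^ θ * (1 + θ * (Real.exp y / 2 - 1)) := by
  have h := rpow_one_add_le_one_add_mul_self (s := Real.exp y / 2 - 1)
    (by linarith [Real.exp_pos y]) h0 h1
  calc Real.exp (θ * y) = 2 ^ θ * (1 + (Real.exp y / 2 - 1)) ^ θ := by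
        rw [← Real.mul_rpow (by norm_num) (by linarith [Real.exp_pos y]), mul_comm,
          Real.exp_mul]
        congr 1
        ring
    _ ≤ _ := mul_le_mul_of_nonneg_left h (by positivity)

end ExpInequality

/-! ### Conditional moment bounds -/

section CondExp

variable {Ω : Type*} {m : MeasurableSpace Ω} [mΩ : MeasurableSpace Ω] {μ : Measure Ω}
  [IsProbabilityMeasure μ] {X Y : Ω → ℝ} {b : ℝ}

omit [IsProbabilityMeasure μ] in
lemma CondExpLE.mono (h : CondExpLE μ m Y b) (hX : AEStronglyMeasurable X μ)
    (h0 : ∀ x, 0 ≤ X x) (hXY : ∀ x, X x ≤ Y x) : CondExpLE μ m X b := by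
  have hint : Integrable X μ := h.1.mono hX (Eventually.of_forall fun x => by
    rw [Real.norm_of_nonneg (h0 x), Real.norm_of_nonneg ((h0 x).trans (hXY x))]
    exact hXY x)
  refine ⟨hint, ?_⟩
  filter_upwards [h.2, condExp_mono (m := m) hint h.1 (Eventually.of_forall hXY)] with x h1 h2
  exact h2.trans h1

lemma CondExpLE.integral_le (hm : m ≤ mΩ) (h : CondExpLE μ m X b) : ∫ x, X x ∂μ ≤ b := by
  rw [← integral_condExp hm]
  calc ∫ x, (μ[X | m]) x ∂μ ≤ ∫ _x, b ∂μ :=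
        integral_mono_ae integrable_condExp (integrable_const b) h.2
    _ = b := by simp

/-- On the smaller σ-algebra the measure with density `X` is dominated by `b • μ`. Phrased with
lower integrals, this needs no integrability of the factor `Z`. -/
lemma CondExpLE.lintegral_mul_le (hm : m ≤ mΩ) (h0 : ∀ x, 0 ≤ X x) (hb : 0 ≤ b)
    (h : CondExpLE μ m X b) {Z : Ω → ENNReal} (hZ : Measurable[m] Z) :
    ∫⁻ x, Z x * ENNReal.ofReal (X x) ∂μ ≤ ENNReal.ofReal b * ∫⁻ x, Z x ∂μ := by
  have hmeas : AEMeasurable (fun x => ENNReal.ofReal (X x)) μ :=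
    h.1.1.aemeasurable.ennreal_ofReal
  have hle : (μ.withDensity fun x => ENNReal.ofReal (X x)).trim hm ≤
      (ENNReal.ofReal b • μ).trim hm := by
    refine @Measure.le_intro _ m _ _ fun s hs _ => ?_
    rw [trim_measurableSet_eq hm hs, trim_measurableSet_eq hm hs, withDensity_apply _ (hm s hs),
      ← ofReal_integral_eq_lintegral_ofReal h.1.integrableOn (Eventually.of_forall h0),
      ← setIntegral_condExp hm h.1 hs, Measure.smul_apply, smul_eq_mul]
    have h1 : ∫ x in s, (μ[X | m]) x ∂μ ≤ ∫ _x in s, b ∂μ :=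
      integral_mono_ae integrable_condExp.integrableOn (integrable_const b)
        (ae_restrict_of_ae h.2)
    rw [setIntegral_const, smul_eq_mul, mul_comm] at h1
    refine (ENNReal.ofReal_le_ofReal h1).trans ?_
    rw [ENNReal.ofReal_mul hb, ofReal_measureReal]
  calc ∫⁻ x, Z x * ENNReal.ofReal (X x) ∂μ
      = ∫⁻ x, Z x ∂(μ.withDensity fun x => ENNReal.ofReal (X x)) := by
        rw [lintegral_withDensity_eq_lintegral_mul₀ hmeas (hZ.mono hm le_rfl).aemeasurable]
        simp [mul_comm]
    _ = ∫⁻ x, Z x ∂((μ.withDensity fun x => ENNReal.ofReal (X x)).trim hm) :=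
        (lintegral_trim hm hZ).symm
    _ ≤ ∫⁻ x, Z x ∂((ENNReal.ofReal b • μ).trim hm) := lintegral_mono' hle le_rfl
    _ = ENNReal.ofReal b * ∫⁻ x, Z x ∂μ := by
        rw [lintegral_trim hm hZ, lintegral_smul_measure, smul_eq_mul]

lemma CondExpLE.const_add_mul (hm : m ≤ mΩ) (h : CondExpLE μ m X b) (c : ℝ) {d : ℝ} (hd : 0 ≤ d) :
    CondExpLE μ m (fun x => c + d * X x) (c + d * b) := by
  refine ⟨(integrable_const c).add (h.1.const_mul d), ?_⟩
  have h1 := condExp_add (m := m) (integrable_const (μ := μ) c) (h.1.const_mul d)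
  have h2 := condExp_smul (μ := μ) d X m
  rw [condExp_const hm] at h1
  filter_upwards [h.2, h1, h2] with x hx1 hx2 hx3
  change (μ[(fun _ => c) + (fun x => d * X x) | m]) x ≤ _
  change (μ[fun x => d * X x | m]) x = _ at hx3
  rw [hx2, Pi.add_apply, hx3]
  simp only [Pi.smul_apply, smul_eq_mul]
  gcongr

omit [IsProbabilityMeasure μ] in
lemma CondExpLE.add (h : CondExpLE μ m X b) {b' : ℝ} (h' : CondExpLE μ m Y b') :
    CondExpLE μ m (fun x => X x + Y x) (b + b') := by
  refine ⟨h.1.add h'.1, ?_⟩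
  filter_upwards [h.2, h'.2, condExp_add h.1 h'.1 m] with x hx1 hx2 hx3
  change (μ[X + Y | m]) x ≤ _
  rw [hx3]
  exact add_le_add hx1 hx2

omit [IsProbabilityMeasure μ] in
lemma CondExpLE.mono_right (h : CondExpLE μ m X b) {b' : ℝ} (hb : b ≤ b') : CondExpLE μ m X b' :=
  ⟨h.1, h.2.mono fun _ hx => hx.trans hb⟩

/-- Conditional Jensen inequality for the power `θ ∈ [0, 1]` of an exponential. -/
lemma CondExpLE.exp_mul (hm : m ≤ mΩ) (h : CondExpLE μ m (fun x => Real.exp (Y x)) 2)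
    (hY : AEStronglyMeasurable Y μ) {θ : ℝ} (h0 : 0 ≤ θ) (h1 : θ ≤ 1) :
    CondExpLE μ m (fun x => Real.exp (θ * Y x)) (Real.exp (θ * Real.log 2)) := by
  have h2 : (0 : ℝ) < 2 ^ θ := by positivity
  have hc := h.const_add_mul hm (2 ^ θ * (1 - θ)) (d := 2 ^ θ * θ / 2) (by positivity)
  have hb : 2 ^ θ * (1 - θ) + 2 ^ θ * θ / 2 * 2 = Real.exp (θ * Real.log 2) := by
    rw [Real.rpow_def_of_pos (by norm_num), mul_comm (Real.log 2)]
    ring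
  rw [hb] at hc
  refine hc.mono (Real.continuous_exp.comp_aestronglyMeasurable (hY.const_mul θ))
    (fun x => (Real.exp_pos _).le) fun x => ?_
  refine (exp_mul_le_of_le_one (Y x) h0 h1).trans (le_of_eq ?_)
  ring

/-- Conditional moment generating function of a variable with a light tail and a small bias. -/
lemma CondExpLE.exp_const_mul (hm : m ≤ mΩ) (hX : AEStronglyMeasurable X μ)
    (h : CondExpLE μ m (fun x => Real.exp (X x ^ 2)) 2) {β : ℝ} (hβ : 0 ≤ β)
    (hbias : ∀ᵐ x ∂μ, |(μ[X | m]) x| ≤ β) {r : ℝ} (hr : 4 / 7 * r ^ 2 ≤ 1) :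
    CondExpLE μ m (fun x => Real.exp (r * X x))
      (Real.exp (4 / 7 * r ^ 2 * Real.log 2 + |r| * β)) := by
  have hXint : Integrable X μ := h.1.mono hX (Eventually.of_forall fun x => by
    rw [Real.norm_eq_abs, Real.norm_of_nonneg (Real.exp_pos _).le]
    have := Real.add_one_le_exp (X x ^ 2)
    nlinarith [sq_nonneg (|X x| - 1), sq_abs (X x)])
  have h1 : CondExpLE μ m (fun x => r * X x) (|r| * β) := by
    refine ⟨hXint.const_mul r, ?_⟩
    filter_upwards [hbias, condExp_smul (μ := μ) r X m] with x hx1 hx2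
    change (μ[fun x => r * X x | m]) x = _ at hx2
    rw [hx2, Pi.smul_apply, smul_eq_mul]
    refine (le_abs_self _).trans ?_
    rw [abs_mul]
    gcongr
  have h2 := h.exp_mul hm (hX.pow 2) (θ := 4 / 7 * r ^ 2) (by positivity) hr
  -- The linear term only sees the bias and the Gaussian-type term is at least `1`, so their sum is
  -- at most a single exponential.
  refine CondExpLE.mono_right (b := |r| * β + Real.exp (4 / 7 * r ^ 2 * Real.log 2)) ?_ ?_
  · refine (h1.add h2).mono (Real.continuous_exp.comp_aestronglyMeasurable (hX.const_mul r))
      (fun x => (Real.exp_pos _).le) fun x => ?_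
    have := exp_le_add_exp_sq (r * X x)
    rwa [mul_pow, ← mul_assoc] at this
  · rw [Real.exp_add]
    have h3 : 1 ≤ Real.exp (4 / 7 * r ^ 2 * Real.log 2) :=
      Real.one_le_exp (mul_nonneg (by positivity) (Real.log_nonneg (by norm_num)))
    have h4 := Real.add_one_le_exp (|r| * β)
    have h5 : 0 ≤ |r| * β := by positivity
    nlinarith

end CondExp

/-! ### Exponential moments of adapted sums -/

section Concentration

variable {Ω : Type*} [mΩ : MeasurableSpace Ω] {μ : Measure Ω} [IsProbabilityMeasure μ]
  {ℱ : Filtration ℕ mΩ}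

/-- Factors are peeled off from the last one, each conditioned on its past. The first `m` are kept:
`m = 0` gives a plain tail bound, while `m = 1` leaves the initial factor open so that its two signs
can later be added. -/
lemma lintegral_exp_sum_le {g : ℕ → Ω → ℝ} {B : ℝ} (hB : 0 ≤ B) {m n : ℕ}
    (hmeas : ∀ t < m + n, Measurable[ℱ (t + 1)] (g t))
    (h : ∀ t < m + n, m ≤ t → CondExpLE μ (ℱ t) (fun x => Real.exp (g t x)) B) :
    ∫⁻ x, ENNReal.ofReal (Real.exp (∑ t ∈ Finset.range (m + n), g t x)) ∂μ ≤
      ENNReal.ofReal (B ^ n) *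
        ∫⁻ x, ENNReal.ofReal (Real.exp (∑ t ∈ Finset.range m, g t x)) ∂μ := by
  induction n with
  | zero => simp
  | succ n ih =>
    have ih := ih (fun t ht => hmeas t (by omega)) (fun t ht => h t (by omega))
    have hZ : Measurable[ℱ (m + n)] fun x =>
        ENNReal.ofReal (Real.exp (∑ t ∈ Finset.range (m + n), g t x)) := by
      refine ENNReal.measurable_ofReal.comp (Real.measurable_exp.comp ?_)
      refine Finset.measurable_fun_sum _ fun t ht => ?_
      have ht := Finset.mem_range.1 ht
      exact (hmeas t (by omega)).mono (ℱ.mono (by omega)) le_rfl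
    calc ∫⁻ x, ENNReal.ofReal (Real.exp (∑ t ∈ Finset.range (m + (n + 1)), g t x)) ∂μ
        = ∫⁻ x, ENNReal.ofReal (Real.exp (∑ t ∈ Finset.range (m + n), g t x)) *
            ENNReal.ofReal (Real.exp (g (m + n) x)) ∂μ := by
          refine lintegral_congr fun x => ?_
          rw [← ENNReal.ofReal_mul (Real.exp_pos _).le, ← Real.exp_add, ← add_assoc,
            Finset.sum_range_succ]
      _ ≤ ENNReal.ofReal B *
            ∫⁻ x, ENNReal.ofReal (Real.exp (∑ t ∈ Finset.range (m + n), g t x)) ∂μ :=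
          (h (m + n) (by omega) (by omega)).lintegral_mul_le (ℱ.le _)
            (fun _ => (Real.exp_pos _).le) hB hZ
      _ ≤ _ := by
          rw [pow_succ', ENNReal.ofReal_mul hB, mul_assoc]
          gcongr

omit [IsProbabilityMeasure μ] in
lemma measureReal_le_of_lintegral_exp_le {S : Ω → ℝ} (hS : Measurable S) {C : ℝ} (hC : 0 ≤ C)
    (h : ∫⁻ x, ENNReal.ofReal (Real.exp (S x)) ∂μ ≤ ENNReal.ofReal C) (l : ℝ) :
    μ.real {x | l ≤ S x} ≤ C * Real.exp (-l) := by
  have h1 := mul_meas_ge_le_lintegral (μ := μ)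
    (ENNReal.measurable_ofReal.comp (Real.measurable_exp.comp hS)) (ENNReal.ofReal (Real.exp l))
  have h2 : {x | l ≤ S x} ⊆ {x | ENNReal.ofReal (Real.exp l) ≤
      (ENNReal.ofReal ∘ Real.exp ∘ S) x} := fun x hx =>
    ENNReal.ofReal_le_ofReal (Real.exp_le_exp.2 hx)
  have h3 : ENNReal.ofReal (Real.exp l) * μ {x | l ≤ S x} ≤ ENNReal.ofReal C :=
    (mul_le_mul_right (measure_mono h2) _).trans (h1.trans h)
  have h4 : Real.exp l * μ.real {x | l ≤ S x} ≤ C := by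
    have := ENNReal.toReal_mono ENNReal.ofReal_ne_top h3
    rwa [ENNReal.toReal_mul, ENNReal.toReal_ofReal (Real.exp_pos l).le,
      ENNReal.toReal_ofReal hC] at this
  rw [Real.exp_neg, ← div_eq_mul_inv, le_div_iff₀ (Real.exp_pos l)]
  linarith

/-- Tail bound for a sum of variables with exponential moments conditionally bounded by `2`. -/
lemma measureReal_le_sum_le {k : ℕ} {Y : ℕ → Ω → ℝ}
    (hmeas : ∀ t < k, Measurable[ℱ (t + 1)] (Y t))
    (h : ∀ t < k, CondExpLE μ (ℱ t) (fun x => Real.exp (Y t x)) 2) (l : ℝ) :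
    μ.real {x | l ≤ ∑ t ∈ Finset.range k, Y t x} ≤ 2 ^ k * Real.exp (-l) := by
  have h1 := lintegral_exp_sum_le (μ := μ) (ℱ := ℱ) (g := Y) (B := 2) (by norm_num) (m := 0) (n := k)
    (fun t ht => hmeas t (by omega)) (fun t ht _ => h t (by omega))
  simp only [zero_add, Finset.range_zero, Finset.sum_empty, Real.exp_zero, ENNReal.ofReal_one,
    lintegral_const, measure_univ, mul_one] at h1
  refine measureReal_le_of_lintegral_exp_le ?_ (by positivity) h1 l
  exact Finset.measurable_fun_sum _ fun t ht =>
    (hmeas t (Finset.mem_range.1 ht)).mono (ℱ.le _) le_rfl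

end Concentration

/-! ### Two-sided tail bound for nearly centered sums -/

section Concentration

variable {Ω : Type*} [mΩ : MeasurableSpace Ω] {μ : Measure Ω} [IsProbabilityMeasure μ]
  {ℱ : Filtration ℕ mΩ}

/-- The exponent balance behind `measureReal_sqrt_lt_abs_sum_le`, where `r` is the Chernoff
parameter. -/
lemma chernoff_exponent_le {k l r : ℝ} (hk : 1 ≤ k) (hl : Real.log 2 ≤ l) (hr0 : 0 ≤ r)
    (hr : 4 / 7 * r ^ 2 * Real.log 2 * k = l) :
    k * (4 / 7 * r ^ 2 * Real.log 2) + (k - 1) * (r * (1 / k)) - r * √(3 * k * l) ≤ -l := by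
  have h1 := Real.log_two_gt_d9
  have h2 := Real.log_two_lt_d9
  have hk0 : 0 < k := by linarith
  -- From `l ≥ log 2`. It makes `k * r` of order at least `√k`, which pays for the bias.
  have hkr : 7 / 4 * k ≤ (k * r) ^ 2 := by
    have : Real.log 2 * (7 / 4 * k) ≤ Real.log 2 * (k * r) ^ 2 := by nlinarith
    exact le_of_mul_le_mul_left this (by linarith)
  have hT : 1.09 * (k * r) ≤ √(3 * k * l) := by
    refine Real.le_sqrt_of_sq_le ?_
    rw [← hr]
    nlinarith [sq_nonneg (k * r)]
  -- The constant fits `2 * 0.3961119 + 0.2977 ≤ 1.09`. The intermediate bound `4/27 * k` comes from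
  -- `4k³ - 27(k-1)² = (k-3)²(4k-3)` and is tight at `k = 3`.
  have hb : (k - 1) * (1 / k) ≤ 0.2977 * (k * r) := by
    refine le_of_sq_le_sq ?_ (by positivity)
    have h3 : ((k - 1) * (1 / k)) ^ 2 ≤ 4 / 27 * k := by
      rw [mul_one_div, div_pow, div_le_iff₀ (by positivity)]
      nlinarith [mul_nonneg (sq_nonneg (k - 3)) (by linarith : 0 ≤ k - 3 / 4)]
    nlinarith
  have hc : k * (4 / 7 * r ^ 2 * Real.log 2) ≤ 0.3961119 * (k * r) * r := by
    have : 0 ≤ k * r * r := by positivity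
    nlinarith
  have h4 := mul_le_mul_of_nonneg_left hT hr0
  have h5 := mul_le_mul_of_nonneg_left hb hr0
  have h6 : 0 ≤ k * r * r := by positivity
  nlinarith

/-- A concentration inequality for sums of conditionally light-tailed, nearly centered variables. -/
lemma measureReal_sqrt_lt_abs_sum_le {k : ℕ} (hk : 1 ≤ k) {X : ℕ → Ω → ℝ}
    (hmeas : ∀ t < k, Measurable[ℱ (t + 1)] (X t))
    (h : ∀ t < k, CondExpLE μ (ℱ t) (fun x => Real.exp (X t x ^ 2)) 2)
    (hbias : ∀ t < k, ∀ᵐ x ∂μ, |(μ[X t | ℱ t]) x| ≤ 1 / k) {l : ℝ} (hl : Real.log 2 ≤ l) :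
    μ.real {x | √(3 * k * l) < |∑ t ∈ Finset.range k, X t x|} ≤ 2 * Real.exp (-l) := by
  have hlog : 0 < Real.log 2 := Real.log_pos (by norm_num)
  have hl0 : 0 < l := hlog.trans_le hl
  have hk0 : (0 : ℝ) < k := by exact_mod_cast hk
  have hX (t : ℕ) (ht : t < k) : Measurable (X t) := (hmeas t ht).mono (ℱ.le _) le_rfl
  have hS : Measurable fun x => ∑ t ∈ Finset.range k, X t x :=
    Finset.measurable_fun_sum _ fun t ht => hX t (Finset.mem_range.1 ht)
  -- For large `l`, Cauchy-Schwarz forces `∑ X_t² ≥ 3l`, an event of probability at most `2^k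
  -- e^{-3l} ≤ 2 e^{-l}`, and the bias plays no role.
  by_cases hcase : (k - 1) * Real.log 2 ≤ 2 * l
  · have hsub : {x | √(3 * k * l) < |∑ t ∈ Finset.range k, X t x|} ⊆
        {x | 3 * l ≤ ∑ t ∈ Finset.range k, X t x ^ 2} := by
      intro x hx
      have hx : √(3 * k * l) < |∑ t ∈ Finset.range k, X t x| := hx
      have h1 := (Real.sqrt_lt' ((Real.sqrt_nonneg _).trans_lt hx)).1 hx
      rw [sq_abs] at h1
      have h2 := sq_sum_le_card_mul_sum_sq (s := Finset.range k) (f := fun t => X t x)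
      rw [Finset.card_range] at h2
      refine le_of_mul_le_mul_left ?_ hk0
      linarith
    refine (measureReal_mono hsub).trans ((measureReal_le_sum_le (ℱ := ℱ)
      (fun t ht => (hmeas t ht).pow_const 2) h _).trans ?_)
    have e1 : (2 : ℝ) ^ k = Real.exp (k * Real.log 2) := by
      rw [Real.exp_nat_mul, Real.exp_log (by norm_num)]
    have e2 : (2 : ℝ) * Real.exp (-l) = Real.exp (Real.log 2 + -l) := by
      rw [Real.exp_add, Real.exp_log (by norm_num)]
    rw [e1, e2, ← Real.exp_add]
    refine Real.exp_le_exp.2 ?_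
    linarith
  · push Not at hcase
    -- Chosen so that the variance part of the exponent is exactly `l`. In the present case `4/7 *
    -- r² ≤ 1`, as the moment bound requires.
    set r : ℝ := √(l / (4 / 7 * Real.log 2 * k)) with hrdef
    have hr0 : 0 ≤ r := Real.sqrt_nonneg _
    have hr2 : r ^ 2 = l / (4 / 7 * Real.log 2 * k) := Real.sq_sqrt (by positivity)
    have hr : 4 / 7 * r ^ 2 * Real.log 2 * k = l := by
      rw [hr2]; field_simp
    have hr1 : 4 / 7 * r ^ 2 ≤ 1 := by
      have : 4 / 7 * r ^ 2 * (Real.log 2 * k) ≤ 1 * (Real.log 2 * k) := by nlinarith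
      exact le_of_mul_le_mul_right this (by positivity)
    obtain ⟨n, rfl⟩ : ∃ n, k = 1 + n := ⟨k - 1, by omega⟩
    set B : ℝ := Real.exp (4 / 7 * r ^ 2 * Real.log 2 + r * (1 / ((1 + n : ℕ) : ℝ))) with hB
    have hcond (e : ℝ) (he : |e| = r) (t : ℕ) (ht : t < 1 + n) :
        CondExpLE μ (ℱ t) (fun x => Real.exp (e * X t x)) B := by
      have he2 : e ^ 2 = r ^ 2 := by rw [← sq_abs, he]
      have := (h t ht).exp_const_mul (ℱ.le t) (hX t ht).aestronglyMeasurable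
        (by positivity) (hbias t ht) (r := e) (by rw [he2]; exact hr1)
      rwa [he2, he] at this
    have hint (e : ℝ) (he : |e| = r) : Integrable (fun x => Real.exp (e * X 0 x)) μ :=
      (hcond e he 0 (by omega)).1
    have htail (e : ℝ) (he : |e| = r) (a : ℝ) :
        μ.real {x | a ≤ e * ∑ t ∈ Finset.range (1 + n), X t x} ≤
          B ^ n * (∫ x, Real.exp (e * X 0 x) ∂μ) * Real.exp (-a) := by
      have h1 := lintegral_exp_sum_le (μ := μ) (ℱ := ℱ) (g := fun t x => e * X t x) (B := B)
        (Real.exp_pos _).le (m := 1) (n := n) (fun t ht => (hmeas t ht).const_mul e)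
        (fun t ht _ => hcond e he t ht)
      simp only [Finset.range_one, Finset.sum_singleton, ← Finset.mul_sum] at h1
      rw [← ofReal_integral_eq_lintegral_ofReal (hint e he)
        (Eventually.of_forall fun x => (Real.exp_pos _).le),
        ← ENNReal.ofReal_mul (by positivity)] at h1
      exact measureReal_le_of_lintegral_exp_le (hS.const_mul e)
        (mul_nonneg (by positivity) (integral_nonneg fun x => (Real.exp_pos _).le)) h1 a
    have hr' : |r| = r := abs_of_nonneg hr0
    have hnr : |-r| = r := by rw [abs_neg, hr']
    -- In the sum of the two tails the linear terms at time `0` cancel, so only `k - 1` steps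
    -- contribute a bias. For small `k` this saving is needed.
    have hfirst : ∫ x, Real.exp (r * X 0 x) ∂μ + ∫ x, Real.exp (-r * X 0 x) ∂μ ≤
        2 * Real.exp (4 / 7 * r ^ 2 * Real.log 2) := by
      rw [← integral_add (hint r hr') (hint (-r) hnr)]
      have h2 := (h 0 (by omega)).exp_mul (ℱ.le 0)
        ((hX 0 (by omega)).pow_const 2).aestronglyMeasurable
        (θ := 4 / 7 * r ^ 2) (by positivity) hr1
      calc ∫ x, (Real.exp (r * X 0 x) + Real.exp (-r * X 0 x)) ∂μ
          ≤ ∫ x, 2 * Real.exp (4 / 7 * r ^ 2 * X 0 x ^ 2) ∂μ := by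
            refine integral_mono ((hint r hr').add (hint (-r) hnr)) (h2.1.const_mul 2)
              fun x => ?_
            have e1 := exp_le_add_exp_sq (r * X 0 x)
            have e2 := exp_le_add_exp_sq (-r * X 0 x)
            rw [mul_pow, ← mul_assoc] at e1 e2
            rw [neg_sq] at e2
            linarith
        _ ≤ _ := by
            rw [integral_const_mul]
            exact mul_le_mul_of_nonneg_left (h2.integral_le (ℱ.le 0)) (by norm_num)
    set T := √(3 * ((1 + n : ℕ) : ℝ) * l) with hT
    have hsub : {x | T < |∑ t ∈ Finset.range (1 + n), X t x|} ⊆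
        {x | r * T ≤ r * ∑ t ∈ Finset.range (1 + n), X t x} ∪
          {x | r * T ≤ -r * ∑ t ∈ Finset.range (1 + n), X t x} := by
      intro x hx
      have hx : T < |∑ t ∈ Finset.range (1 + n), X t x| := hx
      rcases lt_abs.1 hx with h1 | h1
      · exact Or.inl (mul_le_mul_of_nonneg_left h1.le hr0)
      · refine Or.inr ?_
        have := mul_le_mul_of_nonneg_left h1.le hr0
        simpa using this
    calc μ.real {x | T < |∑ t ∈ Finset.range (1 + n), X t x|}
        ≤ B ^ n * (∫ x, Real.exp (r * X 0 x) ∂μ) * Real.exp (-(r * T)) +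
          B ^ n * (∫ x, Real.exp (-r * X 0 x) ∂μ) * Real.exp (-(r * T)) :=
          (measureReal_mono hsub).trans ((measureReal_union_le _ _).trans
            (add_le_add (htail r hr' _) (htail (-r) hnr _)))
      _ = B ^ n * (∫ x, Real.exp (r * X 0 x) ∂μ + ∫ x, Real.exp (-r * X 0 x) ∂μ) *
            Real.exp (-(r * T)) := by ring
      _ ≤ B ^ n * (2 * Real.exp (4 / 7 * r ^ 2 * Real.log 2)) * Real.exp (-(r * T)) := by
          gcongr
      _ = 2 * Real.exp (((1 + n : ℕ) : ℝ) * (4 / 7 * r ^ 2 * Real.log 2) +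
            (((1 + n : ℕ) : ℝ) - 1) * (r * (1 / ((1 + n : ℕ) : ℝ))) - r * T) := by
          rw [hB, ← Real.exp_nat_mul, mul_left_comm, ← Real.exp_add, mul_assoc, ← Real.exp_add]
          congr 2
          push_cast
          ring
      _ ≤ 2 * Real.exp (-l) := by
          have := chernoff_exponent_le (by exact_mod_cast hk) hl hr0 hr
          gcongr

end Concentration

/-! ### Second moments of martingale sums -/

section SecondMoment

variable {Ω : Type*} {m : MeasurableSpace Ω} [mΩ : MeasurableSpace Ω] {μ : Measure Ω}
  [IsProbabilityMeasure μ] {ℱ : Filtration ℕ mΩ}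

lemma integral_mul_sub_condExp_eq_zero (hm : m ≤ mΩ) {Z X : Ω → ℝ}
    (hZm : StronglyMeasurable[m] Z) (hZ : MemLp Z 2 μ) (hX : MemLp X 2 μ) :
    ∫ x, Z x * (X x - (μ[X | m]) x) ∂μ = 0 := by
  have hX1 : Integrable X μ := hX.integrable (by norm_num)
  have hZX : Integrable (Z * X) μ := hZ.integrable_mul hX
  have hZc : Integrable (Z * μ[X | m]) μ := hZ.integrable_mul (hX.condExp (by norm_num))
  have h1 := condExp_mul_of_stronglyMeasurable_left hZm hZX hX1
  calc ∫ x, Z x * (X x - (μ[X | m]) x) ∂μ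
      = ∫ x, (Z * X) x ∂μ - ∫ x, (Z * μ[X | m]) x ∂μ := by
        rw [← integral_sub hZX hZc]
        exact integral_congr_ae (Eventually.of_forall fun x => by simp; ring)
    _ = 0 := by rw [← integral_condExp hm, integral_congr_ae h1, sub_self]

omit [IsProbabilityMeasure μ] in
lemma integral_add_sq_of_integral_mul_eq_zero {f g : Ω → ℝ} (hf : MemLp f 2 μ) (hg : MemLp g 2 μ)
    (h : ∫ x, f x * g x ∂μ = 0) :
    ∫ x, (f x + g x) ^ 2 ∂μ = ∫ x, f x ^ 2 ∂μ + ∫ x, g x ^ 2 ∂μ := by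
  have hfg : Integrable (fun x => f x * g x) μ := hf.integrable_mul hg
  calc ∫ x, (f x + g x) ^ 2 ∂μ = ∫ x, (f x ^ 2 + g x ^ 2 + 2 * (f x * g x)) ∂μ := by
        refine integral_congr_ae (Eventually.of_forall fun x => ?_)
        simp only
        ring
    _ = ∫ x, (f x ^ 2 + g x ^ 2) ∂μ + ∫ x, 2 * (f x * g x) ∂μ :=
        integral_add (hf.integrable_sq.add hg.integrable_sq) (hfg.const_mul 2)
    _ = _ := by
        rw [integral_const_mul, h, mul_zero, add_zero,
          integral_add hf.integrable_sq hg.integrable_sq]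

lemma integral_sub_condExp_sq_le (hm : m ≤ mΩ) {X : Ω → ℝ} (hX : MemLp X 2 μ) :
    ∫ x, (X x - (μ[X | m]) x) ^ 2 ∂μ ≤ ∫ x, X x ^ 2 ∂μ := by
  have hc : MemLp (μ[X | m]) 2 μ := hX.condExp (by norm_num)
  have h0 := integral_mul_sub_condExp_eq_zero hm stronglyMeasurable_condExp hc hX
  have hM : MemLp (fun x => X x - (μ[X | m]) x) 2 μ := hX.sub hc
  have h1 := integral_add_sq_of_integral_mul_eq_zero hc hM h0
  simp only [add_sub_cancel] at h1
  have h3 : 0 ≤ ∫ x, (μ[X | m]) x ^ 2 ∂μ := integral_nonneg fun x => sq_nonneg _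
  linarith

/-- The second moment of a sum of martingale differences. -/
lemma integral_sum_sub_condExp_sq_le {k : ℕ} {X : ℕ → Ω → ℝ}
    (hmeas : ∀ t < k, Measurable[ℱ (t + 1)] (X t)) (hX : ∀ t < k, MemLp (X t) 2 μ) {v : ℝ}
    (hv : ∀ t < k, ∫ x, X t x ^ 2 ∂μ ≤ v) :
    MemLp (fun x => ∑ t ∈ Finset.range k, (X t x - (μ[X t | ℱ t]) x)) 2 μ ∧
      ∫ x, (∑ t ∈ Finset.range k, (X t x - (μ[X t | ℱ t]) x)) ^ 2 ∂μ ≤ k * v := by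
  induction k with
  | zero => simp
  | succ k ih =>
    obtain ⟨ih1, ih2⟩ := ih (fun t ht => hmeas t (by omega)) (fun t ht => hX t (by omega))
      (fun t ht => hv t (by omega))
    have hXk := hX k (by omega)
    have hM : MemLp (fun x => X k x - (μ[X k | ℱ k]) x) 2 μ :=
      hXk.sub (hXk.condExp (by norm_num))
    refine ⟨?_, ?_⟩
    · simp_rw [Finset.sum_range_succ]
      exact ih1.add hM
    -- The past sum is known at time `k`, hence orthogonal to the next martingale difference, and
    -- the squares add.
    have hSm : StronglyMeasurable[ℱ k]
        fun x => ∑ t ∈ Finset.range k, (X t x - (μ[X t | ℱ t]) x) := by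
      refine Finset.stronglyMeasurable_fun_sum _ fun t ht => ?_
      have ht := Finset.mem_range.1 ht
      exact (((hmeas t (by omega)).mono (ℱ.mono (by omega)) le_rfl).stronglyMeasurable).sub
        (stronglyMeasurable_condExp.mono (ℱ.mono ht.le))
    have h0 := integral_mul_sub_condExp_eq_zero (ℱ.le k) hSm ih1 hXk
    have h1 := integral_sub_condExp_sq_le (ℱ.le k) hXk
    have h2 := integral_add_sq_of_integral_mul_eq_zero ih1 hM h0
    simp_rw [Finset.sum_range_succ]
    rw [h2]
    push_cast
    linarith [hv k (by omega)]

lemma integral_le_sqrt_of_sq_le {f : Ω → ℝ} (hf : MemLp f 2 μ) {v : ℝ}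
    (h : ∫ x, f x ^ 2 ∂μ ≤ v) : ∫ x, f x ∂μ ≤ √v := by
  have h1 := ProbabilityTheory.variance_nonneg f μ
  rw [ProbabilityTheory.variance_eq_sub hf] at h1
  refine Real.le_sqrt_of_sq_le ?_
  have h2 : ∫ x, (f ^ 2) x ∂μ = ∫ x, f x ^ 2 ∂μ := rfl
  linarith

end SecondMoment

/-! ### Measurability of values along random policies -/

section Measurability

variable {S A Ω : Type*} [Fintype S] [Fintype A] [MeasurableSpace Ω] {M : MDP S A}
  {π : Ω → S → A → ℝ}

lemma measurable_comp_of_continuousOn_simplex {f : (A → ℝ) → ℝ}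
    (hf : ContinuousOn f (stdSimplex ℝ A)) {p : Ω → A → ℝ} (hp : Measurable p)
    (hmem : ∀ x, p x ∈ stdSimplex ℝ A) : Measurable fun x => f (p x) :=
  (continuousOn_iff_continuous_domRestrict.1 hf).measurable.comp (hp.subtype_mk (h := hmem))

lemma measurable_dot {p q : Ω → A → ℝ} (hp : Measurable p) (hq : Measurable q) :
    Measurable fun x => dot (p x) (q x) :=
  continuous_dot.measurable.comp (hp.prodMk hq)

lemma measurable_stateActionLaw (hπ : ∀ s a, Measurable fun x => π x s a) (init : S → A → ℝ)
    (t : ℕ) (s : S) (a : A) : Measurable fun x => stateActionLaw M (π x) init t s a := by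
  induction t generalizing s a with
  | zero => exact measurable_const
  | succ t ih =>
    exact (Finset.measurable_fun_sum _ fun s' _ => Finset.measurable_fun_sum _ fun a' _ =>
      (ih s' a').mul_const _).mul (hπ s a)

/-- The action value is a pointwise limit of partial sums, each built from the policy by finite sums
and products and the regularizer, which is continuous on the simplex. -/
lemma measurable_qValue (hh : ∀ s, ContinuousOn (M.h s) (stdSimplex ℝ A))
    (hπ : ∀ x, IsPolicy (π x)) (hmeas : ∀ s a, Measurable fun x => π x s a) (s : S) (a : A) :
    Measurable fun x => qValue M (π x) s a := by
  classical
  refine measurable_of_tendsto_metrizable (fun n => ?_) (tendsto_pi_nhds.2 fun x =>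
    (summable_discountedCost M (hπ x) (isLaw_dirac s a)).hasSum.tendsto_sum_nat)
  refine Finset.measurable_fun_sum _ fun t _ => Measurable.const_mul
    (Finset.measurable_fun_sum _ fun s' _ => Finset.measurable_fun_sum _ fun a' _ =>
      (measurable_stateActionLaw hmeas _ t s' a').mul (measurable_const.add ?_)) _
  exact measurable_comp_of_continuousOn_simplex (hh s')
    (measurable_pi_lambda _ fun a => hmeas s' a) fun x => hπ x s'

lemma measurable_value (hh : ∀ s, ContinuousOn (M.h s) (stdSimplex ℝ A))
    (hπ : ∀ x, IsPolicy (π x)) (hmeas : ∀ s a, Measurable fun x => π x s a) (s : S) :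
    Measurable fun x => value M (π x) s := by
  simp_rw [fun x => value_eq_dot M (hπ x) s]
  exact measurable_dot (measurable_pi_lambda _ fun a => measurable_qValue hh hπ hmeas s a)
    (measurable_pi_lambda _ fun a => hmeas s a)

end Measurability

/-! ### Uniform bounds on action values -/

section Bounds

variable {S A : Type*} [Fintype S] [Fintype A] {M : MDP S A}

lemma exists_abs_qValue_le (hh : ∀ s, ContinuousOn (M.h s) (stdSimplex ℝ A)) :
    ∃ C : ℝ, 0 ≤ C ∧ ∀ π : S → A → ℝ, IsPolicy π → ∀ s a, |qValue M π s a| ≤ C := by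
  have hB (s : S) : ∃ B : ℝ, ∀ p ∈ stdSimplex ℝ A, |M.h s p| ≤ B := by
    obtain ⟨B, hB⟩ := (isCompact_stdSimplex ℝ A).exists_bound_of_continuousOn (hh s)
    exact ⟨B, fun p hp => hB p hp⟩
  choose B hB using hB
  have hC (π : S → A → ℝ) (hπ : IsPolicy π) (s : S) (a : A) :
      |M.c s a + M.h s (π s)| ≤ ∑ s, ∑ a, |M.c s a| + ∑ s, |B s| := by
    refine (abs_add_le _ _).trans (add_le_add ?_ ?_)
    · exact (Finset.single_le_sum (f := fun a => |M.c s a|)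
          (fun _ _ => abs_nonneg _) (Finset.mem_univ a)).trans
        (Finset.single_le_sum (f := fun s => ∑ a, |M.c s a|)
          (fun _ _ => Finset.sum_nonneg fun _ _ => abs_nonneg _) (Finset.mem_univ s))
    · exact ((hB s _ (hπ s)).trans (le_abs_self _)).trans
        (Finset.single_le_sum (f := fun s => |B s|) (fun _ _ => abs_nonneg _) (Finset.mem_univ s))
  refine ⟨(∑ s, ∑ a, |M.c s a| + ∑ s, |B s|) * (1 - M.γ)⁻¹, ?_, fun π hπ s a =>
    abs_qValue_le hπ (hC π hπ) s a⟩
  have : 0 < 1 - M.γ := sub_pos.2 M.γ_lt_one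
  positivity

lemma norm_qValue_le {C : ℝ} (hC0 : 0 ≤ C)
    (hC : ∀ π : S → A → ℝ, IsPolicy π → ∀ s a, |qValue M π s a| ≤ C) {π : S → A → ℝ}
    (hπ : IsPolicy π) (s : S) : ‖qValue M π s‖ ≤ C :=
  (pi_norm_le_iff_of_nonneg hC0).2 fun a => hC π hπ s a

end Bounds

/-! ### Deterministic properties of the gap functions -/

section Gap

variable {S A : Type*} [Fintype S] [Fintype A] {M : MDP S A} {N : Seminorm ℝ (A → ℝ)}
  {k : ℕ} {π q : ℕ → S → A → ℝ}

/-- The exact gap is the noisy gap fed with exact action values, as `V^π = ⟨Q^π, π⟩`. Measurability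
and bounds need to be proved only once. -/
lemma avgGap_eq_noisyAvgGap (hπ : ∀ t < k, IsPolicy (π t)) (s : S) :
    avgGap M k π s = noisyAvgGap M k π (fun t => qValue M (π t)) s := by
  unfold avgGap noisyAvgGap
  congr 3
  ext p
  congr 1
  refine Finset.sum_congr rfl fun t ht => ?_
  rw [value_eq_dot M (hπ t (Finset.mem_range.1 ht))]

lemma continuousOn_neg_sum_advantage (hh : ∀ s, ContinuousOn (M.h s) (stdSimplex ℝ A))
    (s : S) (v : ℕ → ℝ) : ContinuousOn (fun p => -∑ t ∈ Finset.range k,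
      advantage M (π t) (q t s) (v t) s p) (stdSimplex ℝ A) := by
  refine (continuousOn_finsetSum _ fun t _ => ?_).neg
  have h1 : Continuous fun p => dot (q t s) p :=
    continuous_dot.comp (by fun_prop : Continuous fun p => (q t s, p))
  exact ((h1.continuousOn.sub continuousOn_const).add (hh s)).sub continuousOn_const

lemma neg_sum_advantage_eq (s : S) (p : A → ℝ) :
    -∑ t ∈ Finset.range k, advantage M (π t) (q t s) (dot (q t s) (π t s)) s p =
      ∑ t ∈ Finset.range k, (dot (q t s) (π t s) + M.h s (π t s)) +
        (dot (-∑ t ∈ Finset.range k, q t s) p - k * M.h s p) := by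
  simp only [advantage, Finset.sum_sub_distrib, Finset.sum_add_distrib, dot_neg_left,
    dot_sum_left, Finset.sum_const, Finset.card_range, nsmul_eq_mul]
  ring

/-- Isolates the maximum as a conjugate evaluated at `-∑ Q̃_t`, the form in which its continuity is
known. -/
lemma noisyAvgGap_eq [Nonempty A] (hh : ∀ s, ContinuousOn (M.h s) (stdSimplex ℝ A)) (s : S) :
    noisyAvgGap M k π q s =
      (k : ℝ)⁻¹ * (∑ t ∈ Finset.range k, (dot (q t s) (π t s) + M.h s (π t s)) +
        sSup ((fun p => dot (-∑ t ∈ Finset.range k, q t s) p - k * M.h s p) ''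
          stdSimplex ℝ A)) := by
  rw [noisyAvgGap]
  congr 1
  rw [add_comm]
  have h1 : ContinuousOn (fun p => dot (-∑ t ∈ Finset.range k, q t s) p - k * M.h s p)
      (stdSimplex ℝ A) :=
    (continuous_dot.comp (by fun_prop : Continuous fun p =>
      (-∑ t ∈ Finset.range k, q t s, p))).continuousOn.sub (continuousOn_const.mul (hh s))
  refine le_antisymm (sSup_simplex_image_le_add h1 fun p _ => ?_) ?_
  · rw [neg_sum_advantage_eq, add_comm]
  · have h2 := sSup_simplex_image_le_add (c := -∑ t ∈ Finset.range k,
        (dot (q t s) (π t s) + M.h s (π t s)))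
      (continuousOn_neg_sum_advantage (k := k) (π := π) (q := q) hh s
        fun t => dot (q t s) (π t s))
      (f := fun p => dot (-∑ t ∈ Finset.range k, q t s) p - k * M.h s p)
      fun p _ => by rw [neg_sum_advantage_eq]; linarith
    linarith

lemma measurable_noisyAvgGap [Nonempty A] {Ω : Type*} [MeasurableSpace Ω]
    {π q : ℕ → Ω → S → A → ℝ} (hh : ∀ s, ContinuousOn (M.h s) (stdSimplex ℝ A))
    (hπ : ∀ t < k, ∀ x, IsPolicy (π t x)) (hmeas : ∀ t < k, ∀ s a, Measurable fun x => π t x s a)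
    (hq : ∀ t < k, ∀ s a, Measurable fun x => q t x s a) (s : S) :
    Measurable fun x => noisyAvgGap M k (fun t => π t x) (fun t => q t x) s := by
  have hπ' (t : ℕ) (ht : t < k) : Measurable fun x => π t x s :=
    measurable_pi_lambda _ fun a => hmeas t ht s a
  have hq' (t : ℕ) (ht : t < k) : Measurable fun x => q t x s :=
    measurable_pi_lambda _ fun a => hq t ht s a
  simp_rw [noisyAvgGap_eq hh]
  refine Measurable.const_mul (Measurable.add ?_ ?_) _
  · refine Finset.measurable_fun_sum _ fun t ht => ?_
    have ht := Finset.mem_range.1 ht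
    exact (measurable_dot (hq' t ht) (hπ' t ht)).add
      (measurable_comp_of_continuousOn_simplex (hh s) (hπ' t ht) fun x => hπ t ht x s)
  · refine (continuous_sSup_dot_sub (continuousOn_const.mul (hh s))).measurable.comp ?_
    exact (Finset.measurable_fun_sum _ fun t ht => hq' t (Finset.mem_range.1 ht)).neg

lemma abs_noisyAvgGap_le [Nonempty A] (hN : IsSimplexNorm N) {c : ℝ} (hc : 0 ≤ c)
    (h_lip : ∀ s, ∀ p ∈ stdSimplex ℝ A, ∀ p' ∈ stdSimplex ℝ A,
      M.h s p - M.h s p' ≤ c * N (p - p'))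
    (hπ : ∀ t < k, IsPolicy (π t)) (s : S) :
    |noisyAvgGap M k π q s| ≤
      (k : ℝ)⁻¹ * ∑ t ∈ Finset.range k, (dualNorm N (q t s) * 2 + c * 2) := by
  have key (p : A → ℝ) (hp : p ∈ stdSimplex ℝ A) :
      |-∑ t ∈ Finset.range k, advantage M (π t) (q t s) (dot (q t s) (π t s)) s p| ≤
        ∑ t ∈ Finset.range k, (dualNorm N (q t s) * 2 + c * 2) := by
    rw [abs_neg]
    refine (Finset.abs_sum_le_sum_abs _ _).trans (Finset.sum_le_sum fun t ht => ?_)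
    have hq := hπ t (Finset.mem_range.1 ht) s
    have h1 := (hN.abs_dot_le (q t s) (p - π t s)).trans
      (mul_le_mul_of_nonneg_left (hN.sub_le_two hp hq) (hN.dualNorm_nonneg _))
    have h2 := (h_lip s _ hp _ hq).trans (mul_le_mul_of_nonneg_left (hN.sub_le_two hp hq) hc)
    have h3 := (h_lip s _ hq _ hp).trans (mul_le_mul_of_nonneg_left (hN.sub_le_two hq hp) hc)
    rw [dot_sub_right] at h1
    rw [abs_le] at h1 ⊢
    unfold advantage
    constructor <;> linarith [h1.1, h1.2]
  have hcont := continuousOn_neg_sum_advantage (k := k) (π := π) (q := q)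
    (fun s => hN.continuousOn_of_lipschitz hc (h_lip s)) s fun t => dot (q t s) (π t s)
  obtain ⟨p, hp⟩ := nonempty_stdSimplex (A := A)
  rw [noisyAvgGap, abs_mul, abs_of_nonneg (by positivity : 0 ≤ (k : ℝ)⁻¹)]
  refine mul_le_mul_of_nonneg_left (abs_le.2 ⟨?_, ?_⟩) (by positivity)
  · exact (abs_le.1 (key p hp)).1.trans (le_csSup (bddAbove_simplex_image hcont) ⟨p, hp, rfl⟩)
  · exact sSup_simplex_image_le fun p hp => (abs_le.1 (key p hp)).2

/-- The regularizers cancel in the difference of the two objectives, which leaves a linear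
functional of the noise. -/
lemma noisyAvgGap_sub_le [Nonempty A] (hh : ∀ s, ContinuousOn (M.h s) (stdSimplex ℝ A))
    {q' : ℕ → S → A → ℝ} {s : S} {b : ℝ}
    (h : ∀ p ∈ stdSimplex ℝ A, ∑ t ∈ Finset.range k, dot (q' t s - q t s) (p - π t s) ≤ b) :
    noisyAvgGap M k π q s - noisyAvgGap M k π q' s ≤ (k : ℝ)⁻¹ * b := by
  rw [noisyAvgGap, noisyAvgGap, ← mul_sub]
  refine mul_le_mul_of_nonneg_left ?_ (by positivity)
  rw [sub_le_iff_le_add']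
  refine sSup_simplex_image_le_add (continuousOn_neg_sum_advantage hh s _) fun p hp => ?_
  have h1 := h p hp
  have h2 : ∑ t ∈ Finset.range k, dot (q' t s - q t s) (p - π t s) =
      ∑ t ∈ Finset.range k, advantage M (π t) (q' t s) (dot (q' t s) (π t s)) s p -
        ∑ t ∈ Finset.range k, advantage M (π t) (q t s) (dot (q t s) (π t s)) s p := by
    rw [← Finset.sum_sub_distrib]
    refine Finset.sum_congr rfl fun t _ => ?_
    simp only [advantage, dot_sub_left, dot_sub_right]
    ring
  linarith

lemma le_avgGap (hh : ∀ s, ContinuousOn (M.h s) (stdSimplex ℝ A)) (s : S) {p : A → ℝ}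
    (hp : p ∈ stdSimplex ℝ A) :
    (k : ℝ)⁻¹ * -∑ t ∈ Finset.range k,
      advantage M (π t) (qValue M (π t) s) (value M (π t) s) s p ≤ avgGap M k π s :=
  mul_le_mul_of_nonneg_left (le_csSup (bddAbove_simplex_image
    (continuousOn_neg_sum_advantage (q := fun t => qValue M (π t)) hh s _)) ⟨p, hp, rfl⟩)
    (by positivity)

/-- This reverse comparison removes the maximum over `p` before any randomness is estimated. -/
lemma avgGap_le_avgValue_sub [Nonempty S] [Nonempty A] {πs : S → A → ℝ} (h : IsOptimal M πs)
    (hk : 1 ≤ k) (hπ : ∀ t < k, IsPolicy (π t)) (s : S) :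
    avgGap M k π s ≤ avgValue M k π s - value M πs s := by
  have hk0 : (0 : ℝ) < k := by exact_mod_cast hk
  have e : avgValue M k π s - value M πs s =
      (k : ℝ)⁻¹ * ∑ t ∈ Finset.range k, (value M (π t) s - value M πs s) := by
    rw [Finset.sum_sub_distrib, mul_sub, Finset.sum_const, Finset.card_range, nsmul_eq_mul,
      inv_mul_cancel_left₀ hk0.ne', avgValue]
  rw [e, avgGap]
  refine mul_le_mul_of_nonneg_left (sSup_simplex_image_le fun p hp => ?_) (by positivity)
  rw [← Finset.sum_neg_distrib]
  exact Finset.sum_le_sum fun t ht =>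
    h.neg_advantage_le (hπ t (Finset.mem_range.1 ht)) s hp

lemma avgValue_sub_eq {πs : S → A → ℝ} (hs : IsPolicy πs) (hk : 1 ≤ k)
    (hπ : ∀ t < k, IsPolicy (π t)) (s : S) :
    avgValue M k π s - value M πs s =
      (k : ℝ)⁻¹ * -∑ t ∈ Finset.range k,
          advantage M (π t) (qValue M (π t) s) (value M (π t) s) s (πs s) +
        M.γ * ∑ s', transition M πs s s' * (avgValue M k π s' - value M πs s') := by
  have hk0 : (0 : ℝ) < k := by exact_mod_cast hk
  have e (s : S) : avgValue M k π s - value M πs s =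
      (k : ℝ)⁻¹ * ∑ t ∈ Finset.range k, (value M (π t) s - value M πs s) := by
    rw [Finset.sum_sub_distrib, mul_sub, Finset.sum_const, Finset.card_range, nsmul_eq_mul,
      inv_mul_cancel_left₀ hk0.ne', avgValue]
  simp_rw [e]
  have h1 : ∀ t ∈ Finset.range k, value M (π t) s - value M πs s =
      -advantage M (π t) (qValue M (π t) s) (value M (π t) s) s (πs s) +
        M.γ * ∑ s', transition M πs s s' * (value M (π t) s' - value M πs s') := by
    intro t ht
    have := value_sub_value M (hπ t (Finset.mem_range.1 ht)) hs s
    have h2 : ∑ s', transition M πs s s' * (value M (π t) s' - value M πs s') =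
        -∑ s', transition M πs s s' * (value M πs s' - value M (π t) s') := by
      rw [← Finset.sum_neg_distrib]
      exact Finset.sum_congr rfl fun _ _ => by ring
    rw [h2]
    linarith
  rw [Finset.sum_congr rfl h1, Finset.sum_add_distrib, mul_add, Finset.sum_neg_distrib]
  congr 1
  simp_rw [Finset.mul_sum]
  rw [Finset.sum_comm]
  refine Finset.sum_congr rfl fun _ _ => Finset.sum_congr rfl fun _ _ => ?_
  ring

end Gap

/-- A run of stochastic policy mirror descent with step size `α / √k`, adapted to a filtration. -/
structure IsStochasticRun {S A Ω : Type*} [Fintype S] [Fintype A] [mΩ : MeasurableSpace Ω]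
    (M : MDP S A) (N : Seminorm ℝ (A → ℝ)) (w : (A → ℝ) → ℝ) (Mh : ℝ) (k : ℕ) (α : ℝ)
    (ℱ : Filtration ℕ mΩ) (π0 : S → A → ℝ) (π Qt : ℕ → Ω → S → A → ℝ) (D0 : ℝ) : Prop where
  norm : IsSimplexNorm N
  dgf : IsDGF N w
  convex : ∀ s, ConvexOn ℝ (stdSimplex ℝ A) (M.h s)
  Mh_nonneg : 0 ≤ Mh
  lipschitz : ∀ s, ∀ p ∈ stdSimplex ℝ A, ∀ p' ∈ stdSimplex ℝ A,
    M.h s p - M.h s p' ≤ Mh * N (p - p')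
  one_le : 1 ≤ k
  α_pos : 0 < α
  measurable_policy : ∀ t ≤ k, ∀ s a, Measurable[ℱ t] fun x => π t x s a
  measurable_estimate : ∀ t < k, ∀ s a, Measurable[ℱ (t + 1)] fun x => Qt t x s a
  run : ∀ x, IsRun M w (α / √k) k π0 (fun t => π t x) (fun t => Qt t x)
  bregman_le : ∀ s, ∀ p ∈ stdSimplex ℝ A, bregman w (π0 s) p ≤ D0

/-- The noise `Q̃_t(s,·) - Q^{π_t}(s,·)` of the estimates. -/
noncomputable def noise {S A Ω : Type*} [Fintype S] (M : MDP S A) [Fintype A]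
    (π Qt : ℕ → Ω → S → A → ℝ) (t : ℕ) (x : Ω) (s : S) : A → ℝ :=
  Qt t x s - qValue M (π t x) s

/-- The auxiliary comparison sequence: the regularized leader for the past noise, with sign `e`. -/
noncomputable def noiseLeader {S A Ω : Type*} [Fintype S] [Fintype A] (M : MDP S A)
    (R : (A → ℝ) → ℝ) (η e : ℝ) (π Qt : ℕ → Ω → S → A → ℝ) (t : ℕ) (x : Ω) (s : S) : A → ℝ :=
  leader R (η • ∑ i ∈ Finset.range t, e • noise M π Qt i x s)

namespace IsStochasticRun

variable {S A Ω : Type*} [Fintype S] [Nonempty S] [Fintype A] [Nonempty A]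
  [mΩ : MeasurableSpace Ω] {μ : Measure Ω} [IsProbabilityMeasure μ]
  {M : MDP S A} {N : Seminorm ℝ (A → ℝ)} {w : (A → ℝ) → ℝ} {Mh : ℝ} {k : ℕ} {α : ℝ}
  {ℱ : Filtration ℕ mΩ} {π0 : S → A → ℝ} {π Qt : ℕ → Ω → S → A → ℝ} {D0 : ℝ}

/-! ### Stochastic runs: positivity and adaptedness -/

section Basic

omit [Nonempty S] [Nonempty A]

lemma k_pos (H : IsStochasticRun M N w Mh k α ℱ π0 π Qt D0) : (0 : ℝ) < k := by
  exact_mod_cast H.one_le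

lemma η_pos (H : IsStochasticRun M N w Mh k α ℱ π0 π Qt D0) : 0 < α / √k :=
  div_pos H.α_pos (Real.sqrt_pos.2 H.k_pos)

lemma isPolicy (H : IsStochasticRun M N w Mh k α ℱ π0 π Qt D0) {t : ℕ} (ht : t < k) (x : Ω) :
    IsPolicy (π t x) :=
  (H.run x).policy t ht.le

lemma continuousOn_h (H : IsStochasticRun M N w Mh k α ℱ π0 π Qt D0) (s : S) :
    ContinuousOn (M.h s) (stdSimplex ℝ A) :=
  H.norm.continuousOn_of_lipschitz H.Mh_nonneg (H.lipschitz s)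

lemma measurable_policy_apply (H : IsStochasticRun M N w Mh k α ℱ π0 π Qt D0) {t : ℕ} (ht : t < k)
    (s : S) : Measurable[ℱ t] fun x => π t x s :=
  @measurable_pi_lambda _ _ _ (ℱ t) _ _ fun a => H.measurable_policy t ht.le s a

lemma measurable_qValue_apply (H : IsStochasticRun M N w Mh k α ℱ π0 π Qt D0) {t : ℕ} (ht : t < k)
    (s : S) (a : A) : Measurable[ℱ t] fun x => qValue M (π t x) s a :=
  @measurable_qValue _ _ _ _ _ (ℱ t) _ _ H.continuousOn_h (H.isPolicy ht)
    (H.measurable_policy t ht.le) s a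

lemma measurable_noise (H : IsStochasticRun M N w Mh k α ℱ π0 π Qt D0) {t : ℕ} (ht : t < k)
    (s : S) : Measurable[ℱ (t + 1)] fun x => noise M π Qt t x s :=
  @measurable_pi_lambda _ _ _ (ℱ (t + 1)) _ _ fun a =>
    (H.measurable_estimate t ht s a).sub
      ((H.measurable_qValue_apply ht s a).mono (ℱ.mono t.le_succ) le_rfl)

end Basic

/-! ### Decoupling the comparator from the noise -/

section Leader

omit [Nonempty S]

omit [Nonempty A] in
lemma continuousOn_bregman (H : IsStochasticRun M N w Mh k α ℱ π0 π Qt D0) (s : S) :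
    ContinuousOn (bregman w (π0 s)) (stdSimplex ℝ A) :=
  (H.dgf.bregman _).continuousOn

lemma noiseLeader_mem (H : IsStochasticRun M N w Mh k α ℱ π0 π Qt D0) (e : ℝ) (t : ℕ) (x : Ω)
    (s : S) : noiseLeader M (bregman w (π0 s)) (α / √k) e π Qt t x s ∈ stdSimplex ℝ A :=
  leader_mem (H.continuousOn_bregman s) _

lemma measurable_noiseLeader (H : IsStochasticRun M N w Mh k α ℱ π0 π Qt D0) (e : ℝ) {t : ℕ}
    (ht : t < k) (s : S) :
    Measurable[ℱ t] fun x => noiseLeader M (bregman w (π0 s)) (α / √k) e π Qt t x s := by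
  refine ((H.dgf.bregman (π0 s)).continuous_leader H.norm).measurable.comp ?_
  have hsum : Measurable[ℱ t] fun x => ∑ i ∈ Finset.range t, e • noise M π Qt i x s := by
    refine Finset.measurable_fun_sum _ fun i hi => ?_
    have hi := Finset.mem_range.1 hi
    exact ((H.measurable_noise (hi.trans ht) s).mono (ℱ.mono hi) le_rfl).const_smul e
  exact hsum.const_smul (α / √k)

/-- The test directions in which the noise is accumulated. -/
lemma measurable_leader_sub (H : IsStochasticRun M N w Mh k α ℱ π0 π Qt D0) (e : ℝ) {t : ℕ}
    (ht : t < k) (s : S) : Measurable[ℱ t] fun x =>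
      e • (noiseLeader M (bregman w (π0 s)) (α / √k) e π Qt t x s - π t x s) :=
  ((H.measurable_noiseLeader e ht s).sub (H.measurable_policy_apply ht s)).const_smul e

lemma norm_leader_sub_le (H : IsStochasticRun M N w Mh k α ℱ π0 π Qt D0) {e : ℝ} (he : |e| = 1)
    {t : ℕ} (ht : t < k) (s : S) (x : Ω) :
    N (e • (noiseLeader M (bregman w (π0 s)) (α / √k) e π Qt t x s - π t x s)) ≤ 2 := by
  rw [map_smul_eq_mul, Real.norm_eq_abs, he, one_mul]
  exact H.norm.sub_le_two (H.noiseLeader_mem e t x s) (H.isPolicy ht x s)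

lemma sum_dot_noise_le (H : IsStochasticRun M N w Mh k α ℱ π0 π Qt D0) {e : ℝ} (he : |e| = 1)
    (x : Ω) (s : S) {p : A → ℝ} (hp : p ∈ stdSimplex ℝ A) :
    ∑ t ∈ Finset.range k, dot (e • noise M π Qt t x s) (p - π t x s) ≤
      D0 / (α / √k) + α / √k / 2 * ∑ t ∈ Finset.range k, dualNorm N (noise M π Qt t x s) ^ 2 +
        ∑ t ∈ Finset.range k, dot (noise M π Qt t x s)
          (e • (noiseLeader M (bregman w (π0 s)) (α / √k) e π Qt t x s - π t x s)) := by
  have hk0 : 0 < k := H.one_le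
  have hinit : π 0 x = π0 := (H.run x).init
  -- The point `π0` is the iterate at time `0 < k`, so `w` is differentiable there.
  have hpos : ∀ p ∈ stdSimplex ℝ A, 0 ≤ bregman w (π0 s) p := fun p hp => by
    have h := H.dgf.half_sq_le_bregman (H.isPolicy hk0 x s) hp
      ((H.run x).differentiable 0 hk0 s)
    rw [hinit] at h
    exact le_trans (by positivity) h
  have h := (H.dgf.bregman (π0 s)).leader_regret_le H.norm hpos H.η_pos
    (fun t => e • noise M π Qt t x s) k hp (H.bregman_le s p hp)
  have hd (z : A → ℝ) : dualNorm N (e • z) = dualNorm N z := by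
    rcases eq_or_eq_neg_of_abs_eq he with h | h
    · rw [h, one_smul]
    · rw [h, neg_smul, one_smul, dualNorm_neg]
  simp only [hd] at h
  have e1 : ∑ t ∈ Finset.range k, dot (e • noise M π Qt t x s) (p - π t x s) =
      ∑ t ∈ Finset.range k, dot (e • noise M π Qt t x s)
        (p - noiseLeader M (bregman w (π0 s)) (α / √k) e π Qt t x s) +
      ∑ t ∈ Finset.range k, dot (noise M π Qt t x s)
          (e • (noiseLeader M (bregman w (π0 s)) (α / √k) e π Qt t x s - π t x s)) := by
    rw [← Finset.sum_add_distrib]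
    refine Finset.sum_congr rfl fun t _ => ?_
    rw [dot_smul_left, dot_smul_left, dot_smul_right, dot_sub_right, dot_sub_right, dot_sub_right]
    ring
  rw [e1]
  exact add_le_add_left h _

/-- The two signs of the difference need two leader sequences, since the leader follows the signed
noise. The maximum keeps the common regret terms from being counted twice. -/
lemma abs_avgGap_sub_le (H : IsStochasticRun M N w Mh k α ℱ π0 π Qt D0) (x : Ω) (s : S) :
    |avgGap M k (fun t => π t x) s - noisyAvgGap M k (fun t => π t x) (fun t => Qt t x) s| ≤
      (k : ℝ)⁻¹ * (D0 / (α / √k) +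
        α / √k / 2 * ∑ t ∈ Finset.range k, dualNorm N (noise M π Qt t x s) ^ 2 +
        max |∑ t ∈ Finset.range k, dot (noise M π Qt t x s)
            ((1 : ℝ) • (noiseLeader M (bregman w (π0 s)) (α / √k) 1 π Qt t x s - π t x s))|
          |∑ t ∈ Finset.range k, dot (noise M π Qt t x s)
            ((-1 : ℝ) • (noiseLeader M (bregman w (π0 s)) (α / √k) (-1) π Qt t x s - π t x s))|) := by
  rw [avgGap_eq_noisyAvgGap (fun t ht => H.isPolicy ht x)]
  refine abs_le.2 ⟨?_, ?_⟩
  · rw [neg_le, neg_sub]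
    refine noisyAvgGap_sub_le H.continuousOn_h fun p hp => ?_
    have h := H.sum_dot_noise_le (e := -1) (by simp) x s hp
    simp only [neg_smul, one_smul, noise, neg_sub] at h
    refine h.trans (add_le_add_right ((le_abs_self _).trans ?_) _)
    simp only [neg_smul, one_smul, noise, neg_sub]
    exact le_max_right _ _
  · refine noisyAvgGap_sub_le H.continuousOn_h fun p hp => ?_
    have h := H.sum_dot_noise_le (e := 1) (by simp) x s hp
    simp only [one_smul, noise] at h
    refine h.trans (add_le_add_right ((le_abs_self _).trans ?_) _)
    simp only [one_smul, noise]
    exact le_max_left _ _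

end Leader

/-! ### Pathwise identities and the regret decomposition -/

section Deterministic

omit [Nonempty S] [Nonempty A] in
lemma avgValue_sub_noisyAvgValue (H : IsStochasticRun M N w Mh k α ℱ π0 π Qt D0) (x : Ω) (s : S) :
    avgValue M k (fun t => π t x) s - noisyAvgValue k (fun t => π t x) (fun t => Qt t x) s =
      -((k : ℝ)⁻¹ * ∑ t ∈ Finset.range k, dot (noise M π Qt t x s) (π t x s)) := by
  rw [avgValue, noisyAvgValue, ← mul_sub, ← mul_neg, ← Finset.sum_sub_distrib,
    ← Finset.sum_neg_distrib]
  congr 1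
  refine Finset.sum_congr rfl fun t ht => ?_
  rw [value_eq_dot M (H.isPolicy (Finset.mem_range.1 ht) x), noise, dot_sub_left]
  ring

omit [Nonempty S] [Nonempty A] in
lemma neg_sum_advantage_le (H : IsStochasticRun M N w Mh k α ℱ π0 π Qt D0) (x : Ω) (s : S)
    {p : A → ℝ} (hp : p ∈ stdSimplex ℝ A) :
    -∑ t ∈ Finset.range k,
        advantage M (π t x) (qValue M (π t x) s) (value M (π t x) s) s p ≤
      D0 / (α / √k) + α / √k * ∑ t ∈ Finset.range k, (dualNorm N (Qt t x s) ^ 2 + Mh ^ 2) +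
        ∑ t ∈ Finset.range k, dot (noise M π Qt t x s) (p - π t x s) := by
  have h := (H.run x).regret_le H.norm H.dgf (H.convex s) (H.lipschitz s) H.η_pos H.one_le hp
    (H.bregman_le s p hp)
  refine le_trans (le_of_eq ?_) (add_le_add_left h _)
  rw [← Finset.sum_add_distrib, ← Finset.sum_neg_distrib]
  refine Finset.sum_congr rfl fun t ht => ?_
  rw [advantage_eq M (H.isPolicy (Finset.mem_range.1 ht) x), noise]
  simp only [dot_sub_left, dot_sub_right]
  ring

end Deterministic

/-! ### Conditional bias of the noise in predictable directions -/

section Noise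

omit [Nonempty S] [Nonempty A]

omit [IsProbabilityMeasure μ] in
lemma integrable_of_measurable_of_dualNorm_le (H : IsStochasticRun M N w Mh k α ℱ π0 π Qt D0)
    {t : ℕ} (ht : t < k) (s : S) {Y : Ω → ℝ} (hY : Integrable Y μ)
    (h : ∀ x, dualNorm N (Qt t x s) ≤ Y x) (a : A) : Integrable (fun x => Qt t x s a) μ :=
  hY.mono' ((H.measurable_estimate t ht s a).mono (ℱ.le _) le_rfl).aestronglyMeasurable
    (Eventually.of_forall fun x => (H.norm.abs_apply_le _ a).trans (h x))

lemma integrable_qValue (H : IsStochasticRun M N w Mh k α ℱ π0 π Qt D0) {t : ℕ} (ht : t < k)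
    (s : S) (a : A) : Integrable (fun x => qValue M (π t x) s a) μ := by
  obtain ⟨C, _, hC⟩ := exists_abs_qValue_le H.continuousOn_h
  exact Integrable.of_bound
    ((H.measurable_qValue_apply ht s a).mono (ℱ.le _) le_rfl).aestronglyMeasurable C
    (Eventually.of_forall fun x => hC _ (H.isPolicy ht x) s a)

lemma measurable_dot_noise (H : IsStochasticRun M N w Mh k α ℱ π0 π Qt D0) {t : ℕ} (ht : t < k)
    (s : S) {y : Ω → A → ℝ} (hy : Measurable[ℱ t] y) :
    Measurable[ℱ (t + 1)] fun x => dot (noise M π Qt t x s) (y x) :=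
  @measurable_dot _ _ _ (ℱ (t + 1)) _ _ (H.measurable_noise ht s)
    (hy.mono (ℱ.mono t.le_succ) le_rfl)

omit [IsProbabilityMeasure μ] in
lemma abs_dot_noise_le (H : IsStochasticRun M N w Mh k α ℱ π0 π Qt D0) (t : ℕ)
    (s : S) {y : Ω → A → ℝ} {r : ℝ} (hr : ∀ x, N (y x) ≤ r) (x : Ω) :
    |dot (noise M π Qt t x s) (y x)| ≤ dualNorm N (noise M π Qt t x s) * r :=
  (H.norm.abs_dot_le _ _).trans
    (mul_le_mul_of_nonneg_left (hr x) (H.norm.dualNorm_nonneg _))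

/-- The conditional bias of the noise in a predictable direction. -/
lemma abs_condExp_dot_noise_le (H : IsStochasticRun M N w Mh k α ℱ π0 π Qt D0) {ς : ℝ}
    (hς : 0 ≤ ς) (hbias : BiasBound M N μ ℱ k π Qt ς) {t : ℕ} (ht : t < k) (s : S)
    (hint : ∀ a, Integrable (fun x => Qt t x s a) μ) {y : Ω → A → ℝ} (hy : Measurable[ℱ t] y)
    {r : ℝ} (hr : ∀ x, N (y x) ≤ r) :
    ∀ᵐ x ∂μ, |(μ[fun x => dot (noise M π Qt t x s) (y x) | ℱ t]) x| ≤ ς * r := by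
  obtain ⟨C, hC, hCN⟩ := H.norm.exists_norm_le
  have hya (a : A) : Measurable[ℱ t] fun x => y x a := (measurable_pi_apply a).comp hy
  have hbd (a : A) (x : Ω) : ‖y x a‖ ≤ C * r :=
    (norm_le_pi_norm (y x) a).trans ((hCN _).trans (mul_le_mul_of_nonneg_left (hr x) hC.le))
  have hna (a : A) : Integrable (fun x => noise M π Qt t x s a) μ :=
    (hint a).sub (H.integrable_qValue ht s a)
  have hprod (a : A) : Integrable ((fun x => noise M π Qt t x s a) * fun x => y x a) μ :=
    (hna a).mul_bdd (c := C * r) ((hya a).mono (ℱ.le _) le_rfl).aestronglyMeasurable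
      (Eventually.of_forall (hbd a))
  have h1 : (fun x => dot (noise M π Qt t x s) (y x)) =
      ∑ a, (fun x => noise M π Qt t x s a) * fun x => y x a := by
    ext x; simp [dot]
  -- The direction is known at time `t` and leaves the conditional expectation coordinatewise; its
  -- boundedness supplies the integrability.
  have h2 (a : A) : μ[(fun x => noise M π Qt t x s a) * fun x => y x a | ℱ t] =ᵐ[μ]
      μ[fun x => noise M π Qt t x s a | ℱ t] * fun x => y x a :=
    condExp_mul_of_stronglyMeasurable_right (hya a).stronglyMeasurable (hprod a) (hna a)
  have h3 (a : A) : μ[fun x => noise M π Qt t x s a | ℱ t] =ᵐ[μ]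
      μ[fun x => Qt t x s a | ℱ t] - fun x => qValue M (π t x) s a := by
    have h4 := condExp_sub (hint a) (H.integrable_qValue (μ := μ) ht s a) (ℱ t)
    rw [condExp_of_stronglyMeasurable (ℱ.le t)
      (H.measurable_qValue_apply ht s a).stronglyMeasurable (H.integrable_qValue ht s a)] at h4
    exact h4
  rw [h1]
  filter_upwards [condExp_finsetSum (fun a _ => hprod a) (ℱ t) (s := Finset.univ),
    ae_all_iff.2 h2, ae_all_iff.2 h3, hbias t ht s] with x hx1 hx2 hx3 hx4
  have h5 : (μ[∑ a, (fun x => noise M π Qt t x s a) * fun x => y x a | ℱ t]) x =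
      dot (fun a => (μ[fun y => Qt t y s a | ℱ t]) x - qValue M (π t x) s a) (y x) := by
    rw [hx1, Finset.sum_apply]
    refine Finset.sum_congr rfl fun a _ => ?_
    rw [hx2, Pi.mul_apply, hx3, Pi.sub_apply]
  rw [h5]
  refine (H.norm.abs_dot_le _ _).trans ?_
  exact mul_le_mul hx4 (hr x) (apply_nonneg _ _) hς

end Noise

end IsStochasticRun

namespace IsStochasticRun

variable {S A Ω : Type*} [Fintype S] [Nonempty S] [Fintype A] [Nonempty A]
  [mΩ : MeasurableSpace Ω] {μ : Measure Ω} [IsProbabilityMeasure μ]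
  {M : MDP S A} {N : Seminorm ℝ (A → ℝ)} {w : (A → ℝ) → ℝ} {Mh : ℝ} {k : ℕ} {α : ℝ}
  {ℱ : Filtration ℕ mΩ} {π0 : S → A → ℝ} {π Qt : ℕ → Ω → S → A → ℝ} {D0 : ℝ}
  {ς σ Qbar : ℝ}

/-! ### Integrability of the averaged quantities -/

section Integrability

omit [Nonempty S]

omit [Nonempty A] in
lemma integrable_dualNorm_of_sq (H : IsStochasticRun M N w Mh k α ℱ π0 π Qt D0) {t : ℕ}
    (ht : t < k) (s : S) (h : Integrable (fun x => dualNorm N (Qt t x s) ^ 2) μ) :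
    Integrable (fun x => dualNorm N (Qt t x s)) μ := by
  have hm : Measurable fun x => dualNorm N (Qt t x s) :=
    H.norm.continuous_dualNorm.measurable.comp (measurable_pi_lambda _ fun a =>
      (H.measurable_estimate t ht s a).mono (ℱ.le _) le_rfl)
  exact ((memLp_two_iff_integrable_sq hm.aestronglyMeasurable).2 h).integrable (by norm_num)

omit [Nonempty A] in
lemma integrable_value (H : IsStochasticRun M N w Mh k α ℱ π0 π Qt D0) {t : ℕ} (ht : t < k)
    (s : S) : Integrable (fun x => value M (π t x) s) μ := by
  obtain ⟨C, hC0, hC⟩ := exists_abs_qValue_le H.continuousOn_h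
  refine Integrable.of_bound (measurable_value H.continuousOn_h (H.isPolicy ht) (fun s a =>
    (H.measurable_policy t ht.le s a).mono (ℱ.le _) le_rfl) s).aestronglyMeasurable C
    (Eventually.of_forall fun x => ?_)
  rw [value_eq_dot M (H.isPolicy ht x), Real.norm_eq_abs]
  exact (abs_dot_le_norm _ (H.isPolicy ht x s)).trans
    (norm_qValue_le hC0 hC (H.isPolicy ht x) s)

omit [Nonempty A] in
lemma integrable_avgValue (H : IsStochasticRun M N w Mh k α ℱ π0 π Qt D0) (s : S) :
    Integrable (fun x => avgValue M k (fun t => π t x) s) μ :=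
  (integrable_finsetSum _ fun _ ht => H.integrable_value (Finset.mem_range.1 ht) s).const_mul _

omit [IsProbabilityMeasure μ] [Nonempty A] in
lemma integrable_noisyAvgValue (H : IsStochasticRun M N w Mh k α ℱ π0 π Qt D0)
    (hint : ∀ t < k, ∀ s a, Integrable (fun x => Qt t x s a) μ) (s : S) :
    Integrable (fun x => noisyAvgValue k (fun t => π t x) (fun t => Qt t x) s) μ := by
  refine (integrable_finsetSum _ fun t ht => integrable_finsetSum _ fun a _ => ?_).const_mul _
  have ht := Finset.mem_range.1 ht
  refine (hint t ht s a).mul_bdd (c := 1)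
    ((H.measurable_policy t ht.le s a).mono (ℱ.le _) le_rfl).aestronglyMeasurable
    (Eventually.of_forall fun x => ?_)
  rw [Real.norm_of_nonneg ((H.isPolicy ht x s).1 a)]
  exact (Finset.single_le_sum (fun b _ => (H.isPolicy ht x s).1 b) (Finset.mem_univ a)).trans_eq
    (H.isPolicy ht x s).2

lemma integrable_noisyAvgGap_of_dualNorm (H : IsStochasticRun M N w Mh k α ℱ π0 π Qt D0)
    {q : ℕ → Ω → S → A → ℝ} (s : S) (hq : ∀ t < k, ∀ s a, Measurable fun x => q t x s a)
    {Y : ℕ → Ω → ℝ} (hY : ∀ t < k, Integrable (Y t) μ)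
    (hqY : ∀ t < k, ∀ x, dualNorm N (q t x s) ≤ Y t x) :
    Integrable (fun x => noisyAvgGap M k (fun t => π t x) (fun t => q t x) s) μ := by
  have hbound : Integrable (fun x => (k : ℝ)⁻¹ * ∑ t ∈ Finset.range k, (Y t x * 2 + Mh * 2)) μ :=
    (integrable_finsetSum _ fun t ht =>
      ((hY t (Finset.mem_range.1 ht)).mul_const 2).add (integrable_const _)).const_mul _
  refine hbound.mono' (measurable_noisyAvgGap H.continuousOn_h (fun t ht => H.isPolicy ht)
    (fun t ht s a => (H.measurable_policy t ht.le s a).mono (ℱ.le _) le_rfl)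
    hq s).aestronglyMeasurable (Eventually.of_forall fun x => ?_)
  refine (abs_noisyAvgGap_le H.norm H.Mh_nonneg H.lipschitz (fun t ht => H.isPolicy ht x) s).trans ?_
  gcongr with t ht
  exact hqY t (Finset.mem_range.1 ht) x

lemma integrable_avgGap (H : IsStochasticRun M N w Mh k α ℱ π0 π Qt D0) (s : S) :
    Integrable (fun x => avgGap M k (fun t => π t x) s) μ := by
  obtain ⟨C, hC0, hC⟩ := exists_abs_qValue_le H.continuousOn_h
  obtain ⟨C', hC0', hC'⟩ := H.norm.exists_dualNorm_le
  simp_rw [fun x => avgGap_eq_noisyAvgGap (M := M) (fun t ht => H.isPolicy ht x) s]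
  refine H.integrable_noisyAvgGap_of_dualNorm (q := fun t x => qValue M (π t x))
    (Y := fun _ _ => C' * C) s (fun t ht s a =>
      (H.measurable_qValue_apply ht s a).mono (ℱ.le _) le_rfl) (fun _ _ => integrable_const _)
    fun t ht x => (hC' _).trans ?_
  exact mul_le_mul_of_nonneg_left (norm_qValue_le hC0 hC (H.isPolicy ht x) s) hC0'

end Integrability

/-! ### Auxiliary estimates -/

section Auxiliary

/-- Cauchy-Schwarz with `√(3² + 2²) ≤ 4`. -/
lemma three_mul_add_le_sqrt (a b : ℝ) : 3 * a + 2 * b ≤ 4 * √(a ^ 2 + b ^ 2) := by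
  have : (3 * a + 2 * b) / 4 ≤ √(a ^ 2 + b ^ 2) := by
    refine Real.le_sqrt_of_sq_le ?_
    nlinarith [sq_nonneg (2 * a - 3 * b), sq_nonneg a, sq_nonneg b]
  linarith

lemma integral_affine_add {f g : Ω → ℝ} (hf : Integrable f μ) (hg : Integrable g μ)
    (a b c : ℝ) :
    ∫ x, (a + b * f x + (g x + c)) ∂μ = a + b * ∫ x, f x ∂μ + (∫ x, g x ∂μ + c) := by
  have h1 : Integrable (fun x => a + b * f x) μ := (integrable_const a).add (hf.const_mul b)
  have h2 : Integrable (fun x => g x + c) μ := hg.add (integrable_const c)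
  rw [integral_add h1 h2, integral_add (integrable_const a) (hf.const_mul b),
    integral_add hg (integrable_const c), integral_const_mul]
  simp

end Auxiliary

/-! ### Noise bounds in expectation -/

section ExpectationBounds

omit [Nonempty S]

omit [Nonempty A] in
lemma integrable_estimate (H : IsStochasticRun M N w Mh k α ℱ π0 π Qt D0)
    (hL : NoiseL2 M N μ ℱ k π Qt ς σ Qbar) {t : ℕ} (ht : t < k) (s : S) (a : A) :
    Integrable (fun x => Qt t x s a) μ :=
  H.integrable_of_measurable_of_dualNorm_le ht s
    (H.integrable_dualNorm_of_sq ht s (hL.second_moment t ht s).1) (fun _ => le_rfl) a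

omit [Nonempty A] in
/-- The accumulated noise in a predictable direction is, up to the bias, dominated by a martingale
with controlled second moment. -/
lemma exists_martingale_bound (H : IsStochasticRun M N w Mh k α ℱ π0 π Qt D0)
    (hL : NoiseL2 M N μ ℱ k π Qt ς σ Qbar) (s : S) {y : ℕ → Ω → A → ℝ}
    (hy : ∀ t < k, Measurable[ℱ t] (y t)) {r : ℝ} (hr : ∀ t < k, ∀ x, N (y t x) ≤ r) :
    ∃ Z : Ω → ℝ, MemLp Z 2 μ ∧ ∫ x, Z x ^ 2 ∂μ ≤ k * (σ ^ 2 * r ^ 2) ∧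
      ∀ᵐ x ∂μ, |∑ t ∈ Finset.range k, dot (noise M π Qt t x s) (y t x)| ≤ |Z x| + k * (ς * r) := by
  set X : ℕ → Ω → ℝ := fun t x => dot (noise M π Qt t x s) (y t x) with hX
  have hmeas (t : ℕ) (ht : t < k) : Measurable[ℱ (t + 1)] (X t) :=
    H.measurable_dot_noise ht s (hy t ht)
  have hsq (t : ℕ) (ht : t < k) (x : Ω) :
      X t x ^ 2 ≤ dualNorm N (noise M π Qt t x s) ^ 2 * r ^ 2 := by
    rw [← sq_abs, ← mul_pow]
    exact pow_le_pow_left₀ (abs_nonneg _) (H.abs_dot_noise_le t s (hr t ht) x) 2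
  have hint (t : ℕ) (ht : t < k) :
      Integrable (fun x => dualNorm N (noise M π Qt t x s) ^ 2 * r ^ 2) μ :=
    (hL.variance t ht s).1.mul_const _
  have hm (t : ℕ) (ht : t < k) : AEStronglyMeasurable (X t) μ :=
    ((hmeas t ht).mono (ℱ.le _) le_rfl).aestronglyMeasurable
  have hLp (t : ℕ) (ht : t < k) : MemLp (X t) 2 μ := by
    refine (memLp_two_iff_integrable_sq (hm t ht)).2 ((hint t ht).mono' ((hm t ht).pow 2)
      (Eventually.of_forall fun x => ?_))
    rw [Real.norm_of_nonneg (sq_nonneg _)]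
    exact hsq t ht x
  have hv (t : ℕ) (ht : t < k) : ∫ x, X t x ^ 2 ∂μ ≤ σ ^ 2 * r ^ 2 := by
    calc ∫ x, X t x ^ 2 ∂μ ≤ ∫ x, dualNorm N (noise M π Qt t x s) ^ 2 * r ^ 2 ∂μ :=
          integral_mono (hLp t ht).integrable_sq (hint t ht) (hsq t ht)
      _ = (∫ x, dualNorm N (noise M π Qt t x s) ^ 2 ∂μ) * r ^ 2 := integral_mul_const _ _
      _ ≤ σ ^ 2 * r ^ 2 := mul_le_mul_of_nonneg_right
          ((hL.variance t ht s).integral_le (ℱ.le t)) (sq_nonneg r)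
  obtain ⟨h1, h2⟩ := integral_sum_sub_condExp_sq_le hmeas hLp hv
  refine ⟨_, h1, h2, ?_⟩
  have hb : ∀ᵐ x ∂μ, ∀ t : Fin k, |(μ[X t | ℱ t]) x| ≤ ς * r :=
    ae_all_iff.2 fun t => H.abs_condExp_dot_noise_le hL.ς_nonneg hL.bias t.2 s
      (H.integrable_estimate hL t.2 s) (hy t t.2) (hr t t.2)
  filter_upwards [hb] with x hx
  have h3 : ∑ t ∈ Finset.range k, X t x = ∑ t ∈ Finset.range k, (X t x - (μ[X t | ℱ t]) x) +
      ∑ t ∈ Finset.range k, (μ[X t | ℱ t]) x := by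
    rw [← Finset.sum_add_distrib]
    exact Finset.sum_congr rfl fun _ _ => by ring
  have h4 : |∑ t ∈ Finset.range k, (μ[X t | ℱ t]) x| ≤ k * (ς * r) := by
    refine (Finset.abs_sum_le_sum_abs _ _).trans ((Finset.sum_le_card_nsmul _ _ (ς * r)
      fun t ht => hx ⟨t, Finset.mem_range.1 ht⟩).trans_eq ?_)
    rw [Finset.card_range, nsmul_eq_mul]
  change |∑ t ∈ Finset.range k, X t x| ≤ _
  rw [h3]
  exact (abs_add_le _ _).trans (add_le_add_right h4 _)

-- In expectation, without absolute values, only the bias survives; this is why `σ` is absent from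
-- the rate for the optimality gap.
omit [Nonempty A] in
lemma integral_sum_dot_noise_le (H : IsStochasticRun M N w Mh k α ℱ π0 π Qt D0)
    (hL : NoiseL2 M N μ ℱ k π Qt ς σ Qbar) (s : S) {y : ℕ → Ω → A → ℝ}
    (hy : ∀ t < k, Measurable[ℱ t] (y t)) {r : ℝ} (hr : ∀ t < k, ∀ x, N (y t x) ≤ r) :
    Integrable (fun x => ∑ t ∈ Finset.range k, dot (noise M π Qt t x s) (y t x)) μ ∧
    ∫ x, ∑ t ∈ Finset.range k, dot (noise M π Qt t x s) (y t x) ∂μ ≤ k * (ς * r) := by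
  have hint (t : ℕ) (ht : t < k) : Integrable (fun x => dot (noise M π Qt t x s) (y t x)) μ := by
    have hm : AEStronglyMeasurable (fun x => dot (noise M π Qt t x s) (y t x)) μ :=
      ((H.measurable_dot_noise ht s (hy t ht)).mono (ℱ.le _) le_rfl).aestronglyMeasurable
    refine (((integrable_const (1 : ℝ)).add (hL.variance t ht s).1).mul_const r).mono' hm
      (Eventually.of_forall fun x => (H.abs_dot_noise_le t s (hr t ht) x).trans ?_)
    have hr0 : 0 ≤ r := (apply_nonneg N _).trans (hr t ht x)
    refine mul_le_mul_of_nonneg_right ?_ hr0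
    change dualNorm N (noise M π Qt t x s) ≤ 1 + dualNorm N (noise M π Qt t x s) ^ 2
    nlinarith [sq_nonneg (dualNorm N (noise M π Qt t x s) - 1)]
  refine ⟨integrable_finsetSum _ fun t ht => hint t (Finset.mem_range.1 ht), ?_⟩
  rw [integral_finsetSum _ fun t ht => hint t (Finset.mem_range.1 ht)]
  refine (Finset.sum_le_card_nsmul _ _ (ς * r) fun t ht => ?_).trans_eq
    (by rw [Finset.card_range, nsmul_eq_mul])
  have ht := Finset.mem_range.1 ht
  rw [← integral_condExp (ℱ.le t)]
  calc ∫ x, (μ[fun x => dot (noise M π Qt t x s) (y t x) | ℱ t]) x ∂μ ≤ ∫ _x, ς * r ∂μ := by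
        refine integral_mono_ae integrable_condExp (integrable_const _) ?_
        filter_upwards [H.abs_condExp_dot_noise_le hL.ς_nonneg hL.bias ht s
          (H.integrable_estimate hL ht s) (hy t ht) (hr t ht)] with x hx
        exact (le_abs_self _).trans hx
    _ = ς * r := by simp

omit [Nonempty A] in
lemma integral_abs_avgValue_sub_le (H : IsStochasticRun M N w Mh k α ℱ π0 π Qt D0)
    (hL : NoiseL2 M N μ ℱ k π Qt ς σ Qbar) (s : S) :
    ∫ x, |avgValue M k (fun t => π t x) s -
      noisyAvgValue k (fun t => π t x) (fun t => Qt t x) s| ∂μ ≤ σ / √k + ς := by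
  obtain ⟨Z, hZ, hZ2, hZb⟩ := H.exists_martingale_bound hL s (y := fun t x => π t x s) (r := 1)
    (fun t ht => H.measurable_policy_apply ht s)
    fun t ht x => H.norm.le_one _ (H.isPolicy ht x s)
  have hint := (H.integrable_avgValue (μ := μ) s).sub
    (H.integrable_noisyAvgValue (fun t ht s a => H.integrable_estimate hL ht s a) s)
  have hZa : ∫ x, |Z x| ∂μ ≤ √(k * (σ ^ 2 * 1 ^ 2)) :=
    integral_le_sqrt_of_sq_le (f := fun x => |Z x|) hZ.abs (by simpa only [sq_abs] using hZ2)
  have hk := H.k_pos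
  have hsqrt : √(k * (σ ^ 2 * 1 ^ 2)) = √k * σ := by
    rw [one_pow, mul_one, Real.sqrt_mul hk.le, Real.sqrt_sq hL.σ_nonneg]
  rw [hsqrt] at hZa
  calc ∫ x, |avgValue M k (fun t => π t x) s -
        noisyAvgValue k (fun t => π t x) (fun t => Qt t x) s| ∂μ
      ≤ ∫ x, (k : ℝ)⁻¹ * (|Z x| + k * (ς * 1)) ∂μ := by
        refine integral_mono_ae hint.abs (((hZ.integrable (by norm_num)).abs.add
          (integrable_const _)).const_mul _) ?_
        filter_upwards [hZb] with x hx
        rw [H.avgValue_sub_noisyAvgValue, abs_neg, abs_mul, abs_of_nonneg (by positivity)]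
        exact mul_le_mul_of_nonneg_left hx (by positivity)
    _ = (k : ℝ)⁻¹ * (∫ x, |Z x| ∂μ + k * (ς * 1)) := by
        rw [integral_const_mul, integral_add (hZ.integrable (by norm_num)).abs
          (integrable_const _)]
        simp
    _ ≤ (k : ℝ)⁻¹ * (√k * σ + k * (ς * 1)) := by gcongr
    _ = σ / √k + ς := by
        have h1 : 0 < √(k : ℝ) := Real.sqrt_pos.2 hk
        have h2 : (k : ℝ) = √k * √k := (Real.mul_self_sqrt hk.le).symm
        field_simp
        rw [h2]
        simp only [Real.sqrt_mul_self h1.le]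
        ring

lemma integrable_noisyAvgGap (H : IsStochasticRun M N w Mh k α ℱ π0 π Qt D0)
    (hL : NoiseL2 M N μ ℱ k π Qt ς σ Qbar) (s : S) :
    Integrable (fun x => noisyAvgGap M k (fun t => π t x) (fun t => Qt t x) s) μ :=
  H.integrable_noisyAvgGap_of_dualNorm s
    (fun t ht s a => (H.measurable_estimate t ht s a).mono (ℱ.le _) le_rfl)
    (fun t ht => H.integrable_dualNorm_of_sq ht s (hL.second_moment t ht s).1)
    fun _ _ _ => le_rfl

lemma integral_abs_avgGap_sub_le (H : IsStochasticRun M N w Mh k α ℱ π0 π Qt D0)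
    (hL : NoiseL2 M N μ ℱ k π Qt ς σ Qbar) (s : S) :
    ∫ x, |avgGap M k (fun t => π t x) s -
      noisyAvgGap M k (fun t => π t x) (fun t => Qt t x) s| ∂μ ≤
        (α⁻¹ * D0 + α * σ ^ 2 + 4 * √(σ ^ 2 + k * ς ^ 2)) / √k := by
  obtain ⟨Z, hZ, hZ2, hZb⟩ := H.exists_martingale_bound hL s (r := 2)
    (fun t ht => H.measurable_leader_sub 1 ht s)
    (fun t ht => H.norm_leader_sub_le (e := 1) (by simp) ht s)
  obtain ⟨Z', hZ', hZ2', hZb'⟩ := H.exists_martingale_bound hL s (r := 2)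
    (fun t ht => H.measurable_leader_sub (-1) ht s)
    (fun t ht => H.norm_leader_sub_le (e := -1) (by simp) ht s)
  have hk := H.k_pos
  have hη := H.η_pos
  set η := α / √k with hηdef
  have hint := (H.integrable_avgGap (μ := μ) s).sub (H.integrable_noisyAvgGap hL s)
  have hmax : MemLp (fun x => max |Z x| |Z' x|) 2 μ := hZ.abs.sup hZ'.abs
  -- The squared maximum is at most the sum of two squares, each contributing `σ² * 2²` per step.
  -- Later `√8` is rounded up to `3`.
  have hmaxi : ∫ x, max |Z x| |Z' x| ∂μ ≤ √(k * (8 * σ ^ 2)) := by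
    refine integral_le_sqrt_of_sq_le hmax ?_
    calc ∫ x, max |Z x| |Z' x| ^ 2 ∂μ ≤ ∫ x, (Z x ^ 2 + Z' x ^ 2) ∂μ := by
          refine integral_mono hmax.integrable_sq (hZ.integrable_sq.add hZ'.integrable_sq)
            fun x => ?_
          rcases max_cases |Z x| |Z' x| with ⟨h, _⟩ | ⟨h, _⟩ <;> simp only [h, sq_abs] <;>
            nlinarith [sq_nonneg (Z x), sq_nonneg (Z' x)]
      _ = ∫ x, Z x ^ 2 ∂μ + ∫ x, Z' x ^ 2 ∂μ := integral_add hZ.integrable_sq hZ'.integrable_sq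
      _ ≤ k * (8 * σ ^ 2) := by linarith
  have hvar (t : ℕ) (ht : t ∈ Finset.range k) :
      Integrable (fun x => dualNorm N (noise M π Qt t x s) ^ 2) μ :=
    (hL.variance t (Finset.mem_range.1 ht) s).1
  have hdi : Integrable (fun x => ∑ t ∈ Finset.range k, dualNorm N (noise M π Qt t x s) ^ 2) μ :=
    integrable_finsetSum _ hvar
  have hd : ∫ x, ∑ t ∈ Finset.range k, dualNorm N (noise M π Qt t x s) ^ 2 ∂μ ≤ k * σ ^ 2 := by
    rw [integral_finsetSum _ hvar]
    refine (Finset.sum_le_card_nsmul _ _ (σ ^ 2) fun t ht => ?_).trans_eq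
      (by rw [Finset.card_range, nsmul_eq_mul])
    exact (hL.variance t (Finset.mem_range.1 ht) s).integral_le (ℱ.le t)
  calc ∫ x, |avgGap M k (fun t => π t x) s -
        noisyAvgGap M k (fun t => π t x) (fun t => Qt t x) s| ∂μ
      ≤ ∫ x, (k : ℝ)⁻¹ * (D0 / η +
          η / 2 * ∑ t ∈ Finset.range k, dualNorm N (noise M π Qt t x s) ^ 2 +
            (max |Z x| |Z' x| + k * (ς * 2))) ∂μ := by
        refine integral_mono_ae hint.abs ((((integrable_const _).add (hdi.const_mul _)).add
          ((hmax.integrable (by norm_num)).add (integrable_const _))).const_mul _) ?_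
        filter_upwards [hZb, hZb'] with x hx hx'
        refine (H.abs_avgGap_sub_le x s).trans ?_
        gcongr
        exact max_le (hx.trans (add_le_add_left (le_max_left _ _) _))
          (hx'.trans (add_le_add_left (le_max_right _ _) _))
    _ = (k : ℝ)⁻¹ * (D0 / η +
          η / 2 * ∫ x, ∑ t ∈ Finset.range k, dualNorm N (noise M π Qt t x s) ^ 2 ∂μ +
            (∫ x, max |Z x| |Z' x| ∂μ + k * (ς * 2))) := by
        rw [integral_const_mul, integral_affine_add hdi (hmax.integrable (by norm_num))]
    _ ≤ (k : ℝ)⁻¹ * (D0 / η + η / 2 * (k * σ ^ 2) + (√(k * (8 * σ ^ 2)) + k * (ς * 2))) := by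
        gcongr
    _ ≤ (α⁻¹ * D0 + α * σ ^ 2 + 4 * √(σ ^ 2 + k * ς ^ 2)) / √k := by
        have h1 : 0 < √(k : ℝ) := Real.sqrt_pos.2 hk
        have h2 : √(k : ℝ) ^ 2 = k := Real.sq_sqrt hk.le
        have h3 : √((k : ℝ) * (8 * σ ^ 2)) ≤ √k * (3 * σ) := by
          rw [Real.sqrt_mul hk.le]
          refine mul_le_mul_of_nonneg_left ?_ h1.le
          refine Real.sqrt_le_iff.2 ⟨mul_nonneg (by norm_num) hL.σ_nonneg, ?_⟩
          nlinarith [sq_nonneg σ]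
        have h4 : 3 * σ + √k * (ς * 2) ≤ 4 * √(σ ^ 2 + k * ς ^ 2) := by
          have := three_mul_add_le_sqrt σ (√k * ς)
          rw [mul_pow, h2] at this
          linarith
        have hα := H.α_pos
        have h5 : 0 ≤ α * σ ^ 2 := by positivity
        rw [le_div_iff₀ h1, inv_mul_eq_div, div_mul_eq_mul_div, div_le_iff₀ hk]
        have e1 : D0 / η = √k * (α⁻¹ * D0) := by rw [hηdef]; field_simp
        have e2 : η / 2 * (k * σ ^ 2) = √k * (α * σ ^ 2 / 2) := by
          rw [hηdef, ← h2]
          simp only [Real.sqrt_sq h1.le]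
          field_simp
        have e3 : (k : ℝ) * (ς * 2) = √k * (√k * (ς * 2)) := by
          rw [← mul_assoc √(k : ℝ), ← sq, h2]
        rw [e1, e2, e3]
        calc (√k * (α⁻¹ * D0) + √k * (α * σ ^ 2 / 2) +
              (√(k * (8 * σ ^ 2)) + √k * (√k * (ς * 2)))) * √k
            ≤ (√k * (α⁻¹ * D0) + √k * (α * σ ^ 2) +
              (√k * (3 * σ) + √k * (√k * (ς * 2)))) * √k := by
              gcongr
              linarith
          _ = (α⁻¹ * D0 + α * σ ^ 2 + (3 * σ + √k * (ς * 2))) * √k ^ 2 := by ring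
          _ ≤ _ := by rw [h2]; gcongr

end ExpectationBounds

end IsStochasticRun

namespace IsStochasticRun

variable {S A Ω : Type*} [Fintype S] [Nonempty S] [Fintype A] [Nonempty A]
  [mΩ : MeasurableSpace Ω] {μ : Measure Ω} [IsProbabilityMeasure μ]
  {M : MDP S A} {N : Seminorm ℝ (A → ℝ)} {w : (A → ℝ) → ℝ} {Mh : ℝ} {k : ℕ} {α : ℝ}
  {ℱ : Filtration ℕ mΩ} {π0 : S → A → ℝ} {π Qt : ℕ → Ω → S → A → ℝ} {D0 : ℝ}
  {ς σ Qbar : ℝ} {πstar : S → A → ℝ}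

/-! ### The optimality gap in expectation and pathwise -/

section OptimalityGap

-- The recursion is integrated before the maximum principle is applied, so the maximum over states
-- stays outside the expectation. Integrability in `hb` is a gift to the caller: it follows from the
-- recursion itself.
omit [Nonempty A] in
lemma integral_avgValue_sub_le (H : IsStochasticRun M N w Mh k α ℱ π0 π Qt D0)
    (hopt : IsOptimal M πstar) {b : ℝ}
    (hb : ∀ s, Integrable (fun x => (k : ℝ)⁻¹ * -∑ t ∈ Finset.range k,
        advantage M (π t x) (qValue M (π t x) s) (value M (π t x) s) s (πstar s)) μ →
      ∫ x, (k : ℝ)⁻¹ * -∑ t ∈ Finset.range k,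
        advantage M (π t x) (qValue M (π t x) s) (value M (π t x) s) s (πstar s) ∂μ ≤ b) (s : S) :
    ∫ x, (avgValue M k (fun t => π t x) s - value M πstar s) ∂μ ≤ (1 - M.γ)⁻¹ * b := by
  have hgap (s : S) : Integrable (fun x => avgValue M k (fun t => π t x) s - value M πstar s) μ :=
    (H.integrable_avgValue s).sub (integrable_const _)
  have hsum (s : S) : Integrable (fun x => M.γ * ∑ s', transition M πstar s s' *
      (avgValue M k (fun t => π t x) s' - value M πstar s')) μ :=
    (integrable_finsetSum _ fun s' _ => (hgap s').const_mul _).const_mul _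
  have heq (x : Ω) (s : S) :=
    avgValue_sub_eq (M := M) hopt.1 H.one_le (π := fun t => π t x) (fun _ ht => H.isPolicy ht x) s
  have hadv (s : S) : Integrable (fun x => (k : ℝ)⁻¹ * -∑ t ∈ Finset.range k,
      advantage M (π t x) (qValue M (π t x) s) (value M (π t x) s) s (πstar s)) μ := by
    refine ((hgap s).sub (hsum s)).congr (Eventually.of_forall fun x => ?_)
    simp only [Pi.sub_apply]
    rw [heq x s]
    ring
  refine le_of_le_add_transition M hopt.1
    (f := fun s => ∫ x, (avgValue M k (fun t => π t x) s - value M πstar s) ∂μ) (fun s => ?_) s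
  have e : ∫ x, M.γ * ∑ s', transition M πstar s s' *
      (avgValue M k (fun t => π t x) s' - value M πstar s') ∂μ =
      M.γ * ∑ s', transition M πstar s s' *
        ∫ x, (avgValue M k (fun t => π t x) s' - value M πstar s') ∂μ := by
    rw [integral_const_mul, integral_finsetSum _ fun s' _ => (hgap s').const_mul _]
    simp_rw [integral_const_mul]
  simp_rw [fun x => heq x s]
  rw [integral_add (hadv s) (hsum s), e]
  exact add_le_add_left (hb s (hadv s)) _

lemma integral_avgValue_sub_le_iSup (H : IsStochasticRun M N w Mh k α ℱ π0 π Qt D0)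
    (hopt : IsOptimal M πstar) (s : S) :
    ∫ x, (avgValue M k (fun t => π t x) s - value M πstar s) ∂μ ≤
      (1 - M.γ)⁻¹ * ⨆ q, ∫ x, avgGap M k (fun t => π t x) q ∂μ :=
  H.integral_avgValue_sub_le hopt (fun q hq =>
    (integral_mono hq (H.integrable_avgGap q) fun _ =>
      le_avgGap H.continuousOn_h q (hopt.1 q)).trans
    (le_ciSup (Finite.bddAbove_range fun q => ∫ x, avgGap M k (fun t => π t x) q ∂μ) q)) s

/-- One factor `(1-γ)⁻¹` is in the statement; the other comes from passing from the gap to the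
averaged value and back to the advantage at the fixed comparator `π*`. -/
lemma iSup_integral_avgGap_le (H : IsStochasticRun M N w Mh k α ℱ π0 π Qt D0)
    (hopt : IsOptimal M πstar) (hL : NoiseL2 M N μ ℱ k π Qt ς σ Qbar) :
    (1 - M.γ)⁻¹ * (⨆ q, ∫ x, avgGap M k (fun t => π t x) q ∂μ) ≤
      (α⁻¹ * D0 + α * (Qbar ^ 2 + Mh ^ 2) + 2 * ς * √k) / ((1 - M.γ) ^ 2 * √k) := by
  have hk := H.k_pos
  have hα := H.α_pos
  have hη := H.η_pos
  have h1 : 0 < √(k : ℝ) := Real.sqrt_pos.2 hk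
  have h2 : √(k : ℝ) ^ 2 = k := Real.sq_sqrt hk.le
  have hγ : 0 < 1 - M.γ := sub_pos.2 M.γ_lt_one
  set b : ℝ := (α⁻¹ * D0 + α * (Qbar ^ 2 + Mh ^ 2) + 2 * ς * √k) / √k with hb
  have key (q : S) : ∫ x, avgGap M k (fun t => π t x) q ∂μ ≤ (1 - M.γ)⁻¹ * b := by
    refine (integral_mono (H.integrable_avgGap q)
      ((H.integrable_avgValue q).sub (integrable_const _)) fun x =>
      avgGap_le_avgValue_sub hopt H.one_le (fun _ ht => H.isPolicy ht x) q).trans ?_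
    refine H.integral_avgValue_sub_le hopt (fun s hs => ?_) q
    obtain ⟨hZi, hZ⟩ := H.integral_sum_dot_noise_le hL s (y := fun t x => πstar s - π t x s)
      (r := 2) (fun t ht => measurable_const.sub (H.measurable_policy_apply ht s))
      fun t ht x => H.norm.sub_le_two (hopt.1 s) (H.isPolicy ht x s)
    have hQ (t : ℕ) (ht : t ∈ Finset.range k) :
        Integrable (fun x => dualNorm N (Qt t x s) ^ 2 + Mh ^ 2) μ :=
      (hL.second_moment t (Finset.mem_range.1 ht) s).1.add (integrable_const _)
    have hQs : ∫ x, ∑ t ∈ Finset.range k, (dualNorm N (Qt t x s) ^ 2 + Mh ^ 2) ∂μ ≤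
        k * (Qbar ^ 2 + Mh ^ 2) := by
      rw [integral_finsetSum _ hQ]
      refine (Finset.sum_le_card_nsmul _ _ (Qbar ^ 2 + Mh ^ 2) fun t ht => ?_).trans_eq
        (by rw [Finset.card_range, nsmul_eq_mul])
      have ht := Finset.mem_range.1 ht
      rw [integral_add (hL.second_moment t ht s).1 (integrable_const _)]
      simpa using (hL.second_moment t ht s).integral_le (ℱ.le t)
    have hQi : Integrable (fun x => ∑ t ∈ Finset.range k,
      (dualNorm N (Qt t x s) ^ 2 + Mh ^ 2)) μ := integrable_finsetSum _ hQ
    calc ∫ x, (k : ℝ)⁻¹ * -∑ t ∈ Finset.range k,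
          advantage M (π t x) (qValue M (π t x) s) (value M (π t x) s) s (πstar s) ∂μ
        ≤ ∫ x, (k : ℝ)⁻¹ * (D0 / (α / √k) + α / √k *
            ∑ t ∈ Finset.range k, (dualNorm N (Qt t x s) ^ 2 + Mh ^ 2) +
              (∑ t ∈ Finset.range k, dot (noise M π Qt t x s) (πstar s - π t x s) + 0)) ∂μ := by
          refine integral_mono hs ((((integrable_const _).add (hQi.const_mul _)).add
            (hZi.add (integrable_const _))).const_mul _) fun x => ?_
          refine mul_le_mul_of_nonneg_left ?_ (by positivity)
          rw [add_zero]
          exact H.neg_sum_advantage_le x s (hopt.1 s)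
      _ ≤ (k : ℝ)⁻¹ * (D0 / (α / √k) + α / √k * (k * (Qbar ^ 2 + Mh ^ 2)) +
            (k * (ς * 2) + 0)) := by
          rw [integral_const_mul, integral_affine_add hQi hZi]
          gcongr
      _ = b := by
          rw [hb, ← h2]
          simp only [Real.sqrt_sq h1.le]
          field_simp
          ring
  have hsup : (⨆ q, ∫ x, avgGap M k (fun t => π t x) q ∂μ) ≤ (1 - M.γ)⁻¹ * b := ciSup_le key
  refine (mul_le_mul_of_nonneg_left hsup (inv_nonneg.2 hγ.le)).trans_eq ?_
  rw [hb]
  field_simp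

omit [Nonempty A] in
lemma avgValue_sub_le (H : IsStochasticRun M N w Mh k α ℱ π0 π Qt D0)
    (hopt : IsOptimal M πstar) (x : Ω) {b : ℝ}
    (hb : ∀ s, (k : ℝ)⁻¹ * -∑ t ∈ Finset.range k,
      advantage M (π t x) (qValue M (π t x) s) (value M (π t x) s) s (πstar s) ≤ b) (s : S) :
    avgValue M k (fun t => π t x) s - value M πstar s ≤ (1 - M.γ)⁻¹ * b :=
  le_of_le_add_transition M hopt.1
    (f := fun s => avgValue M k (fun t => π t x) s - value M πstar s) (fun s =>
      (avgValue_sub_eq hopt.1 H.one_le (π := fun t => π t x) (fun _ ht => H.isPolicy ht x) s).le.trans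
        (add_le_add_left (hb s) _)) s

omit [Nonempty A] in
lemma avgValue_sub_le_iSup (H : IsStochasticRun M N w Mh k α ℱ π0 π Qt D0)
    (hopt : IsOptimal M πstar) (x : Ω) (s : S) :
    avgValue M k (fun t => π t x) s - value M πstar s ≤
      (1 - M.γ)⁻¹ * ⨆ q, avgGap M k (fun t => π t x) q :=
  H.avgValue_sub_le hopt x (fun q => (le_avgGap H.continuousOn_h q (hopt.1 q)).trans
    (le_ciSup (Finite.bddAbove_range fun q => avgGap M k (fun t => π t x) q) q)) s

lemma iSup_avgGap_le (H : IsStochasticRun M N w Mh k α ℱ π0 π Qt D0)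
    (hopt : IsOptimal M πstar) (x : Ω) {b : ℝ}
    (hb : ∀ s, (k : ℝ)⁻¹ * -∑ t ∈ Finset.range k,
      advantage M (π t x) (qValue M (π t x) s) (value M (π t x) s) s (πstar s) ≤ b) :
    ⨆ q, avgGap M k (fun t => π t x) q ≤ (1 - M.γ)⁻¹ * b :=
  ciSup_le fun q => (avgGap_le_avgValue_sub hopt H.one_le (fun _ ht => H.isPolicy ht x) q).trans
    (H.avgValue_sub_le hopt x hb q)

end OptimalityGap

/-! ### Noise bounds with high probability -/

section HighProbability

omit [Nonempty S] [Nonempty A]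

omit [IsProbabilityMeasure μ] in
lemma integrable_estimate_of_noiseExp (H : IsStochasticRun M N w Mh k α ℱ π0 π Qt D0)
    (hE : NoiseExp M N μ ℱ k π Qt ς σ Qbar) {t : ℕ} (ht : t < k) (s : S) (a : A) :
    Integrable (fun x => Qt t x s a) μ := by
  refine H.integrable_of_measurable_of_dualNorm_le ht s
    ((hE.second_moment t ht s).1.const_mul Qbar) (fun x => ?_) a
  have hQ := hE.Qbar_pos
  have h1 := Real.add_one_le_exp (dualNorm N (Qt t x s) ^ 2 / Qbar ^ 2)
  rw [← div_pow] at h1 ⊢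
  have h2 : dualNorm N (Qt t x s) / Qbar ≤ Real.exp ((dualNorm N (Qt t x s) / Qbar) ^ 2) := by
    nlinarith [sq_nonneg (dualNorm N (Qt t x s) / Qbar - 1)]
  rw [div_le_iff₀ hQ] at h2
  linarith

/-- Concentration of the accumulated noise in a predictable direction. -/
lemma measureReal_lt_abs_sum_dot_noise_le (H : IsStochasticRun M N w Mh k α ℱ π0 π Qt D0)
    (hE : NoiseExp M N μ ℱ k π Qt ς σ Qbar) (hςσ : ς ≤ σ / k) (s : S) {y : ℕ → Ω → A → ℝ}
    (hy : ∀ t < k, Measurable[ℱ t] (y t)) {r : ℝ} (hr0 : 0 < r)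
    (hr : ∀ t < k, ∀ x, N (y t x) ≤ r) {l : ℝ} (hl : Real.log 2 ≤ l) :
    μ.real {x | r * σ * √(3 * k * l) <
      |∑ t ∈ Finset.range k, dot (noise M π Qt t x s) (y t x)|} ≤ 2 * Real.exp (-l) := by
  have hσ := hE.σ_pos
  have hrσ : 0 < r * σ := mul_pos hr0 hσ
  set X : ℕ → Ω → ℝ := fun t x => dot (noise M π Qt t x s) (y t x) with hX
  have hmeas (t : ℕ) (ht : t < k) : Measurable[ℱ (t + 1)] (X t) :=
    H.measurable_dot_noise ht s (hy t ht)
  have hmeas' (t : ℕ) (ht : t < k) : Measurable[ℱ (t + 1)] fun x => (r * σ)⁻¹ * X t x :=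
    (hmeas t ht).const_mul _
  -- Dividing by `r * σ` normalizes the tail and turns the bias `ς * r` into `ς / σ ≤ 1 / k`.
  have h := measureReal_sqrt_lt_abs_sum_le (μ := μ) (ℱ := ℱ) H.one_le
    (X := fun t x => (r * σ)⁻¹ * X t x) hmeas' (fun t ht => ?_) (fun t ht => ?_) hl
  · refine (measureReal_mono fun x hx => ?_).trans h
    have hx : r * σ * √(3 * k * l) < |∑ t ∈ Finset.range k, X t x| := hx
    change √(3 * k * l) < |∑ t ∈ Finset.range k, (r * σ)⁻¹ * X t x|
    rw [← Finset.mul_sum, abs_mul, abs_of_pos (inv_pos.2 hrσ), inv_mul_eq_div, lt_div_iff₀ hrσ]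
    linarith
  · refine (hE.variance t ht s).mono (Real.measurable_exp.comp
      (((hmeas' t ht).mono (ℱ.le _) le_rfl).pow_const 2)).aestronglyMeasurable
      (fun x => (Real.exp_pos _).le) fun x => Real.exp_le_exp.2 ?_
    rw [mul_pow, inv_pow, inv_mul_eq_div, div_le_div_iff₀ (by positivity) (by positivity)]
    have h1 : X t x ^ 2 ≤ (dualNorm N (noise M π Qt t x s) * r) ^ 2 := by
      rw [← sq_abs]
      exact pow_le_pow_left₀ (abs_nonneg _) (H.abs_dot_noise_le t s (hr t ht) x) 2
    calc X t x ^ 2 * σ ^ 2 ≤ (dualNorm N (noise M π Qt t x s) * r) ^ 2 * σ ^ 2 := by gcongr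
      _ = dualNorm N (noise M π Qt t x s) ^ 2 * (r * σ) ^ 2 := by ring
  · filter_upwards [H.abs_condExp_dot_noise_le hE.ς_nonneg hE.bias ht s
      (H.integrable_estimate_of_noiseExp hE ht s) (hy t ht) (hr t ht),
      condExp_smul (μ := μ) (r * σ)⁻¹ (X t) (ℱ t)] with x hx1 hx2
    change (μ[fun x => (r * σ)⁻¹ * X t x | ℱ t]) x = _ at hx2
    rw [hx2, Pi.smul_apply, smul_eq_mul, abs_mul, abs_of_pos (inv_pos.2 hrσ), inv_mul_eq_div,
      div_le_iff₀ hrσ]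
    refine hx1.trans ((mul_le_mul_of_nonneg_right hςσ hr0.le).trans_eq ?_)
    ring

/-- The shift `k * log 2` in the threshold cancels the factor `2 ^ k` of the moment bound. -/
lemma measureReal_le_sum_sq_div_le {Y : ℕ → Ω → ℝ} {c : ℝ}
    (hmeas : ∀ t < k, Measurable[ℱ (t + 1)] (Y t))
    (h : ∀ t < k, CondExpLE μ (ℱ t) (fun x => Real.exp (Y t x ^ 2 / c ^ 2)) 2) (l : ℝ) :
    μ.real {x | k * Real.log 2 + l ≤ ∑ t ∈ Finset.range k, Y t x ^ 2 / c ^ 2} ≤ Real.exp (-l) := by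
  refine (measureReal_le_sum_le (ℱ := ℱ) (fun t ht => ((hmeas t ht).pow_const 2).div_const _) h
    _).trans_eq ?_
  rw [neg_add, Real.exp_add, ← mul_assoc, Real.exp_neg, Real.exp_nat_mul,
    Real.exp_log (by norm_num), mul_inv_cancel₀ (by positivity), one_mul]

lemma measurable_dualNorm_estimate (H : IsStochasticRun M N w Mh k α ℱ π0 π Qt D0) {t : ℕ}
    (ht : t < k) (s : S) : Measurable[ℱ (t + 1)] fun x => dualNorm N (Qt t x s) :=
  H.norm.continuous_dualNorm.measurable.comp
    (@measurable_pi_lambda _ _ _ (ℱ (t + 1)) _ _ fun a => H.measurable_estimate t ht s a)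

lemma measurable_dualNorm_noise (H : IsStochasticRun M N w Mh k α ℱ π0 π Qt D0) {t : ℕ}
    (ht : t < k) (s : S) : Measurable[ℱ (t + 1)] fun x => dualNorm N (noise M π Qt t x s) :=
  H.norm.continuous_dualNorm.measurable.comp (H.measurable_noise ht s)

end HighProbability

end IsStochasticRun

/-! ### Numerical rates and union bounds over states -/

namespace IsStochasticRun

variable {S A Ω : Type*} [Fintype S] [Nonempty S] [Fintype A] [Nonempty A]
  [mΩ : MeasurableSpace Ω] {μ : Measure Ω} [IsProbabilityMeasure μ]
  {M : MDP S A} {N : Seminorm ℝ (A → ℝ)} {w : (A → ℝ) → ℝ} {Mh : ℝ} {k : ℕ} {α : ℝ}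
  {ℱ : Filtration ℕ mΩ} {π0 : S → A → ℝ} {π Qt : ℕ → Ω → S → A → ℝ} {D0 : ℝ}
  {ς σ Qbar : ℝ} {πstar : S → A → ℝ}

omit [Nonempty S] [IsProbabilityMeasure μ] in
lemma measureReal_exists_le {p : S → Ω → Prop} {b δ : ℝ} (h : ∀ s, μ.real {x | p s x} ≤ b)
    (hb : Fintype.card S * b ≤ δ) : μ.real {x | ∃ s, p s x} ≤ δ := by
  rw [Set.ofPred_exists]
  refine (measureReal_iUnion_fintype_le _).trans (le_trans ?_ hb)
  calc ∑ s, μ.real {x | p s x} ≤ ∑ _s : S, b := Finset.sum_le_sum fun s _ => h s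
    _ = Fintype.card S * b := by simp

omit [IsProbabilityMeasure μ] in
lemma measureReal_or_le {p q : Ω → Prop} {a b : ℝ} (hp : μ.real {x | p x} ≤ a)
    (hq : μ.real {x | q x} ≤ b) : μ.real {x | p x ∨ q x} ≤ a + b :=
  (measureReal_union_le {x | p x} {x | q x}).trans (add_le_add hp hq)

lemma exp_neg_log_mul_card_div {c δ : ℝ} (hc : 0 < c) (hδ : 0 < δ) :
    Fintype.card S * Real.exp (-Real.log (c * Fintype.card S / δ)) = δ / c := by
  have hS : (0 : ℝ) < Fintype.card S := by exact_mod_cast Fintype.card_pos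
  rw [Real.exp_neg, Real.exp_log (by positivity)]
  field_simp

lemma log_two_le_log_mul_card_div {c δ : ℝ} (hc : 2 ≤ c) (hδ : 0 < δ) (hδ1 : δ ≤ 1) :
    Real.log 2 ≤ Real.log (c * Fintype.card S / δ) := by
  have hS : (1 : ℝ) ≤ Fintype.card S := by exact_mod_cast Fintype.card_pos
  refine Real.log_le_log (by norm_num) ?_
  rw [le_div_iff₀ hδ]
  nlinarith

/-- The numerical estimate that converts the deviation bounds into the stated rate. -/
lemma rate_le {ρ D L Q : ℝ} (hρ : 1 ≤ ρ) (hα : 0 < α) (hL : 0 ≤ L)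
    (hQ : Q ≤ Qbar ^ 2 * (ρ ^ 2 * Real.log 2 + L) + ρ ^ 2 * Mh ^ 2) {z : ℝ}
    (hz : z ≤ 2 * σ * (ρ * √(3 * L))) :
    (ρ ^ 2)⁻¹ * (D / (α / ρ) + α / ρ * Q + z) ≤
      (α⁻¹ * D + 2 * α * (Qbar ^ 2 + Mh ^ 2) + 12 * α * (Qbar ^ 2 / ρ + σ ^ 2) * L + α⁻¹) / ρ := by
  have hρ0 : 0 < ρ := by linarith
  have hlog : Real.log 2 ≤ 1 := by linarith [Real.log_two_lt_d9]
  -- Weighted AM-GM; this is the origin of the isolated summand `α⁻¹` in the rate.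
  have hu : 2 * σ * √(3 * L) ≤ α⁻¹ + 12 * α * σ ^ 2 * L := by
    have h1 : √(3 * L) ^ 2 = 3 * L := Real.sq_sqrt (by positivity)
    have h2 : 0 ≤ α⁻¹ * (1 - α * σ * √(3 * L)) ^ 2 := by positivity
    have h3 : α⁻¹ * (1 - α * σ * √(3 * L)) ^ 2 =
        α⁻¹ - 2 * σ * √(3 * L) + α * σ ^ 2 * √(3 * L) ^ 2 := by
      field_simp; ring
    have h4 : 0 ≤ α * σ ^ 2 * L := by positivity
    rw [h3, h1] at h2
    linarith
  have hQ' : α / ρ * Q ≤ ρ * (2 * α * (Qbar ^ 2 + Mh ^ 2) + 12 * α * (Qbar ^ 2 / ρ) * L) := by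
    have h1 : α / ρ * Q ≤ α / ρ * (Qbar ^ 2 * (ρ ^ 2 * Real.log 2 + L) + ρ ^ 2 * Mh ^ 2) := by
      gcongr
    have h2 : α / ρ * (Qbar ^ 2 * (ρ ^ 2 * Real.log 2 + L) + ρ ^ 2 * Mh ^ 2) =
        ρ * (α * (Qbar ^ 2 * Real.log 2 + Mh ^ 2)) + α * (Qbar ^ 2 / ρ) * L := by
      field_simp; ring
    have h3 : ρ * (α * (Qbar ^ 2 * Real.log 2 + Mh ^ 2)) ≤ ρ * (2 * α * (Qbar ^ 2 + Mh ^ 2)) := by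
      refine mul_le_mul_of_nonneg_left ?_ hρ0.le
      have : Qbar ^ 2 * Real.log 2 ≤ Qbar ^ 2 * 1 := by gcongr
      nlinarith [mul_nonneg hα.le (sq_nonneg Qbar), mul_nonneg hα.le (sq_nonneg Mh)]
    have h4 : 0 ≤ α * (Qbar ^ 2 / ρ) * L := by positivity
    nlinarith
  rw [inv_mul_eq_div, div_le_div_iff₀ (by positivity) hρ0]
  have e : D / (α / ρ) = ρ * (α⁻¹ * D) := by field_simp
  have hz' : z ≤ ρ * (α⁻¹ + 12 * α * σ ^ 2 * L) := by
    refine hz.trans ?_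
    rw [mul_left_comm]
    exact mul_le_mul_of_nonneg_left hu hρ0.le
  rw [e]
  have h5 : ρ * (α⁻¹ * D) + α / ρ * Q + z ≤ ρ * (α⁻¹ * D + 2 * α * (Qbar ^ 2 + Mh ^ 2) +
      12 * α * (Qbar ^ 2 / ρ + σ ^ 2) * L + α⁻¹) := by linarith
  calc _ ≤ ρ * (α⁻¹ * D + 2 * α * (Qbar ^ 2 + Mh ^ 2) +
      12 * α * (Qbar ^ 2 / ρ + σ ^ 2) * L + α⁻¹) * ρ := by gcongr
    _ = _ := by ring

/-- The numerical estimate behind the deviation bound for the noisy gap. -/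
lemma gap_rate_le {ρ D L L' Q : ℝ} (hρ : 1 ≤ ρ) (hα : 0 < α) (hσ : 0 ≤ σ) (hD : 0 ≤ D)
    (hL : 0 ≤ L) (hLL : L ≤ L') (hQ : Q ≤ σ ^ 2 * (ρ ^ 2 * Real.log 2 + L)) {z : ℝ}
    (hz : z ≤ 2 * σ * (ρ * √(3 * L))) :
    (ρ ^ 2)⁻¹ * (D / (α / ρ) + α / ρ / 2 * Q + z) ≤
      (2 * (α⁻¹ * D + α * σ ^ 2) + 4 * σ * √(3 * L) + 24 * α * σ ^ 2 * L') / ρ := by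
  have hρ0 : 0 < ρ := by linarith
  have hlog : Real.log 2 ≤ 1 := by linarith [Real.log_two_lt_d9]
  have hQ' : α / ρ / 2 * Q ≤ ρ * (α * σ ^ 2 + α * σ ^ 2 * L') := by
    have h1 : α / ρ / 2 * Q ≤ α / ρ / 2 * (σ ^ 2 * (ρ ^ 2 * 1 + L')) := by
      refine mul_le_mul_of_nonneg_left (hQ.trans ?_) (by positivity)
      gcongr
    have h2 : α / ρ / 2 * (σ ^ 2 * (ρ ^ 2 * 1 + L')) =
        ρ * (α * σ ^ 2 / 2) + (α * σ ^ 2 * L' / 2) / ρ := by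
      field_simp
    have h3 : 0 ≤ α * σ ^ 2 := by positivity
    have h4 : 0 ≤ α * σ ^ 2 * L' := mul_nonneg h3 (hL.trans hLL)
    have h5 : (α * σ ^ 2 * L' / 2) / ρ ≤ α * σ ^ 2 * L' / 2 := div_le_self (by positivity) hρ
    nlinarith
  rw [inv_mul_eq_div, div_le_div_iff₀ (by positivity) hρ0]
  have e : D / (α / ρ) = ρ * (α⁻¹ * D) := by field_simp
  rw [e]
  have h6 : 0 ≤ α⁻¹ * D := by positivity
  have h7 : 0 ≤ σ * √(3 * L) := by positivity
  have h8 : 0 ≤ α * σ ^ 2 := by positivity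
  have h9 : 0 ≤ α * σ ^ 2 * L' := mul_nonneg h8 (hL.trans hLL)
  have h5 : ρ * (α⁻¹ * D) + α / ρ / 2 * Q + z ≤
      ρ * (2 * (α⁻¹ * D + α * σ ^ 2) + 4 * σ * √(3 * L) + 24 * α * σ ^ 2 * L') := by
    nlinarith
  calc _ ≤ ρ * (2 * (α⁻¹ * D + α * σ ^ 2) + 4 * σ * √(3 * L) + 24 * α * σ ^ 2 * L') * ρ := by
        gcongr
    _ = _ := by ring

lemma sqrt_three_mul_nat (k : ℕ) (l : ℝ) : √(3 * k * l) = √k * √(3 * l) := by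
  rw [← Real.sqrt_mul (Nat.cast_nonneg k)]
  congr 1
  ring

omit [Nonempty S] [Nonempty A] in
lemma one_le_sqrt (H : IsStochasticRun M N w Mh k α ℱ π0 π Qt D0) : 1 ≤ √(k : ℝ) :=
  Real.one_le_sqrt.2 (by exact_mod_cast H.one_le)

lemma measureReal_iSup_avgGap_gt_le (H : IsStochasticRun M N w Mh k α ℱ π0 π Qt D0)
    (hopt : IsOptimal M πstar) (hE : NoiseExp M N μ ℱ k π Qt ς σ Qbar) (hςσ : ς ≤ σ / k)
    {δ : ℝ} (hδ : 0 < δ) (hδ1 : δ ≤ 1) :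
    μ.real {x | (1 - M.γ)⁻¹ * (⨆ q, avgGap M k (fun t => π t x) q) >
        (α⁻¹ * D0 + 2 * α * (Qbar ^ 2 + Mh ^ 2) +
          12 * α * (Qbar ^ 2 / √k + σ ^ 2) * Real.log (4 * Fintype.card S / δ) + α⁻¹) /
          ((1 - M.γ) ^ 2 * √k)} ≤ δ := by
  set L := Real.log (4 * Fintype.card S / δ) with hL
  have hL2 : Real.log 2 ≤ L := log_two_le_log_mul_card_div (by norm_num) hδ hδ1
  have hL0 : 0 ≤ L := (Real.log_nonneg (by norm_num)).trans hL2
  have hcard := exp_neg_log_mul_card_div (S := S) (c := 4) (by norm_num) hδ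
  have hρ := H.one_le_sqrt
  have hk2 : √(k : ℝ) ^ 2 = k := Real.sq_sqrt H.k_pos.le
  have hγ : 0 < 1 - M.γ := sub_pos.2 M.γ_lt_one
  have hQ := hE.Qbar_pos
  -- Per state, the bad events are a large noise sum in the direction `π* - π_t` (`2 e^{-L}`) and
  -- large estimates (`e^{-L}`). Over all states this costs `3δ/4`.
  refine (measureReal_mono (s₂ := {x | ∃ s,
    2 * σ * √(3 * k * L) < |∑ t ∈ Finset.range k, dot (noise M π Qt t x s) (πstar s - π t x s)| ∨
    k * Real.log 2 + L ≤ ∑ t ∈ Finset.range k, dualNorm N (Qt t x s) ^ 2 / Qbar ^ 2}) ?_).trans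
    (measureReal_exists_le (b := 2 * Real.exp (-L) + Real.exp (-L)) (fun s => ?_) ?_)
  · intro x hx
    by_contra hcon
    simp only [Set.mem_ofPred_eq, not_exists, not_or, not_lt, not_le] at hcon
    rw [Set.mem_ofPred_eq] at hx
    refine not_le_of_gt hx ?_
    have hb := H.iSup_avgGap_le hopt x (b := (α⁻¹ * D0 + 2 * α * (Qbar ^ 2 + Mh ^ 2) +
      12 * α * (Qbar ^ 2 / √k + σ ^ 2) * L + α⁻¹) / √k) fun s => by
        obtain ⟨h1, h2⟩ := hcon s
        refine (mul_le_mul_of_nonneg_left (H.neg_sum_advantage_le x s (hopt.1 s))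
          (by positivity)).trans ?_
        have h3 := rate_le (α := α) (Mh := Mh) (Qbar := Qbar) (σ := σ) (D := D0) (L := L)
          (ρ := √(k : ℝ)) (Q := ∑ t ∈ Finset.range k, (dualNorm N (Qt t x s) ^ 2 + Mh ^ 2))
          hρ H.α_pos hL0 ?_ (z := ∑ t ∈ Finset.range k,
            dot (noise M π Qt t x s) (πstar s - π t x s)) ?_
        · rwa [hk2] at h3
        · rw [hk2, Finset.sum_add_distrib, Finset.sum_const, Finset.card_range, nsmul_eq_mul]
          refine add_le_add_left ?_ _
          rw [← Finset.sum_div, div_lt_iff₀ (by positivity)] at h2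
          linarith
        · rw [sqrt_three_mul_nat] at h1
          exact (le_abs_self _).trans h1
    refine (mul_le_mul_of_nonneg_left hb (inv_nonneg.2 hγ.le)).trans_eq ?_
    field_simp
  · exact measureReal_or_le (H.measureReal_lt_abs_sum_dot_noise_le hE hςσ s
      (fun t ht => measurable_const.sub (H.measurable_policy_apply ht s)) (by norm_num)
      (fun t ht x => H.norm.sub_le_two (hopt.1 s) (H.isPolicy ht x s)) hL2)
      (measureReal_le_sum_sq_div_le (fun t ht => H.measurable_dualNorm_estimate ht s)
        (fun t ht => hE.second_moment t ht s) L)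
  · rw [← hL] at hcard
    linarith

omit [Nonempty A] in
lemma measureReal_exists_abs_avgValue_sub_gt_le (H : IsStochasticRun M N w Mh k α ℱ π0 π Qt D0)
    (hE : NoiseExp M N μ ℱ k π Qt ς σ Qbar) (hςσ : ς ≤ σ / k) {δ : ℝ} (hδ : 0 < δ) (hδ1 : δ ≤ 1) :
    μ.real {x | ∃ s, |avgValue M k (fun t => π t x) s -
        noisyAvgValue k (fun t => π t x) (fun t => Qt t x) s| >
        σ * √(3 * Real.log (2 * Fintype.card S / δ) / k)} ≤ δ := by
  set L := Real.log (2 * Fintype.card S / δ) with hL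
  have hL2 : Real.log 2 ≤ L := log_two_le_log_mul_card_div le_rfl hδ hδ1
  have hcard := exp_neg_log_mul_card_div (S := S) (c := 2) (by norm_num) hδ
  have hk := H.k_pos
  refine measureReal_exists_le (b := 2 * Real.exp (-L)) (fun s => ?_) ?_
  · refine (measureReal_mono fun x hx => ?_).trans
      (H.measureReal_lt_abs_sum_dot_noise_le hE hςσ s (y := fun t x => π t x s)
        (fun t ht => H.measurable_policy_apply ht s) one_pos
        (fun t ht x => H.norm.le_one _ (H.isPolicy ht x s)) hL2)
    have hx : σ * √(3 * L / k) < |avgValue M k (fun t => π t x) s -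
      noisyAvgValue k (fun t => π t x) (fun t => Qt t x) s| := hx
    rw [H.avgValue_sub_noisyAvgValue, abs_neg, abs_mul, abs_of_pos (inv_pos.2 hk),
      inv_mul_eq_div, lt_div_iff₀ hk] at hx
    refine lt_of_eq_of_lt ?_ hx
    have h1 : √(3 * k * L) = √(3 * L / k) * k := by
      rw [show 3 * k * L = 3 * L / k * (k : ℝ) ^ 2 by field_simp, Real.sqrt_mul' _ (sq_nonneg _),
        Real.sqrt_sq hk.le]
    rw [h1]
    ring
  · rw [← hL] at hcard
    linarith

lemma measureReal_exists_abs_avgGap_sub_gt_le (H : IsStochasticRun M N w Mh k α ℱ π0 π Qt D0)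
    (hD0 : 0 ≤ D0) (hE : NoiseExp M N μ ℱ k π Qt ς σ Qbar) (hςσ : ς ≤ σ / k) {δ : ℝ} (hδ : 0 < δ)
    (hδ1 : δ ≤ 1) :
    μ.real {x | ∃ s, |avgGap M k (fun t => π t x) s -
        noisyAvgGap M k (fun t => π t x) (fun t => Qt t x) s| >
        (2 * (α⁻¹ * D0 + α * σ ^ 2) + 4 * σ * √(3 * Real.log (8 * Fintype.card S / δ)) +
          24 * α * σ ^ 2 * Real.log (16 * Fintype.card S / δ)) / √k} ≤ δ := by
  set L := Real.log (8 * Fintype.card S / δ) with hL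
  have hL2 : Real.log 2 ≤ L := log_two_le_log_mul_card_div (by norm_num) hδ hδ1
  have hL0 : 0 ≤ L := (Real.log_nonneg (by norm_num)).trans hL2
  have hcard := exp_neg_log_mul_card_div (S := S) (c := 8) (by norm_num) hδ
  have hLL : L ≤ Real.log (16 * Fintype.card S / δ) := by
    have hS : (0 : ℝ) < Fintype.card S := by exact_mod_cast Fintype.card_pos
    refine Real.log_le_log (by positivity) ?_
    gcongr
    norm_num
  have hρ := H.one_le_sqrt
  have hk2 : √(k : ℝ) ^ 2 = k := Real.sq_sqrt H.k_pos.le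
  have hσ := hE.σ_pos
  -- Two noise sums, one for each leader sequence, and one sum of squares: `5 e^{-L}` per state, in
  -- total `5δ/8`.
  refine measureReal_exists_le
    (b := (2 * Real.exp (-L) + 2 * Real.exp (-L)) + Real.exp (-L)) (fun s => ?_) ?_
  · have htail {e : ℝ} (he : |e| = 1) := H.measureReal_lt_abs_sum_dot_noise_le hE hςσ s
      (fun t ht => H.measurable_leader_sub e ht s) (r := 2) (by norm_num)
      (fun t ht => H.norm_leader_sub_le he ht s) hL2
    refine (measureReal_mono fun x hx => ?_).trans (measureReal_or_le (measureReal_or_le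
      (htail (e := 1) (by simp)) (htail (e := -1) (by simp)))
      (measureReal_le_sum_sq_div_le (fun t ht => H.measurable_dualNorm_noise ht s)
        (fun t ht => hE.variance t ht s) L))
    by_contra hcon
    simp only [Set.mem_ofPred_eq, not_or, not_lt, not_le] at hcon
    obtain ⟨⟨h1, h2⟩, h3⟩ := hcon
    rw [Set.mem_ofPred_eq] at hx
    refine not_le_of_gt hx ((H.abs_avgGap_sub_le x s).trans ?_)
    rw [sqrt_three_mul_nat] at h1 h2
    have h4 := gap_rate_le (α := α) (σ := σ) (D := D0) (ρ := √(k : ℝ)) (L := L)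
      (Q := ∑ t ∈ Finset.range k, dualNorm N (noise M π Qt t x s) ^ 2) hρ H.α_pos hσ.le hD0 hL0 hLL
      ?_ (max_le h1 h2)
    · rwa [hk2] at h4
    · rw [← Finset.sum_div, div_lt_iff₀ (by positivity)] at h3
      rw [hk2]
      linarith
  · rw [← hL] at hcard
    linarith

end IsStochasticRun

end SPMD

/-! ### The main theorem -/

theorem mainTheorem9 {S A Ω : Type*} [Fintype S] [Nonempty S] [Fintype A] [Nonempty A]
    [mΩ : MeasurableSpace Ω] (μ : Measure Ω) [IsProbabilityMeasure μ]
    (M : SPMD.MDP S A) (N : Seminorm ℝ (A → ℝ)) (hN : SPMD.IsSimplexNorm N)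
    (w : (A → ℝ) → ℝ) (hw : SPMD.IsDGF N w)
    (h_convex : ∀ s, ConvexOn ℝ (stdSimplex ℝ A) (M.h s))
    (Mh : ℝ) (hMh : 0 ≤ Mh)
    (h_lipschitz : ∀ s, ∀ p ∈ stdSimplex ℝ A, ∀ p' ∈ stdSimplex ℝ A,
      M.h s p - M.h s p' ≤ Mh * N (p - p'))
    (πstar : S → A → ℝ) (h_opt : SPMD.IsOptimal M πstar)
    (k : ℕ) (hk : 1 ≤ k) (α : ℝ) (hα : 0 < α)
    (ℱ : Filtration ℕ mΩ) (π0 : S → A → ℝ) (π Qt : ℕ → Ω → S → A → ℝ)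
    (hπ_meas : ∀ t ≤ k, ∀ s a, Measurable[ℱ t] fun x => π t x s a)
    (hQt_meas : ∀ t < k, ∀ s a, Measurable[ℱ (t + 1)] fun x => Qt t x s a)
    (h_run : ∀ x, SPMD.IsRun M w (α / √k) k π0 (fun t => π t x) (fun t => Qt t x))
    (D0 : ℝ) (hD0 : 0 < D0)
    (hD0_bound : ∀ s, ∀ p ∈ stdSimplex ℝ A, SPMD.bregman w (π0 s) p ≤ D0) :
    let V : Ω → S → ℝ := fun x => SPMD.avgValue M k (fun t => π t x)
    let Vn : Ω → S → ℝ := fun x => SPMD.noisyAvgValue k (fun t => π t x) (fun t => Qt t x)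
    let G : Ω → S → ℝ := fun x => SPMD.avgGap M k (fun t => π t x)
    let Gn : Ω → S → ℝ := fun x => SPMD.noisyAvgGap M k (fun t => π t x) (fun t => Qt t x)
    (∀ ς σ Qbar : ℝ, SPMD.NoiseL2 M N μ ℱ k π Qt ς σ Qbar →
      (∀ s, Integrable (fun x => V x s) μ ∧ Integrable (fun x => G x s) μ ∧
        Integrable (fun x => Vn x s) μ ∧ Integrable (fun x => Gn x s) μ) ∧
      (∀ s, ∫ x, (V x s - SPMD.value M πstar s) ∂μ ≤ (1 - M.γ)⁻¹ * (⨆ q, ∫ x, G x q ∂μ)) ∧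
      (1 - M.γ)⁻¹ * (⨆ q, ∫ x, G x q ∂μ) ≤
        (α⁻¹ * D0 + α * (Qbar ^ 2 + Mh ^ 2) + 2 * ς * √k) / ((1 - M.γ) ^ 2 * √k) ∧
      (∀ s, ∫ x, |V x s - Vn x s| ∂μ ≤ σ / √k + ς) ∧
      (∀ s, ∫ x, |G x s - Gn x s| ∂μ ≤
        (α⁻¹ * D0 + α * σ ^ 2 + 4 * √(σ ^ 2 + k * ς ^ 2)) / √k)) ∧
    (∀ ς σ Qbar : ℝ, SPMD.NoiseExp M N μ ℱ k π Qt ς σ Qbar → ς ≤ σ / k →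
      ∀ δ : ℝ, 0 < δ → δ ≤ 1 →
      μ.real {x | ∀ s, V x s - SPMD.value M πstar s ≤ (1 - M.γ)⁻¹ * (⨆ q, G x q)} = 1 ∧
      μ.real {x | (1 - M.γ)⁻¹ * (⨆ q, G x q) >
        (α⁻¹ * D0 + 2 * α * (Qbar ^ 2 + Mh ^ 2) +
          12 * α * (Qbar ^ 2 / √k + σ ^ 2) * Real.log (4 * Fintype.card S / δ) + α⁻¹) /
          ((1 - M.γ) ^ 2 * √k)} ≤ δ ∧
      μ.real {x | ∃ s, |V x s - Vn x s| >
        σ * √(3 * Real.log (2 * Fintype.card S / δ) / k)} ≤ δ ∧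
      μ.real {x | ∃ s, |G x s - Gn x s| >
        (2 * (α⁻¹ * D0 + α * σ ^ 2) + 4 * σ * √(3 * Real.log (8 * Fintype.card S / δ)) +
          24 * α * σ ^ 2 * Real.log (16 * Fintype.card S / δ)) / √k} ≤ δ) := by
  intro V Vn G Gn
  have H : SPMD.IsStochasticRun M N w Mh k α ℱ π0 π Qt D0 :=
    ⟨hN, hw, h_convex, hMh, h_lipschitz, hk, hα, hπ_meas, hQt_meas, h_run, hD0_bound⟩
  refine ⟨fun ς σ Qbar hL => ⟨fun s => ⟨H.integrable_avgValue s, H.integrable_avgGap s,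
    H.integrable_noisyAvgValue (fun t ht s a => H.integrable_estimate hL ht s a) s,
    H.integrable_noisyAvgGap hL s⟩, H.integral_avgValue_sub_le_iSup h_opt,
    H.iSup_integral_avgGap_le h_opt hL, H.integral_abs_avgValue_sub_le hL,
    H.integral_abs_avgGap_sub_le hL⟩, fun ς σ Qbar hE hςσ δ hδ hδ1 => ⟨?_,
    H.measureReal_iSup_avgGap_gt_le h_opt hE hςσ hδ hδ1,
    H.measureReal_exists_abs_avgValue_sub_gt_le hE hςσ hδ hδ1,
    H.measureReal_exists_abs_avgGap_sub_gt_le hD0.le hE hςσ hδ hδ1⟩⟩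
  -- The comparison is pathwise and holds at every sample point, so the event is the whole space.
  have h_univ : {x | ∀ s, V x s - SPMD.value M πstar s ≤ (1 - M.γ)⁻¹ * (⨆ q, G x q)} = Set.univ :=
    Set.eq_univ_of_forall fun x s => H.avgValue_sub_le_iSup h_opt x s
  rw [h_univ, probReal_univ]
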